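/- Let $(\mathcal X,\mathfrak S,\mu)$ be a $\sigma$-finite measure space with an increasing sequence of $\sigma$-algebras $\mathfrak S_n\subset\mathfrak S$, $n\in\mathbb Z$, each of which is atomic: there is a countable disjoint collection $\mathscr D_n\subset\mathfrak S_n$ of sets of positive finite measure such that every $A\in\mathfrak S_n$ is a union of sets from $\mathscr D_n$. No homogeneity is assumed. Put $\mathscr D=\bigcup_n\mathscr D_n$, $|I|=\mu(I)$, $dx=d\mu(x)$, $\langle f\rangle_I=|I|^{-1}\int_I f\,dx$, $\mathbb E_If=\langle f\rangle_I\mathbf 1_I$; all functions are real valued. For $I\in\mathscr D$ the set $\mathrm{ch}(I)$ of its children consists of the $J\in\mathscr D_{n+1}$ with $J\subset I$, where $n$ is the largest integer with $I\in\mathscr D_n$; if $I\in\mathscr D_n$ for all large $n$, then $\mathrm{ch}(I)=\{I\}$. Put $\Delta_If=\sum_{J\in\mathrm{ch}(I)}\mathbb E_Jf-\mathbb E_If$ and $D_I=\Delta_IL^2(\mu)$. Consider operators of the following three kinds. 1. A Haar shift of complexity $1$: $Tf=\sum_{I\in\mathscr D}T_I(\Delta_If)$, where each $T_I$ is a linear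 operator on $D_I$ such that $(T_If,g)_{L^2}\le|I|^{-1}\|f\|_1\|g\|_1$ for all $f,g\in D_I$. (If $\Delta_If$ is only in $L^1$, then $T_I$ is extended by $L^1$-continuity, i.e. $T_I(\Delta_If)=\sum_{J\in\mathrm{ch}(I)}\langle f\rangle_JT_I(\Delta_I\mathbf 1_J)$.) 2. A sparse operator: $Tf=\sum_{I\in\mathcal Q}\langle f\rangle_I\mathbf 1_I$, where $\mathcal Q\subset\mathscr D$ satisfies $\bigl|\bigcup_{I\in\mathcal Q,\,I\subsetneq I_0}I\bigr|\le\frac12|I_0|$ for all $I_0\in\mathcal Q$. 3. A paraproduct: $Tf=\sum_{I\in\mathscr D}\langle f\rangle_Ib_I$, where $b_I\in D_I$ and $\sup_{I\in\mathscr D}|I|^{-1}\sum_{J\in\mathscr D,\,J\subset I}\|b_J\|_\infty^2|J|\le1$. Let $u,v\ge0$ be weights, i.e. measurable functions that are integrable over every $I\in\mathscr D$. Write $\mathbf u_I=\langle u\rangle_I$, and let $\mathbf u^*_I$ be the $L\log L$ norm of $u$ on $I$, namely $$\mathbf u_I^*=\int_0^\infty\psi_0\bigl(|I|^{-1}|\{x\in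 I:u(x)>t\}|\bigr)\,dt,\qquad \psi_0(s)=s\ln(e/s),\quad \psi_0(0)=0;$$ similarly for $v$. Let $\alpha:[1,\infty)\to(0,\infty)$ be such that $t\mapsto t\alpha(t)$ is increasing (not necessarily strictly) and $$C_\alpha:=\frac1{\alpha(1)}+\int_1^\infty\frac{dt}{t\alpha(t)}<\infty .$$ Suppose that $$\sup_{I\in\mathscr D}\ \alpha\bigl(\mathbf u_I^*/\mathbf u_I\bigr)\,\mathbf u_I^*\;\alpha\bigl(\mathbf v_I^*/\mathbf v_I\bigr)\,\mathbf v_I^*\le A<\infty ,$$ where the product is read as $0$ if $\mathbf u_I=0$ or $\mathbf v_I=0$. Then for each such operator $T$ and every $f\in L^2(u)$ the series defining $T(fu)$ converges unconditionally in $L^2(v)$, and $$\int_{\mathcal X}|T(fu)|^2v\,dx\le C\int_{\mathcal X}|f|^2u\,dx,\qquad C=K\,A\,C_\alpha^2,$$ with an absolute constant $K$. In particular $f\mapsto T(fu)$ is bounded from $L^2(u)$ to $L^2(v)$. -/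

import Mathlib

open MeasureTheory Filter Topology Set
open scoped ENNReal NNReal

noncomputable section

/-- A filtration `𝔖 n`, `n ∈ ℤ`, of atomic `σ`-algebras on a measure space: `atoms n` is a countable
disjoint collection of `𝔖 n`-measurable sets of positive (and finite) measure, and every set of
`𝔖 n` is a union of members of `atoms n`. No homogeneity is assumed. -/
structure AtomicFiltration {X : Type*} [mX : MeasurableSpace X] (μ : Measure X) where
  /-- the increasing sequence of `σ`-algebras -/
  sigma : Filtration ℤ mX
  /-- the atoms of generation `n` -/
  atoms : ℤ → Set (Set X)
  countable_atoms : ∀ n, (atoms n).Countable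
  disjoint_atoms : ∀ n, (atoms n).PairwiseDisjoint id
  measurable_atoms : ∀ n, ∀ I ∈ atoms n, MeasurableSet[sigma n] I
  measure_pos : ∀ n, ∀ I ∈ atoms n, 0 < μ I
  measure_lt_top : ∀ n, ∀ I ∈ atoms n, μ I < ∞
  atomic : ∀ n, ∀ A : Set X, MeasurableSet[sigma n] A → ∃ S ⊆ atoms n, A = ⋃₀ S

namespace AtomicFiltration

variable {X : Type*} [mX : MeasurableSpace X] {μ : Measure X} (F : AtomicFiltration μ)

/-- The collection of the atoms of all generations. -/
def lattice : Set (Set X) := ⋃ n : ℤ, F.atoms n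

/-- The children of `I`: the atoms of generation `n + 1` inside `I`, where `n` is the largest
integer such that `I` is an atom of generation `n`; if `I` is an atom of all sufficiently large
generations, its only child is `I`. -/
def children (I : Set X) : Set (Set X) :=
  {J | ∃ n : ℤ, IsGreatest {k : ℤ | I ∈ F.atoms k} n ∧ J ∈ F.atoms (n + 1) ∧ J ⊆ I} ∪
  {J | J = I ∧ ∀ᶠ n : ℤ in atTop, I ∈ F.atoms n}

theorem measurableSet_of_mem_lattice {I : Set X} (hI : I ∈ F.lattice) : MeasurableSet I := by
  obtain ⟨n, hn⟩ := mem_iUnion.1 hI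
  exact F.sigma.le n I (F.measurable_atoms n I hn)

theorem measure_lt_top_of_mem_lattice {I : Set X} (hI : I ∈ F.lattice) : μ I < ∞ := by
  obtain ⟨n, hn⟩ := mem_iUnion.1 hI
  exact F.measure_lt_top n I hn

theorem mem_lattice_of_mem_children {I J : Set X} (hJ : J ∈ F.children I) : J ∈ F.lattice := by
  rcases hJ with ⟨n, -, h, -⟩ | ⟨rfl, h⟩
  · exact mem_iUnion.2 ⟨n + 1, h⟩
  · obtain ⟨n, hn⟩ := h.exists
    exact mem_iUnion.2 ⟨n, hn⟩

theorem disjoint_children {I J K : Set X} (hJ : J ∈ F.children I) (hK : K ∈ F.children I)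
    (h : J ≠ K) : Disjoint J K := by
  rcases hJ with ⟨n, hn, hJ, -⟩ | ⟨rfl, hJ⟩ <;> rcases hK with ⟨m, hm, hK, -⟩ | ⟨rfl, hK⟩
  · obtain rfl := hn.unique hm
    exact F.disjoint_atoms _ hJ hK h
  · obtain ⟨k, hk, hk'⟩ := (hK.and (eventually_gt_atTop n)).exists
    exact absurd (hn.2 hk) (not_le.2 hk')
  · obtain ⟨k, hk, hk'⟩ := (hJ.and (eventually_gt_atTop m)).exists
    exact absurd (hm.2 hk) (not_le.2 hk')
  · exact absurd rfl h

/-- The averaging operator `𝔼_I f = ⟨f⟩_I 1_I`. -/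
def expect (_F : AtomicFiltration μ) (I : Set X) (f : X → ℝ) : X → ℝ :=
  I.indicator fun _ => ⨍ y in I, f y ∂μ

/-- The martingale difference `Δ_I f = ∑_{J ∈ ch(I)} 𝔼_J f - 𝔼_I f`. The children are disjoint, so
at each point at most one term of the sum is nonzero. -/
def mdiff (I : Set X) (f : X → ℝ) : X → ℝ := fun x =>
  (∑' J : F.children I, F.expect J f x) - F.expect I f x

theorem summable_expect (I : Set X) (f : X → ℝ) (x : X) :
    Summable fun J : F.children I => F.expect (J : Set X) f x := by
  apply summable_of_hasFiniteSupport
  apply Set.Subsingleton.finite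
  intro J hJ K hK
  by_contra h
  have hJx : x ∈ (J : Set X) := by
    by_contra hx
    exact hJ (indicator_of_notMem hx _)
  have hKx : x ∈ (K : Set X) := by
    by_contra hx
    exact hK (indicator_of_notMem hx _)
  exact Set.disjoint_left.1
    (F.disjoint_children J.2 K.2 fun h' => h (Subtype.ext h')) hJx hKx

theorem expect_add {I : Set X} (hI : I ∈ F.lattice) {f g : X → ℝ}
    (hf : MemLp f 2 μ) (hg : MemLp g 2 μ) :
    F.expect I (f + g) = F.expect I f + F.expect I g := by
  have : IsFiniteMeasure (μ.restrict I) :=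
    ⟨by simpa using F.measure_lt_top_of_mem_lattice hI⟩
  have hf' : Integrable f (μ.restrict I) := (hf.restrict I).integrable (by norm_num)
  have hg' : Integrable g (μ.restrict I) := (hg.restrict I).integrable (by norm_num)
  funext x
  by_cases hx : x ∈ I
  · simp only [expect, Pi.add_apply, indicator_of_mem hx, setAverage_eq]
    rw [integral_add hf' hg', smul_add]
  · simp [expect, hx]

theorem expect_smul (I : Set X) (c : ℝ) (f : X → ℝ) :
    F.expect I (c • f) = c • F.expect I f := by
  funext x
  by_cases hx : x ∈ I
  · simp only [expect, Pi.smul_apply, indicator_of_mem hx, setAverage_eq]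
    rw [integral_smul, smul_comm]
  · simp [expect, hx]

theorem mdiff_add {I : Set X} (hI : I ∈ F.lattice) {f g : X → ℝ}
    (hf : MemLp f 2 μ) (hg : MemLp g 2 μ) : F.mdiff I (f + g) = F.mdiff I f + F.mdiff I g := by
  funext x
  have h1 : (fun J : F.children I => F.expect (J : Set X) (f + g) x) =
      fun J : F.children I => F.expect (J : Set X) f x + F.expect (J : Set X) g x := by
    funext J
    rw [F.expect_add (F.mem_lattice_of_mem_children J.2) hf hg, Pi.add_apply]
  simp only [mdiff, Pi.add_apply]
  rw [h1, (F.summable_expect I f x).tsum_add (F.summable_expect I g x), F.expect_add hI hf hg,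
    Pi.add_apply]
  ring

theorem mdiff_smul (I : Set X) (c : ℝ) (f : X → ℝ) : F.mdiff I (c • f) = c • F.mdiff I f := by
  funext x
  simp only [mdiff, Pi.smul_apply, expect_smul, smul_eq_mul, tsum_mul_left]
  ring

/-- The space `D_I = Δ_I L²`. -/
def diffSpace (I : F.lattice) : Submodule ℝ (X → ℝ) where
  carrier := {h | ∃ f : X → ℝ, MemLp f 2 μ ∧ F.mdiff I f = h}
  add_mem' := by
    rintro _ _ ⟨f, hf, rfl⟩ ⟨g, hg, rfl⟩
    exact ⟨f + g, hf.add hg, F.mdiff_add I.2 hf hg⟩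
  zero_mem' := ⟨0, MemLp.zero, by simpa using F.mdiff_smul I 0 0⟩
  smul_mem' := by
    rintro c _ ⟨f, hf, rfl⟩
    exact ⟨c • f, hf.const_smul c, F.mdiff_smul I c f⟩

theorem mdiff_indicator_mem (I : F.lattice) {J : Set X} (hJ : J ∈ F.children I) :
    F.mdiff I (J.indicator fun _ => 1) ∈ F.diffSpace I :=
  ⟨_, memLp_indicator_const 2
    (F.measurableSet_of_mem_lattice (F.mem_lattice_of_mem_children hJ)) 1
    (Or.inr (F.measure_lt_top_of_mem_lattice (F.mem_lattice_of_mem_children hJ)).ne), rfl⟩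

/-- A Haar shift of complexity `1`: linear operators `T_I` on `D_I`, one for every atom `I`, with
`(T_I f, g) ≤ |I|⁻¹ ‖f‖₁ ‖g‖₁` for all `f, g ∈ D_I`. -/
structure HaarShift where
  /-- the operators `T_I` -/
  op : ∀ I : F.lattice, F.diffSpace I →ₗ[ℝ] F.diffSpace I
  bound : ∀ (I : F.lattice) (f g : F.diffSpace I),
    ∫ x, (op I f : X → ℝ) x * (g : X → ℝ) x ∂μ ≤
      (μ.real I)⁻¹ * (∫ x, |(f : X → ℝ) x| ∂μ) * ∫ x, |(g : X → ℝ) x| ∂μ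

open Classical in
/-- The term `T_I (Δ_I f)` of a Haar shift. If `f` is only integrable on `I` and `I` has infinitely
many children, `Δ_I f` need not be in `L²`. In that case `T_I` stands for its unique extension by
`L¹`-continuity: `Δ_I f = ∑_{J ∈ ch(I)} ⟨f⟩_J Δ_I 1_J` in `L¹`, hence
`T_I (Δ_I f) = ∑_{J ∈ ch(I)} ⟨f⟩_J T_I (Δ_I 1_J)`. -/
def HaarShift.term {F : AtomicFiltration μ} (T : F.HaarShift) (I : F.lattice) (f : X → ℝ) :
    X → ℝ :=
  if h : F.mdiff I f ∈ F.diffSpace I then T.op I ⟨F.mdiff I f, h⟩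
  else fun x => ∑' J : F.children I, (⨍ y in (J : Set X), f y ∂μ) *
    (T.op I ⟨F.mdiff I ((J : Set X).indicator fun _ => 1), F.mdiff_indicator_mem I J.2⟩ : X → ℝ) x

/-- A sparse family of atoms: the union of the members strictly inside a member `I₀` has
measure at most `|I₀| / 2`. -/
def IsSparse (Q : Set F.lattice) : Prop :=
  ∀ I₀ ∈ Q, μ (⋃ I ∈ {I ∈ Q | (I : Set X) ⊂ I₀}, (I : Set X)) ≤ μ (I₀ : Set X) / 2

/-- The term `⟨f⟩_I 1_I` of a sparse operator. -/
def sparseTerm (I : F.lattice) (f : X → ℝ) : X → ℝ := F.expect I f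

/-- The normalization `sup_I |I|⁻¹ ∑_{J ⊆ I} ‖b_J‖_∞² |J| ≤ 1` of a paraproduct. -/
def IsNormalizedPara (b : ∀ I : F.lattice, F.diffSpace I) : Prop :=
  ∀ I : F.lattice, (μ (I : Set X))⁻¹ * ∑' J : {J : F.lattice // (J : Set X) ⊆ I},
    eLpNorm (b J : X → ℝ) ∞ μ ^ 2 * μ (J : Set X) ≤ 1

/-- The term `⟨f⟩_I b_I` of the paraproduct with symbol `b`. -/
def paraTerm (b : ∀ I : F.lattice, F.diffSpace I) (I : F.lattice) (f : X → ℝ) : X → ℝ :=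
  fun x => (⨍ y in (I : Set X), f y ∂μ) * (b I : X → ℝ) x

/-- A weight: a nonnegative measurable function, integrable over every atom. -/
structure IsWeight (u : X → ℝ) : Prop where
  measurable : Measurable u
  nonneg : ∀ x, 0 ≤ u x
  integrableOn : ∀ I ∈ F.lattice, IntegrableOn u I μ

end AtomicFiltration

/-- The normalized distribution function `N_I(t) = |I|⁻¹ |{x ∈ I : u(x) > t}|`. -/
def distribFn {X : Type*} [MeasurableSpace X] (μ : Measure X) (I : Set X) (u : X → ℝ) (t : ℝ) : ℝ :=
  μ.real {x ∈ I | t < u x} / μ.real I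

/-- The function `ψ₀(s) = s ln(e/s)`, with `ψ₀(0) = 0`. -/
def psiZero (s : ℝ) : ℝ := s * Real.log (Real.exp 1 / s)

/-- The `L log L` norm of `u ≥ 0` on `I` with respect to the normalized measure `dx/|I|`, that is,
the norm of the Lorentz space `Λ_{ψ₀}`: `u*_I = ∫_0^∞ ψ₀(N_I(t)) dt`, possibly infinite. -/
def llogl {X : Type*} [MeasurableSpace X] (μ : Measure X) (I : Set X) (u : X → ℝ) : ℝ≥0∞ :=
  ∫⁻ t in Ioi (0 : ℝ), ENNReal.ofReal (psiZero (distribFn μ I u t))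

open Classical in
/-- The entropy bump `α(u*_I / u_I) u*_I`, where `u_I = ⟨u⟩_I`. It is `∞` if `u*_I = ∞`, and `0` if
`u = 0` almost everywhere on `I`. -/
def entropyBump {X : Type*} [MeasurableSpace X] (μ : Measure X) (α : ℝ → ℝ) (I : Set X)
    (u : X → ℝ) : ℝ≥0∞ :=
  if llogl μ I u = ∞ then ∞
  else ENNReal.ofReal (α ((llogl μ I u).toReal / ⨍ x in I, u x ∂μ)) * llogl μ I u

/-- `α : [1, ∞) → (0, ∞)` is such that `t ↦ t α(t)` is increasing and `∫_1^∞ dt / (t α(t)) < ∞`. -/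
structure IsPenalty (α : ℝ → ℝ) : Prop where
  pos : ∀ t, 1 ≤ t → 0 < α t
  mono : MonotoneOn (fun t => t * α t) (Ici 1)
  integrable : IntegrableOn (fun t => 1 / (t * α t)) (Ioi 1)

/-- `C_α = 1/α(1) + ∫_1^∞ dt / (t α(t))`. -/
def penaltyConst (α : ℝ → ℝ) : ℝ := 1 / α 1 + ∫ t in Ioi (1 : ℝ), 1 / (t * α t)

/-- The measure `u dμ`. -/
def weighted {X : Type*} [MeasurableSpace X] (μ : Measure X) (u : X → ℝ) : Measure X :=
  μ.withDensity fun x => ENNReal.ofReal (u x)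

/-- For the operator `T = ∑_{i ∈ ι} T_i` with terms `T_i = term i`: for every `f ∈ L²(u)` the series
`T(fu) = ∑ T_i(fu)` converges unconditionally in `L²(v)`, and its sum `g` satisfies
`∫ |g|² v dμ ≤ C ∫ |f|² u dμ`. -/
def TwoWeightBound {X : Type*} [MeasurableSpace X] (μ : Measure X) {ι : Type*}
    (term : ι → (X → ℝ) → X → ℝ) (u v : X → ℝ) (C : ℝ) : Prop :=
  ∀ f : X → ℝ, MemLp f 2 (weighted μ u) →
    ∃ g : X → ℝ, MemLp g 2 (weighted μ v) ∧
      (∀ i, MemLp (term i fun y => f y * u y) 2 (weighted μ v)) ∧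
      Tendsto (fun s : Finset ι =>
        eLpNorm (fun x => g x - ∑ i ∈ s, term i (fun y => f y * u y) x) 2 (weighted μ v))
        atTop (𝓝 0) ∧
      ∫ x, g x ^ 2 * v x ∂μ ≤ C * ∫ x, f x ^ 2 * u x ∂μ

end

noncomputable section

/-! ### The tree of atoms: nesting, children, and induction over generations. -/

namespace AtomicFiltration

variable {X : Type*} [mX : MeasurableSpace X] {μ : Measure X} (F : AtomicFiltration μ)

/-! By duality `T(fu)` is tested against `hv`. For all three kinds of operators the pairing on one
atom `I` is at most `P_I(fu) R_I(hv) / |I|`. Here each of `P_I`, `R_I` is a multiple either of the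
`L¹` norm `‖Δ_I ·‖₁` (shifts on both sides, paraproducts on the side of `v`) or of `|∫_I ·|` (sparse
operators on both sides, paraproducts on the side of `u`). The bump condition and Cauchy–Schwarz
over the atoms separate the two weights (`twoWeightBound_of_pairing`). What remains are one-weight
sums of `P_I(fu)² / (|I| α(u*_I/u_I) u*_I)`, to be bounded by a multiple of `C_α ‖f‖²` in `L²(u)`.

For differences (`IsWeight.sum_diffNorm_mul_sq_le`), `Δ_I(fu)` splits into a part given by the
martingale difference of `f` with respect to `u dμ`, summed by orthogonality in `L²(u)`, and the
average of `f` over `u dμ` times `Δ_I u`, summed by the Carleson embedding theorem. For averages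
(`IsWeight.sum_average_mul_sq_le`) the embedding theorem alone suffices. Both need a Carleson
condition: the sum over `J ⊆ I` of `d_J / (|J| α(u*_J/u_J) u*_J)` is at most a multiple of `C_α
u(I)`, with `d_J = ‖Δ_J u‖₁²` or `d_J = a_J u(J)²`.

`CarlesonBound.div_entropyBump` derives this from the simpler bound of the sum of `d_J / u(J)` by a
multiple of `|I| u*_I`. The atoms are sorted by the dyadic size `2^k` of `u*_J/u_J`. Dividing by the
bump gains `1/(2^k α(2^k))`, the `L log L` bound on the maximal atoms of the class loses `2^(k+1)`,
and the sum over `k` is a dyadic form of `C_α`.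

The `L log L` bounds reduce to indicators of the sets `E = {u > t}`, because `u*_I` is an integral
over `t` of `ψ₀` of their densities. For differences, the entropy `-m ln m` of the density drops
from an atom to its children by an amount that controls `‖Δ_J 1_E‖₁²` (a Pinsker inequality), and
the drops telescope. For averages, the weak type bound for the densities is integrated over the
level, and `∫_0^1 min(1, p/t) dt = ψ₀(p)`.

No step compares an atom with its children in measure, so homogeneity plays no role. -/

theorem atoms_subset_lattice (n : ℤ) : F.atoms n ⊆ F.lattice := subset_iUnion F.atoms n

theorem exists_mem_atoms {I : Set X} (hI : I ∈ F.lattice) : ∃ n, I ∈ F.atoms n := mem_iUnion.1 hI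

theorem measure_pos_of_mem_lattice {I : Set X} (hI : I ∈ F.lattice) : 0 < μ I := by
  obtain ⟨n, hn⟩ := F.exists_mem_atoms hI
  exact F.measure_pos n I hn

theorem nonempty_of_mem_lattice {I : Set X} (hI : I ∈ F.lattice) : I.Nonempty :=
  nonempty_of_measure_ne_zero (F.measure_pos_of_mem_lattice hI).ne'

theorem measureReal_pos_of_mem_lattice {I : Set X} (hI : I ∈ F.lattice) : 0 < μ.real I :=
  ENNReal.toReal_pos (F.measure_pos_of_mem_lattice hI).ne' (F.measure_lt_top_of_mem_lattice hI).ne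

theorem exists_atom_mem (n : ℤ) (x : X) : ∃ I ∈ F.atoms n, x ∈ I := by
  obtain ⟨S, hS, h⟩ := F.atomic n univ MeasurableSet.univ
  have hx : x ∈ ⋃₀ S := h ▸ mem_univ x
  obtain ⟨I, hI, hxI⟩ := hx
  exact ⟨I, hS hI, hxI⟩

theorem atom_subset_of_le {m n : ℤ} (hmn : n ≤ m) {I J : Set X} (hI : I ∈ F.atoms n)
    (hJ : J ∈ F.atoms m) {x : X} (hxI : x ∈ I) (hxJ : x ∈ J) : J ⊆ I := by
  obtain ⟨S, hS, h⟩ := F.atomic m I (F.sigma.mono hmn I (F.measurable_atoms n I hI))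
  rw [h] at hxI
  obtain ⟨L, hL, hxL⟩ := hxI
  have hLJ : L = J := by
    by_contra hne
    exact Set.disjoint_left.1 (F.disjoint_atoms m (hS hL) hJ hne) hxL hxJ
  rw [h, ← hLJ]
  exact subset_sUnion_of_mem hL

theorem subset_or_subset_of_mem {I J : Set X} (hI : I ∈ F.lattice) (hJ : J ∈ F.lattice) {x : X}
    (hxI : x ∈ I) (hxJ : x ∈ J) : I ⊆ J ∨ J ⊆ I := by
  obtain ⟨n, hn⟩ := F.exists_mem_atoms hI
  obtain ⟨m, hm⟩ := F.exists_mem_atoms hJ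
  rcases le_total n m with h | h
  · exact Or.inr (F.atom_subset_of_le h hn hm hxI hxJ)
  · exact Or.inl (F.atom_subset_of_le h hm hn hxJ hxI)

/-- If `I` were an atom of a later generation too, the atom of generation `n + 1` through a point of
`I` would both contain `I` and lie in it. So the generations of an atom have no gaps, and passing
from one generation to the next misses nothing. -/
theorem isGreatest_of_notMem_succ {n : ℤ} {I : Set X} (hI : I ∈ F.atoms n)
    (h : I ∉ F.atoms (n + 1)) : IsGreatest {k : ℤ | I ∈ F.atoms k} n := by
  refine ⟨hI, fun k hk => ?_⟩
  by_contra hnk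
  obtain ⟨x, hx⟩ := F.nonempty_of_mem_lattice (F.atoms_subset_lattice n hI)
  obtain ⟨L, hL, hxL⟩ := F.exists_atom_mem (n + 1) x
  have h1 : L ⊆ I := F.atom_subset_of_le (by omega) hI hL hx hxL
  have h2 : I ⊆ L := F.atom_subset_of_le (by omega) hL hk hxL hx
  exact h (h1.antisymm h2 ▸ hL)

theorem eventually_mem_atoms_or_exists_isGreatest {I : Set X} (hI : I ∈ F.lattice) :
    (∀ᶠ n : ℤ in atTop, I ∈ F.atoms n) ∨ ∃ n, IsGreatest {k : ℤ | I ∈ F.atoms k} n := by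
  by_cases h : ∃ n, IsGreatest {k : ℤ | I ∈ F.atoms k} n
  · exact Or.inr h
  · left
    obtain ⟨n, hn⟩ := F.exists_mem_atoms hI
    refine (eventually_ge_atTop n).mono fun k hk => ?_
    induction k, hk using Int.leInduction with
    | base => exact hn
    | succ k hk ih =>
      by_contra h'
      exact h ⟨k, F.isGreatest_of_notMem_succ ih h'⟩

theorem subset_of_mem_children {I J : Set X} (hJ : J ∈ F.children I) : J ⊆ I := by
  rcases hJ with ⟨n, -, -, h⟩ | ⟨rfl, -⟩
  exacts [h, subset_rfl]

theorem exists_child_mem {I : Set X} (hI : I ∈ F.lattice) {x : X} (hx : x ∈ I) :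
    ∃ J ∈ F.children I, x ∈ J := by
  rcases F.eventually_mem_atoms_or_exists_isGreatest hI with h | ⟨n, hn⟩
  · exact ⟨I, Or.inr ⟨rfl, h⟩, hx⟩
  · obtain ⟨L, hL, hxL⟩ := F.exists_atom_mem (n + 1) x
    exact ⟨L, Or.inl ⟨n, hn, hL, F.atom_subset_of_le (by omega) hn.1 hL hx hxL⟩, hxL⟩

theorem iUnion_children {I : Set X} (hI : I ∈ F.lattice) :
    ⋃ J : F.children I, (J : Set X) = I := by
  apply Subset.antisymm
  · exact iUnion_subset fun J => F.subset_of_mem_children J.2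
  · intro x hx
    obtain ⟨J, hJ, hxJ⟩ := F.exists_child_mem hI hx
    exact mem_iUnion.2 ⟨⟨J, hJ⟩, hxJ⟩

theorem countable_lattice : F.lattice.Countable := countable_iUnion F.countable_atoms

instance countable_children (I : Set X) : Countable (F.children I) :=
  (F.countable_lattice.mono fun _ hJ => F.mem_lattice_of_mem_children hJ).to_subtype

theorem pairwise_disjoint_children (I : Set X) :
    Pairwise (Function.onFun Disjoint fun J : F.children I => (J : Set X)) := fun J K h =>
  F.disjoint_children J.2 K.2 fun h' => h (Subtype.ext h')

theorem measurableSet_child {I : Set X} (J : F.children I) : MeasurableSet (J : Set X) :=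
  F.measurableSet_of_mem_lattice (F.mem_lattice_of_mem_children J.2)

theorem tsum_measure_children {I : Set X} (hI : I ∈ F.lattice) (ν : Measure X) :
    ∑' J : F.children I, ν (J : Set X) = ν I := by
  rw [← measure_iUnion (F.pairwise_disjoint_children I) fun J => F.measurableSet_child J,
    F.iUnion_children hI]

theorem tsum_lintegral_children {I : Set X} (hI : I ∈ F.lattice) (ν : Measure X)
    (f : X → ℝ≥0∞) : ∑' J : F.children I, ∫⁻ x in (J : Set X), f x ∂ν = ∫⁻ x in I, f x ∂ν := by
  rw [← lintegral_iUnion (fun J => F.measurableSet_child J) (F.pairwise_disjoint_children I),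
    F.iUnion_children hI]

theorem hasSum_integral_children {I : Set X} (hI : I ∈ F.lattice) {ν : Measure X} {f : X → ℝ}
    (hf : IntegrableOn f I ν) :
    HasSum (fun J : F.children I => ∫ x in (J : Set X), f x ∂ν) (∫ x in I, f x ∂ν) := by
  have h := hasSum_integral_iUnion (μ := ν) (f := f)
    (fun J : F.children I => F.measurableSet_child J)
    (F.pairwise_disjoint_children I) (by rwa [F.iUnion_children hI])
  rwa [F.iUnion_children hI] at h

/-- A finite family of atoms is covered by its maximal elements, which are disjoint. -/
theorem exists_disjoint_cover (s : Finset (Set X)) (hs : ∀ J ∈ s, J ∈ F.lattice) :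
    ∃ m ⊆ s, (m : Set (Set X)).PairwiseDisjoint id ∧ ∀ J ∈ s, ∃ I ∈ m, J ⊆ I := by
  classical
  refine ⟨s.filter fun I => Maximal (· ∈ s) I, Finset.filter_subset _ _, ?_, ?_⟩
  · intro I hI J hJ hne
    simp only [Finset.coe_filter, mem_ofPred_eq] at hI hJ
    refine Set.disjoint_left.2 fun x hxI hxJ => hne ?_
    rcases F.subset_or_subset_of_mem (hs I hI.1) (hs J hJ.1) hxI hxJ with h | h
    · exact hI.2.eq_of_le hJ.1 h
    · exact (hJ.2.eq_of_le hI.1 h).symm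
  · intro J hJ
    obtain ⟨I, hJI, hI⟩ := s.exists_le_maximal hJ
    exact ⟨I, Finset.mem_filter.2 ⟨hI.1, hI⟩, hJI⟩

/-- If the sums of `c` below each member `I` of a finite family are bounded by `ν I`, then the whole
sum is bounded by the measure of the union. -/
theorem sum_le_measure_iUnion {c : Set X → ℝ≥0∞} {ν : Measure X} {s : Finset (Set X)}
    (hs : ∀ J ∈ s, J ∈ F.lattice)
    (h : ∀ I ∈ s, ∀ t ⊆ s, (∀ J ∈ t, J ⊆ I) → ∑ J ∈ t, c J ≤ ν I) :
    ∑ J ∈ s, c J ≤ ν (⋃ J ∈ s, J) := by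
  classical
  obtain ⟨m, hms, hdisj, hcov⟩ := F.exists_disjoint_cover s hs
  choose! g hg hgs using hcov
  calc ∑ J ∈ s, c J = ∑ I ∈ m, ∑ J ∈ s with g J = I, c J :=
        (Finset.sum_fiberwise_of_maps_to hg c).symm
    _ ≤ ∑ I ∈ m, ν I := by
        refine Finset.sum_le_sum fun I hI => h I (hms hI) _ (Finset.filter_subset _ _) ?_
        intro J hJ
        obtain ⟨hJs, rfl⟩ := Finset.mem_filter.1 hJ
        exact hgs J hJs
    _ = ν (⋃ I ∈ m, I) :=
        (measure_biUnion_finset hdisj fun I hI =>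
          F.measurableSet_of_mem_lattice (hs I (hms hI))).symm
    _ ≤ ν (⋃ J ∈ s, J) := measure_mono (biUnion_subset_biUnion_left hms)

/-- The union is already covered by its maximal members, and these are disjoint. This yields maximal
function estimates without any covering constant. -/
theorem measure_iUnion_le_of_forall {μ' ν : Measure X} {s : Finset (Set X)}
    (hs : ∀ J ∈ s, J ∈ F.lattice) (h : ∀ J ∈ s, μ' J ≤ ν J) :
    μ' (⋃ J ∈ s, J) ≤ ν (⋃ J ∈ s, J) := by
  obtain ⟨m, hms, hdisj, hcov⟩ := F.exists_disjoint_cover s hs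
  calc μ' (⋃ J ∈ s, J) ≤ μ' (⋃ I ∈ m, I) := by
        refine measure_mono (iUnion₂_subset fun J hJ => ?_)
        obtain ⟨I, hI, hJI⟩ := hcov J hJ
        exact hJI.trans (subset_biUnion_of_mem (u := fun I : Set X => I) hI)
    _ ≤ ∑ I ∈ m, μ' I := measure_biUnion_finset_le _ _
    _ ≤ ∑ I ∈ m, ν I := Finset.sum_le_sum fun I hI => h I (hms hI)
    _ = ν (⋃ I ∈ m, I) :=
        (measure_biUnion_finset hdisj fun I hI =>
          F.measurableSet_of_mem_lattice (hs I (hms hI))).symm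
    _ ≤ ν (⋃ J ∈ s, J) := measure_mono (biUnion_subset_biUnion_left hms)

/-- A superadditive majorant: if `c I + ∑_{K ∈ ch(I)} B K ≤ B I` for all atoms, then the sums of `c`
below `I` are bounded by `B I`. -/
theorem sum_le_of_superadditive {c B : Set X → ℝ≥0∞}
    (h : ∀ I ∈ F.lattice, c I + ∑' K : F.children I, B K ≤ B I) {I : Set X} (hI : I ∈ F.lattice)
    {s : Finset (Set X)} (hs : ∀ J ∈ s, J ∈ F.lattice) (hsI : ∀ J ∈ s, J ⊆ I) :
    ∑ J ∈ s, c J ≤ B I := by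
  classical
  -- Induction on the number `d` of generations from `I` down to a bound `N` for the generations in
  -- `s`. If `d = 0`, an atom of `s` inside `I` is of no later generation than `I`, so it is `I`.
  have key : ∀ (d : ℕ) (N n : ℤ) (s : Finset (Set X)), N ≤ n + d →
      (∀ J ∈ s, ∃ k ≤ N, J ∈ F.atoms k) → ∀ I ∈ F.atoms n, (∀ J ∈ s, J ⊆ I) →
      ∑ J ∈ s, c J ≤ B I := by
    intro d
    induction d with
    | zero =>
      intro N n s hN hs I hI hsI
      have hsub : s ⊆ {I} := by
        intro J hJ
        obtain ⟨k, hk, hJk⟩ := hs J hJ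
        obtain ⟨x, hx⟩ := F.nonempty_of_mem_lattice (F.atoms_subset_lattice k hJk)
        have h1 : I ⊆ J := F.atom_subset_of_le (by omega) hJk hI hx (hsI J hJ hx)
        exact Finset.mem_singleton.2 ((hsI J hJ).antisymm h1)
      calc ∑ J ∈ s, c J ≤ ∑ J ∈ {I}, c J := Finset.sum_le_sum_of_subset hsub
        _ = c I := by simp
        _ ≤ B I := le_self_add.trans (h I (F.atoms_subset_lattice n hI))
    | succ d ih =>
      intro N n s hN hs I hI hsI
      -- An atom may survive into the next generation; then only the generation is advanced.
      -- Superadditivity is spent at the last generation of `I`, where the children are exactly the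
      -- atoms of generation `n + 1` inside `I`.
      by_cases hI' : I ∈ F.atoms (n + 1)
      · exact ih N (n + 1) s (by push_cast at hN; omega) hs I hI' hsI
      · have hn := F.isGreatest_of_notMem_succ hI hI'
        have hIl := F.atoms_subset_lattice n hI
        refine le_trans ?_ (h I hIl)
        calc ∑ J ∈ s, c J ≤ ∑ J ∈ insert I (s.erase I), c J :=
              Finset.sum_le_sum_of_subset (Finset.insert_erase_subset I s)
          _ = c I + ∑ J ∈ s.erase I, c J := Finset.sum_insert (Finset.notMem_erase I s)
          _ ≤ c I + ∑ J ∈ s.erase I, ∑' K : F.children I, if J ⊆ K then c J else 0 := by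
              gcongr with J hJ
              obtain ⟨hJI, hJs⟩ := Finset.mem_erase.1 hJ
              obtain ⟨k, -, hJk⟩ := hs J hJs
              obtain ⟨x, hx⟩ := F.nonempty_of_mem_lattice (F.atoms_subset_lattice k hJk)
              have hk : n + 1 ≤ k := by
                by_contra hk
                exact hJI ((hsI J hJs).antisymm
                  (F.atom_subset_of_le (by omega) hJk hI hx (hsI J hJs hx)))
              obtain ⟨L, hL, hxL⟩ := F.exists_atom_mem (n + 1) x
              have hLI : L ⊆ I := F.atom_subset_of_le (by omega) hI hL (hsI J hJs hx) hxL
              have hJL : J ⊆ L := F.atom_subset_of_le hk hL hJk hxL hx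
              have := ENNReal.le_tsum (f := fun K : F.children I => if J ⊆ K then c J else 0)
                ⟨L, Or.inl ⟨n, hn, hL, hLI⟩⟩
              simpa [hJL] using this
          _ = c I + ∑' K : F.children I, ∑ J ∈ s.erase I, if J ⊆ K then c J else 0 := by
              rw [Summable.tsum_finsetSum fun _ _ => ENNReal.summable]
          _ ≤ c I + ∑' K : F.children I, B K := by
              gcongr with K
              rw [← Finset.sum_filter]
              have hK : (K : Set X) ∈ F.atoms (n + 1) := by
                rcases K.2 with ⟨m, hm, hK, -⟩ | ⟨-, hK⟩
                · exact hm.unique hn ▸ hK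
                · obtain ⟨k, hk, hk'⟩ := (hK.and (eventually_gt_atTop n)).exists
                  exact absurd (hn.2 hk) (not_le.2 hk')
              refine ih N (n + 1) _ (by push_cast at hN; omega) ?_ K hK ?_
              · intro J hJ
                exact hs J (Finset.mem_of_mem_erase (Finset.mem_filter.1 hJ).1)
              · intro J hJ
                exact (Finset.mem_filter.1 hJ).2
  obtain ⟨n, hn⟩ := F.exists_mem_atoms hI
  choose! gen hgen using fun J (hJ : J ∈ s) => F.exists_mem_atoms (hs J hJ)
  obtain ⟨N, hN⟩ : ∃ N, ∀ J ∈ s, gen J ≤ N := by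
    obtain ⟨N, hN⟩ := (s.image gen).bddAbove
    exact ⟨N, fun J hJ => hN (Finset.mem_image_of_mem gen hJ)⟩
  exact key (N - n).toNat N n s (by omega) (fun J hJ => ⟨gen J, hN J hJ, hgen J hJ⟩) I hn hsI

end AtomicFiltration

/-! ### Cauchy–Schwarz and layer cake formulas in `ℝ≥0∞`. -/

theorem ENNReal.sum_mul_sq_le {ι : Type*} (s : Finset ι) (a b : ι → ℝ≥0∞) :
    (∑ i ∈ s, a i * b i) ^ 2 ≤ (∑ i ∈ s, a i ^ 2) * ∑ i ∈ s, b i ^ 2 := by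
  have h := ENNReal.inner_le_Lp_mul_Lq s a b Real.HolderConjugate.two_two
  simp only [ENNReal.rpow_two] at h
  rw [← ENNReal.mul_rpow_of_nonneg _ _ (by norm_num)] at h
  calc (∑ i ∈ s, a i * b i) ^ 2
      ≤ (((∑ i ∈ s, a i ^ 2) * ∑ i ∈ s, b i ^ 2) ^ (1 / 2 : ℝ)) ^ 2 := by gcongr
    _ = _ := by rw [← ENNReal.rpow_two, ← ENNReal.rpow_mul]; norm_num

theorem ENNReal.tsum_mul_sq_le {ι : Type*} (a b : ι → ℝ≥0∞) :
    (∑' i, a i * b i) ^ 2 ≤ (∑' i, a i ^ 2) * ∑' i, b i ^ 2 := by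
  refine le_of_tendsto ((ENNReal.continuous_pow 2).continuousAt.tendsto.comp
    (ENNReal.summable (f := fun i => a i * b i)).hasSum) (Eventually.of_forall fun s => ?_)
  refine (ENNReal.sum_mul_sq_le s a b).trans ?_
  gcongr <;> exact ENNReal.sum_le_tsum s

theorem ENNReal.lintegral_mul_sq_le {Y : Type*} [MeasurableSpace Y] {ρ : Measure Y}
    {a b : Y → ℝ≥0∞} (ha : AEMeasurable a ρ) (hb : AEMeasurable b ρ) :
    (∫⁻ y, a y * b y ∂ρ) ^ 2 ≤ (∫⁻ y, a y ^ 2 ∂ρ) * ∫⁻ y, b y ^ 2 ∂ρ := by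
  have h := ENNReal.lintegral_mul_le_Lp_mul_Lq ρ Real.HolderConjugate.two_two ha hb
  simp only [Pi.mul_apply, ENNReal.rpow_two] at h
  rw [← ENNReal.mul_rpow_of_nonneg _ _ (by norm_num)] at h
  calc (∫⁻ y, a y * b y ∂ρ) ^ 2
      ≤ (((∫⁻ y, a y ^ 2 ∂ρ) * ∫⁻ y, b y ^ 2 ∂ρ) ^ (1 / 2 : ℝ)) ^ 2 := by gcongr
    _ = _ := by rw [← ENNReal.rpow_two, ← ENNReal.rpow_mul]; norm_num

theorem volume_setOf_ofReal_lt (a : ℝ≥0∞) :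
    volume ({t : ℝ | ENNReal.ofReal t < a} ∩ Ioi 0) = a := by
  rcases eq_or_ne a ∞ with rfl | ha
  · simp
  · have : ({t : ℝ | ENNReal.ofReal t < a} ∩ Ioi 0) = Ioo 0 a.toReal := by
      ext t
      simp only [mem_inter_iff, mem_ofPred_eq, mem_Ioi, mem_Ioo]
      constructor
      · rintro ⟨h, h0⟩
        exact ⟨h0, (ENNReal.ofReal_lt_iff_lt_toReal h0.le ha).1 h⟩
      · rintro ⟨h0, h⟩
        exact ⟨(ENNReal.ofReal_lt_iff_lt_toReal h0.le ha).2 h, h0⟩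
    rw [this, Real.volume_Ioo, sub_zero, ENNReal.ofReal_toReal ha]

theorem lintegral_indicator_ofReal_lt (a : ℝ≥0∞) :
    ∫⁻ t in Ioi (0 : ℝ), {t : ℝ | ENNReal.ofReal t < a}.indicator 1 t = a := by
  have hm : MeasurableSet {t : ℝ | ENNReal.ofReal t < a} :=
    measurableSet_lt ENNReal.measurable_ofReal measurable_const
  rw [lintegral_indicator_one hm, Measure.restrict_apply hm, volume_setOf_ofReal_lt]

theorem sq_eq_lintegral_indicator {a : ℝ≥0∞} (ha : a ≠ ∞) :
    a ^ 2 = ∫⁻ t in Ioi (0 : ℝ),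
      {t : ℝ | ENNReal.ofReal t < a}.indicator (fun t => ENNReal.ofReal (2 * t)) t := by
  have hm : MeasurableSet {t : ℝ | ENNReal.ofReal t < a} :=
    measurableSet_lt ENNReal.measurable_ofReal measurable_const
  lift a to ℝ≥0 using ha
  have hset : ({t : ℝ | ENNReal.ofReal t < a} ∩ Ioi 0) = Ioo 0 (a : ℝ) := by
    ext t
    simp only [mem_inter_iff, mem_ofPred_eq, mem_Ioi, mem_Ioo]
    constructor
    · rintro ⟨h, h0⟩
      exact ⟨h0, (ENNReal.ofReal_lt_iff_lt_toReal h0.le ENNReal.coe_ne_top).1 h⟩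
    · rintro ⟨h0, h⟩
      exact ⟨(ENNReal.ofReal_lt_iff_lt_toReal h0.le ENNReal.coe_ne_top).2 h, h0⟩
  rw [lintegral_indicator hm, Measure.restrict_restrict hm, hset,
    restrict_Ioo_eq_restrict_Ioc, ← ofReal_integral_eq_lintegral_ofReal,
    ← intervalIntegral.integral_of_le (NNReal.coe_nonneg a)]
  · rw [intervalIntegral.integral_const_mul, integral_id]
    rw [show 2 * (((a : ℝ) ^ 2 - 0 ^ 2) / 2) = (a : ℝ) ^ 2 by ring,
      ENNReal.ofReal_pow (NNReal.coe_nonneg a)]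
    simp
  · exact ((continuous_const.mul continuous_id).integrableOn_Icc (a := 0) (b := (a : ℝ))).mono_set
      Ioc_subset_Icc_self
  · refine (ae_restrict_iff' measurableSet_Ioc).2 (Eventually.of_forall fun t ht => ?_)
    exact mul_nonneg zero_le_two ht.1.le

/-! ### The Carleson embedding theorem for a general measure. -/

namespace AtomicFiltration

variable {X : Type*} [mX : MeasurableSpace X] {μ : Measure X} (F : AtomicFiltration μ)

/-- The sums of `c` over the atoms below `I` are bounded by `B I`. -/
def CarlesonBound (c B : Set X → ℝ≥0∞) : Prop :=
  ∀ I ∈ F.lattice, ∀ s : Finset (Set X), (∀ J ∈ s, J ∈ F.lattice) → (∀ J ∈ s, J ⊆ I) →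
    ∑ J ∈ s, c J ≤ B I

variable {F}

/-- The weak type estimate for the maximal function. -/
theorem measure_iUnion_le_lintegral {ν : Measure X} (hν : ∀ I ∈ F.lattice, ν I ≠ ∞)
    {f : X → ℝ≥0∞} (hf : Measurable f) {s : Finset (Set X)} (hs : ∀ J ∈ s, J ∈ F.lattice)
    {t : ℝ} (ht : 0 < t) (h : ∀ J ∈ s, ENNReal.ofReal t < (∫⁻ x in J, f x ∂ν) / ν J) :
    ν (⋃ J ∈ s, J) ≤ ENNReal.ofReal (2 / t) *
      ∫⁻ x, {x | ENNReal.ofReal t < 2 * f x}.indicator f x ∂ν := by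
  have hm : MeasurableSet {x | ENNReal.ofReal t < 2 * f x} :=
    measurableSet_lt measurable_const (hf.const_mul 2)
  -- On a selected `J` the values of `f` up to `t/2` contribute at most half of `t ν(J)`, so the
  -- values above `t/2` carry the other half. Hence `ν ≤ ν'` on each `J`, and therefore on the
  -- union.
  set ν' : Measure X := ENNReal.ofReal (2 / t) •
    ν.withDensity ({x | ENNReal.ofReal t < 2 * f x}.indicator f) with hν'
  have h1 : ν (⋃ J ∈ s, J) ≤ ν' (⋃ J ∈ s, J) := by
    refine F.measure_iUnion_le_of_forall hs fun J hJ => ?_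
    have hJm := F.measurableSet_of_mem_lattice (hs J hJ)
    rw [hν', Measure.smul_apply, withDensity_apply _ hJm, smul_eq_mul]
    have h2 : ∫⁻ x in J, f x ∂ν ≤
        ∫⁻ x in J, {x | ENNReal.ofReal t < 2 * f x}.indicator f x ∂ν +
          ENNReal.ofReal (t / 2) * ν J := by
      calc ∫⁻ x in J, f x ∂ν ≤ ∫⁻ x in J, ({x | ENNReal.ofReal t < 2 * f x}.indicator f x +
            ENNReal.ofReal (t / 2)) ∂ν := by
            refine lintegral_mono fun x => ?_
            by_cases hx : ENNReal.ofReal t < 2 * f x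
            · simp [indicator, hx]
            · have hx' : f x ≤ ENNReal.ofReal (t / 2) := by
                rw [ENNReal.ofReal_div_of_pos two_pos,
                  ENNReal.le_div_iff_mul_le (by simp) (by simp)]
                simpa [mul_comm] using hx
              simpa [indicator, hx] using hx'
        _ = _ := by
            rw [lintegral_add_left (hf.indicator hm)]; simp
    have h3 : ENNReal.ofReal t * ν J ≤ ∫⁻ x in J, f x ∂ν := by
      refine (ENNReal.le_div_iff_mul_le ?_ (Or.inl (hν J (hs J hJ)))).1 (h J hJ).le
      refine Or.inr ?_
      intro h0
      have := h J hJ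
      simp [h0] at this
    have h4 : ENNReal.ofReal (t / 2) * ν J ≤
        ∫⁻ x in J, {x | ENNReal.ofReal t < 2 * f x}.indicator f x ∂ν := by
      have hfin : ENNReal.ofReal (t / 2) * ν J ≠ ∞ :=
        ENNReal.mul_ne_top ENNReal.ofReal_ne_top (hν J (hs J hJ))
      refine (ENNReal.add_le_add_iff_right hfin).1 ?_
      refine le_trans (le_of_eq ?_) (h3.trans h2)
      rw [← add_mul, ← ENNReal.ofReal_add (by positivity) (by positivity), add_halves]
    calc ν J = ENNReal.ofReal (2 / t) * (ENNReal.ofReal (t / 2) * ν J) := by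
          rw [← mul_assoc, ← ENNReal.ofReal_mul (by positivity)]
          rw [show 2 / t * (t / 2) = 1 by field_simp]; simp
      _ ≤ _ := by gcongr
  refine h1.trans ((measure_mono (subset_univ _)).trans ?_)
  rw [hν', Measure.smul_apply, withDensity_apply _ MeasurableSet.univ, smul_eq_mul,
    Measure.restrict_univ]

/-- The Carleson embedding theorem. -/
theorem CarlesonBound.sum_mul_sq_le {ν : Measure X} [SFinite ν] (hν : ∀ I ∈ F.lattice, ν I ≠ ∞)
    {c : Set X → ℝ≥0∞} {C : ℝ≥0∞} (hc : F.CarlesonBound c fun I => C * ν I)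
    {f : X → ℝ≥0∞} (hf : AEMeasurable f ν) {s : Finset (Set X)} (hs : ∀ J ∈ s, J ∈ F.lattice) :
    ∑ J ∈ s, c J * ((∫⁻ x in J, f x ∂ν) / ν J) ^ 2 ≤ 8 * C * ∫⁻ x, f x ^ 2 ∂ν := by
  classical
  wlog hfm : Measurable f generalizing f
  · have h := this hf.measurable_mk.aemeasurable hf.measurable_mk
    have h1 : ∀ J, ∫⁻ x in J, hf.mk f x ∂ν = ∫⁻ x in J, f x ∂ν := fun J =>
      lintegral_congr_ae (ae_restrict_of_ae hf.ae_eq_mk.symm)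
    have h2 : ∫⁻ x, hf.mk f x ^ 2 ∂ν = ∫⁻ x, f x ^ 2 ∂ν :=
      lintegral_congr_ae (hf.ae_eq_mk.symm.mono fun x hx => by simp only [hx])
    simpa only [h1, h2] using h
  -- An infinite right side is trivial unless `C = 0`, and then all coefficients vanish. Otherwise
  -- the averages are finite, as the layer cake formula for squares requires.
  by_cases htop : ∫⁻ x, f x ^ 2 ∂ν = ∞
  · rcases eq_or_ne C 0 with rfl | hC
    · have hc0 : ∀ J ∈ s, c J = 0 := by
        intro J hJ
        have := hc J (hs J hJ) {J} (by simpa using hs J hJ) (by simp)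
        simpa using this
      rw [Finset.sum_eq_zero fun J hJ => by rw [hc0 J hJ, zero_mul]]
      exact zero_le
    · rw [htop, ENNReal.mul_top (by simp [hC])]
      exact le_top
  set g : Set X → ℝ≥0∞ := fun J => (∫⁻ x in J, f x ∂ν) / ν J with hg
  have hgfin : ∀ J ∈ s, g J ≠ ∞ := by
    intro J hJ
    have h1 := ENNReal.lintegral_mul_sq_le (ρ := ν.restrict J) (a := f) (b := fun _ => 1)
      hfm.aemeasurable aemeasurable_const
    have h2 : ∫⁻ x in J, f x ∂ν ≠ ∞ := by
      intro h
      have h3 : (∫⁻ x in J, f x ^ 2 ∂ν) ≠ ∞ :=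
        ne_top_of_le_ne_top htop (setLIntegral_le_lintegral J _)
      have h4 := ENNReal.mul_ne_top h3 (hν J (hs J hJ))
      simp only [mul_one, h, one_pow, lintegral_const, Measure.restrict_apply_univ, one_mul] at h1
      exact h4 (top_le_iff.1 (by simpa using h1))
    rcases eq_or_ne (ν J) 0 with h0 | h0
    · simp [hg, Measure.restrict_eq_zero.2 h0]
    · exact ENNReal.div_ne_top h2 h0
  have hmt : ∀ a : ℝ≥0∞, MeasurableSet {t : ℝ | ENNReal.ofReal t < a} := fun a =>
    measurableSet_lt ENNReal.measurable_ofReal measurable_const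
  -- The coefficients of the atoms with average above `t` sum to at most `C ν` of their union, to
  -- which the weak type bound applies. The density `2t` of the square times `2/t` gives 4;
  -- integrating `f` over `t < 2f` gives `2f²`, hence the constant 8.
  have hlevel : ∀ t : ℝ, 0 < t →
      ∑ J ∈ s, c J * {t : ℝ | ENNReal.ofReal t < g J}.indicator (fun t => ENNReal.ofReal (2 * t)) t
        ≤ 4 * C * ∫⁻ x, {x | ENNReal.ofReal t < 2 * f x}.indicator f x ∂ν := by
    intro t ht
    set S := s.filter fun J => ENNReal.ofReal t < g J with hS
    have hSl : ∀ J ∈ S, J ∈ F.lattice := fun J hJ => hs J (Finset.mem_filter.1 hJ).1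
    calc ∑ J ∈ s, c J * {t : ℝ | ENNReal.ofReal t < g J}.indicator
            (fun t => ENNReal.ofReal (2 * t)) t
        = (∑ J ∈ S, c J) * ENNReal.ofReal (2 * t) := by
          rw [hS, Finset.sum_filter, Finset.sum_mul]
          refine Finset.sum_congr rfl fun J _ => ?_
          by_cases h : ENNReal.ofReal t < g J <;> simp [indicator, h]
      _ ≤ (C • ν) (⋃ J ∈ S, J) * ENNReal.ofReal (2 * t) := by
          gcongr
          refine F.sum_le_measure_iUnion hSl fun I hI t ht htI => ?_
          exact hc I (hSl I hI) t (fun J hJ => hSl J (ht hJ)) htI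
      _ ≤ (C * (ENNReal.ofReal (2 / t) *
            ∫⁻ x, {x | ENNReal.ofReal t < 2 * f x}.indicator f x ∂ν)) *
            ENNReal.ofReal (2 * t) := by
          rw [Measure.smul_apply, smul_eq_mul]
          gcongr
          exact measure_iUnion_le_lintegral hν hfm hSl ht fun J hJ => (Finset.mem_filter.1 hJ).2
      _ = (ENNReal.ofReal (2 / t) * ENNReal.ofReal (2 * t)) * C *
            ∫⁻ x, {x | ENNReal.ofReal t < 2 * f x}.indicator f x ∂ν := by ring
      _ = _ := by
          rw [← ENNReal.ofReal_mul (by positivity),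
            show 2 / t * (2 * t) = 4 by field_simp; norm_num]
          norm_num
  have hjoint : Measurable fun p : ℝ × X =>
      {x | ENNReal.ofReal p.1 < 2 * f x}.indicator f p.2 := by
    have : (fun p : ℝ × X => {x | ENNReal.ofReal p.1 < 2 * f x}.indicator f p.2) =
        {p : ℝ × X | ENNReal.ofReal p.1 < 2 * f p.2}.indicator fun p => f p.2 := by
      funext p; simp [indicator]
    rw [this]
    refine (hfm.comp measurable_snd).indicator (measurableSet_lt ?_ ?_)
    · exact ENNReal.measurable_ofReal.comp measurable_fst
    · exact (hfm.comp measurable_snd).const_mul 2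
  calc ∑ J ∈ s, c J * g J ^ 2
      = ∑ J ∈ s, c J * ∫⁻ t in Ioi (0 : ℝ),
          {t : ℝ | ENNReal.ofReal t < g J}.indicator (fun t => ENNReal.ofReal (2 * t)) t := by
        refine Finset.sum_congr rfl fun J hJ => ?_
        rw [← sq_eq_lintegral_indicator (hgfin J hJ)]
    _ = ∫⁻ t in Ioi (0 : ℝ), ∑ J ∈ s, c J *
          {t : ℝ | ENNReal.ofReal t < g J}.indicator (fun t => ENNReal.ofReal (2 * t)) t := by
        have hmeas : ∀ J, Measurable fun t =>
            {t : ℝ | ENNReal.ofReal t < g J}.indicator (fun t => ENNReal.ofReal (2 * t)) t :=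
          fun J => Measurable.indicator (by fun_prop) (hmt _)
        rw [lintegral_finsetSum _ fun J _ => (hmeas J).const_mul _]
        exact Finset.sum_congr rfl fun J _ => (lintegral_const_mul _ (hmeas J)).symm
    _ ≤ ∫⁻ t in Ioi (0 : ℝ), 4 * C *
          ∫⁻ x, {x | ENNReal.ofReal t < 2 * f x}.indicator f x ∂ν :=
        setLIntegral_mono' measurableSet_Ioi hlevel
    _ = 4 * C * ∫⁻ x, (∫⁻ t in Ioi (0 : ℝ),
          {x | ENNReal.ofReal t < 2 * f x}.indicator f x) ∂ν := by
        rw [lintegral_const_mul, lintegral_lintegral_swap hjoint.aemeasurable]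
        exact hjoint.lintegral_prod_right'
    _ = 4 * C * ∫⁻ x, 2 * f x ^ 2 ∂ν := by
        congr 1
        refine lintegral_congr fun x => ?_
        calc ∫⁻ t in Ioi (0 : ℝ), {x | ENNReal.ofReal t < 2 * f x}.indicator f x
            = ∫⁻ t in Ioi (0 : ℝ), f x * {t : ℝ | ENNReal.ofReal t < 2 * f x}.indicator 1 t := by
              refine lintegral_congr fun t => ?_
              by_cases h : ENNReal.ofReal t < 2 * f x <;> simp [indicator, h]
          _ = f x * (2 * f x) := by
              rw [lintegral_const_mul _ (measurable_one.indicator (hmt _)),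
                lintegral_indicator_ofReal_lt]
          _ = 2 * f x ^ 2 := by ring
    _ = 8 * C * ∫⁻ x, f x ^ 2 ∂ν := by
        rw [lintegral_const_mul _ (hfm.pow_const 2)]; ring

end AtomicFiltration

/-! ### Scalar inequalities behind the entropy estimates. -/

theorem ENNReal.lintegral_sq_le_div {Y : Type*} [MeasurableSpace Y] {ρ : Measure Y}
    {a b : Y → ℝ≥0∞} (ha : Measurable a) (hb : Measurable b) (hab : ∀ y, b y = 0 → a y = 0)
    (hb' : ∀ y, b y ≠ ∞) :
    (∫⁻ y, a y ∂ρ) ^ 2 ≤ (∫⁻ y, a y ^ 2 / b y ∂ρ) * ∫⁻ y, b y ∂ρ := by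
  have hsq : ∀ y, (b y ^ (1 / 2 : ℝ)) ^ 2 = b y := fun y => by
    rw [← ENNReal.rpow_two, ← ENNReal.rpow_mul]; norm_num
  have h := ENNReal.lintegral_mul_sq_le (ρ := ρ) (a := fun y => a y / b y ^ (1 / 2 : ℝ))
    (b := fun y => b y ^ (1 / 2 : ℝ)) (ha.div (hb.pow_const _)).aemeasurable
    (hb.pow_const _).aemeasurable
  have h1 : ∀ y, a y / b y ^ (1 / 2 : ℝ) * b y ^ (1 / 2 : ℝ) = a y := by
    intro y
    rcases eq_or_ne (b y) 0 with h0 | h0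
    · simp [hab y h0]
    · refine ENNReal.div_mul_cancel ?_ ?_
      · simp [ENNReal.rpow_eq_zero_iff, h0, hb' y]
      · simp [ENNReal.rpow_eq_top_iff, h0, hb' y]
  have h2 : ∀ y, (a y / b y ^ (1 / 2 : ℝ)) ^ 2 = a y ^ 2 / b y := by
    intro y
    rw [div_eq_mul_inv, mul_pow, ← ENNReal.inv_pow, hsq, ← div_eq_mul_inv]
  simpa only [h1, h2, hsq] using h

theorem enorm_sub_le_of_ofReal_le {a b : ℝ} {D : ℝ≥0∞} (ha : 0 ≤ a) (hb : 0 ≤ b)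
    (h1 : ENNReal.ofReal a ≤ ENNReal.ofReal b + D) (h2 : ENNReal.ofReal b ≤ ENNReal.ofReal a + D) :
    ‖a - b‖ₑ ≤ D := by
  rcases eq_or_ne D ∞ with rfl | hD
  · exact le_top
  lift D to ℝ≥0 using hD
  rw [← ENNReal.ofReal_coe_nnreal] at h1 h2 ⊢
  rw [← ENNReal.ofReal_add hb (NNReal.coe_nonneg D),
    ENNReal.ofReal_le_ofReal_iff (by positivity)] at h1
  rw [← ENNReal.ofReal_add ha (NNReal.coe_nonneg D),
    ENNReal.ofReal_le_ofReal_iff (by positivity)] at h2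
  rw [Real.enorm_eq_ofReal_abs]
  exact ENNReal.ofReal_le_ofReal (abs_le.2 ⟨by linarith, by linarith⟩)

theorem psiZero_eq {s : ℝ} (hs : 0 ≤ s) : psiZero s = s + Real.negMulLog s := by
  rcases hs.eq_or_lt with rfl | hs
  · simp [psiZero]
  · rw [psiZero, Real.log_div (Real.exp_pos 1).ne' hs.ne', Real.log_exp, Real.negMulLog]
    ring

theorem le_psiZero {s : ℝ} (hs : 0 ≤ s) (hs1 : s ≤ 1) : s ≤ psiZero s := by
  rw [psiZero_eq hs]
  linarith [Real.negMulLog_nonneg hs hs1]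

theorem negMulLog_le_psiZero {s : ℝ} (hs : 0 ≤ s) : Real.negMulLog s ≤ psiZero s := by
  rw [psiZero_eq hs]
  linarith

/-- Rearranged: `m ln(m/p) - m + p ≥ (√m - √p)²`, that is, relative entropy dominates the squared
Hellinger distance. With `m = p y²` this is `ln y ≥ 1 - 1/y`. For `m, p ≤ 1` every summand, as
distributed here, is nonnegative, so the inequality can be summed in `ℝ≥0∞`. -/
theorem negMulLog_add_le {m p : ℝ} (hm : 0 ≤ m) (hp : 0 < p) :
    Real.negMulLog m + p * (√(m / p) - 1) ^ 2 + m ≤ m * (-Real.log p) + p := by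
  rcases hm.eq_or_lt with rfl | hm
  · simp
  · set y := √(m / p) with hy
    have hy0 : 0 < y := Real.sqrt_pos.2 (div_pos hm hp)
    have hmy : m = p * y ^ 2 := by
      rw [hy, Real.sq_sqrt (div_pos hm hp).le]
      field_simp
    have hlog : 1 - y⁻¹ ≤ Real.log y := Real.one_sub_inv_le_log_of_pos hy0
    have hlogm : Real.log m = Real.log p + 2 * Real.log y := by
      rw [hmy, Real.log_mul hp.ne' (pow_pos hy0 2).ne', Real.log_pow]
      norm_num
    rw [Real.negMulLog, hlogm]
    have h1 : m * (1 - y⁻¹) ≤ m * Real.log y := mul_le_mul_of_nonneg_left hlog hm.le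
    have h2 : m * (1 - y⁻¹) = p * y ^ 2 - p * y := by
      rw [hmy]; field_simp
    rw [h2] at h1
    nlinarith

/-- A difference of squares, prepared for Cauchy–Schwarz: the first factor produces the Hellinger
distance, the second is controlled by the total mass. -/
theorem abs_sub_eq_mul_sqrt {m p : ℝ} (hm : 0 ≤ m) (hp : 0 < p) :
    |m - p| = |√(m / p) - 1| * (p * (√(m / p) + 1)) := by
  have h : m - p = (√(m / p) - 1) * (p * (√(m / p) + 1)) := by
    have := Real.sq_sqrt (div_nonneg hm hp.le)
    have h2 : m = p * √(m / p) ^ 2 := by rw [this]; field_simp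
    linear_combination h2
  rw [h, abs_mul, abs_of_nonneg (a := p * _) (by positivity)]

theorem mul_sqrt_add_one_sq_le {m p : ℝ} (hm : 0 ≤ m) (hp : 0 < p) :
    (p * (√(m / p) + 1)) ^ 2 ≤ 2 * p * m + 2 * p ^ 2 := by
  have := Real.sq_sqrt (div_nonneg hm hp.le)
  have h2 : m = p * √(m / p) ^ 2 := by rw [this]; field_simp
  nlinarith [sq_nonneg (p * (√(m / p) - 1))]

/-- The integrand is `min(1, p/t)` on `(0, 1]`, whose integral is `p + p ln(1/p)`. This is how `ψ₀`
enters the estimate for averages. -/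
theorem lintegral_min_div_le {p : ℝ} (hp : 0 < p) (hp1 : p ≤ 1) :
    ∫⁻ t, ((Ioc 0 p).indicator 1 t + (Ioc p 1).indicator (fun t => ENNReal.ofReal (p / t)) t) =
      ENNReal.ofReal (psiZero p) := by
  rw [lintegral_add_left (measurable_one.indicator measurableSet_Ioc),
    lintegral_indicator_one measurableSet_Ioc, lintegral_indicator measurableSet_Ioc,
    Real.volume_Ioc, sub_zero, ← ofReal_integral_eq_lintegral_ofReal,
    ← intervalIntegral.integral_of_le hp1, psiZero_eq hp.le,
    ENNReal.ofReal_add hp.le (Real.negMulLog_nonneg hp.le hp1)]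
  · congr 2
    simp_rw [div_eq_mul_inv]
    rw [intervalIntegral.integral_const_mul, integral_inv_of_pos hp one_pos, one_div, Real.log_inv,
      Real.negMulLog]
    ring
  · refine (ContinuousOn.integrableOn_Icc ?_).mono_set Ioc_subset_Icc_self
    exact continuousOn_const.div continuousOn_id fun t ht => (hp.trans_le ht.1).ne'
  · refine (ae_restrict_iff' measurableSet_Ioc).2 (Eventually.of_forall fun t ht => ?_)
    exact div_nonneg hp.le (hp.trans ht.1).le

/-- The density `|K ∩ E| / |K|`. -/
def density {X : Type*} [MeasurableSpace X] (μ : Measure X) (E K : Set X) : ℝ :=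
  μ.real (K ∩ E) / μ.real K

theorem density_nonneg {X : Type*} [MeasurableSpace X] (μ : Measure X) (E K : Set X) :
    0 ≤ density μ E K := div_nonneg measureReal_nonneg measureReal_nonneg

theorem distribFn_eq_density {X : Type*} [MeasurableSpace X] (μ : Measure X) (I : Set X)
    (u : X → ℝ) (t : ℝ) : distribFn μ I u t = density μ {x | t < u x} I := rfl

/-! ### The two `L log L` estimates for the indicator of a set. -/

namespace AtomicFiltration

variable {X : Type*} [mX : MeasurableSpace X] {μ : Measure X} {F : AtomicFiltration μ}

theorem density_le_one {K : Set X} (hK : K ∈ F.lattice) (E : Set X) : density μ E K ≤ 1 :=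
  div_le_one_of_le₀ (measureReal_mono inter_subset_left (F.measure_lt_top_of_mem_lattice hK).ne)
    measureReal_nonneg

theorem measure_mul_density {K : Set X} (hK : K ∈ F.lattice) (E : Set X) :
    μ K * ENNReal.ofReal (density μ E K) = μ (K ∩ E) := by
  have h1 := (F.measure_lt_top_of_mem_lattice hK).ne
  have h2 : μ (K ∩ E) ≠ ∞ := ne_top_of_le_ne_top h1 (measure_mono inter_subset_left)
  rw [density, ENNReal.ofReal_div_of_pos (F.measureReal_pos_of_mem_lattice hK), Measure.real,
    Measure.real, ENNReal.ofReal_toReal h1, ENNReal.ofReal_toReal h2,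
    ENNReal.mul_div_cancel (F.measure_pos_of_mem_lattice hK).ne' h1]

theorem density_eq_zero {K : Set X} {E : Set X} (h : μ (K ∩ E) = 0) : density μ E K = 0 := by
  simp [density, Measure.real, h]

/-- Write `|J ∩ E|` as `|J|` times the density of `E` in `J` and integrate over the levels `t` of
the density. The coefficients above level `t` sum to at most the measure of the union of their
atoms, which is at most `|I|` and at most `|I ∩ E| / t`; no density exceeds 1. -/
theorem sum_mul_measure_inter_le {a : Set X → ℝ≥0∞}
    (ha : F.CarlesonBound (fun J => a J * μ J) fun I => μ I) (E : Set X) :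
    F.CarlesonBound (fun J => a J * μ (J ∩ E))
      fun I => μ I * ENNReal.ofReal (psiZero (density μ E I)) := by
  classical
  intro I hI s hs hsI
  set p := density μ E I with hp
  rcases (density_nonneg μ E I).eq_or_lt with hp0 | hp0
  · have hIE : μ (I ∩ E) = 0 := by rw [← measure_mul_density hI, ← hp0]; simp
    rw [Finset.sum_eq_zero]
    · exact zero_le
    · intro J hJ
      rw [measure_mono_null (inter_subset_inter_left E (hsI J hJ)) hIE, mul_zero]
  have hp1 : p ≤ 1 := density_le_one hI E
  set ind : ℝ → ℝ → ℝ≥0∞ := fun m t => {t : ℝ | ENNReal.ofReal t < ENNReal.ofReal m}.indicator 1 t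
    with hind
  have hindm : ∀ m, Measurable (ind m) := fun m => measurable_one.indicator
    (measurableSet_lt ENNReal.measurable_ofReal measurable_const)
  have hpt : ∀ t : ℝ, 0 < t → ∑ J ∈ s, a J * μ J * ind (density μ E J) t ≤
      μ I * ((Ioc 0 p).indicator 1 t +
        (Ioc p 1).indicator (fun t => ENNReal.ofReal (p / t)) t) := by
    intro t ht
    set S := s.filter fun J => t < density μ E J with hS
    have hSs : ∀ J ∈ S, J ∈ s := fun J hJ => (Finset.mem_filter.1 hJ).1
    have hSl : ∀ J ∈ S, J ∈ F.lattice := fun J hJ => hs J (hSs J hJ)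
    have hsum : ∑ J ∈ s, a J * μ J * ind (density μ E J) t = ∑ J ∈ S, a J * μ J := by
      rw [hS, Finset.sum_filter]
      refine Finset.sum_congr rfl fun J _ => ?_
      by_cases h : t < density μ E J
      · have h' : ENNReal.ofReal t < ENNReal.ofReal (density μ E J) :=
          (ENNReal.ofReal_lt_ofReal_iff (ht.trans h)).2 h
        simp [hind, indicator, h, h']
      · have h' : ¬ ENNReal.ofReal t < ENNReal.ofReal (density μ E J) :=
          not_lt.2 (ENNReal.ofReal_le_ofReal (not_lt.1 h))
        simp only [hind, indicator, mem_ofPred_eq, h', h, if_false, mul_zero]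
    have hle : ∑ J ∈ S, a J * μ J ≤ μ (⋃ J ∈ S, J) :=
      F.sum_le_measure_iUnion hSl fun I hI t ht htI =>
        ha I (hSl I hI) t (fun J hJ => hSl J (ht hJ)) htI
    have hSI : (⋃ J ∈ S, J) ⊆ I := iUnion₂_subset fun J hJ => hsI J (hSs J hJ)
    rw [hsum]
    refine hle.trans ?_
    rcases le_or_gt t p with htp | htp
    · have h1 : t ∈ Ioc 0 p := ⟨ht, htp⟩
      have h2 : t ∉ Ioc p 1 := fun h => not_lt.2 htp h.1
      simpa [h1, h2] using measure_mono hSI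
    rcases le_or_gt t 1 with ht1 | ht1
    · have h1 : t ∉ Ioc 0 p := fun h => not_lt.2 h.2 htp
      have h2 : t ∈ Ioc p 1 := ⟨htp, ht1⟩
      have h3 : μ (⋃ J ∈ S, J) ≤ (ENNReal.ofReal t⁻¹ • μ.restrict E) (⋃ J ∈ S, J) := by
        refine F.measure_iUnion_le_of_forall hSl fun J hJ => ?_
        rw [Measure.smul_apply, Measure.restrict_apply (F.measurableSet_of_mem_lattice (hSl J hJ)),
          ← measure_mul_density (hSl J hJ), smul_eq_mul, mul_left_comm,
          ← ENNReal.ofReal_mul (by positivity)]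
        refine le_mul_of_one_le_right' (ENNReal.one_le_ofReal.2 ?_)
        rw [inv_mul_eq_div]
        exact (one_le_div ht).2 (Finset.mem_filter.1 hJ).2.le
      refine h3.trans ?_
      simp only [h1, h2, not_false_eq_true, indicator_of_notMem, indicator_of_mem, zero_add]
      rw [div_eq_inv_mul, ENNReal.ofReal_mul (by positivity), mul_left_comm, hp,
        measure_mul_density hI, Measure.smul_apply, smul_eq_mul]
      rw [← Measure.restrict_apply (F.measurableSet_of_mem_lattice hI)]
      exact mul_le_mul_right (measure_mono hSI) _
    · have hS0 : S = ∅ := by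
        refine Finset.filter_eq_empty_iff.2 fun J hJ => ?_
        exact not_lt.2 ((density_le_one (hs J hJ) E).trans ht1.le)
      simp [hS0]
  calc ∑ J ∈ s, a J * μ (J ∩ E)
      = ∑ J ∈ s, a J * μ J * ∫⁻ t in Ioi (0 : ℝ), ind (density μ E J) t := by
        refine Finset.sum_congr rfl fun J hJ => ?_
        rw [hind, lintegral_indicator_ofReal_lt, mul_assoc, measure_mul_density (hs J hJ)]
    _ = ∫⁻ t in Ioi (0 : ℝ), ∑ J ∈ s, a J * μ J * ind (density μ E J) t := by
        rw [lintegral_finsetSum _ fun J _ => (hindm _).const_mul _]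
        exact Finset.sum_congr rfl fun J _ => (lintegral_const_mul _ (hindm _)).symm
    _ ≤ ∫⁻ t in Ioi (0 : ℝ), μ I *
          ((Ioc 0 p).indicator 1 t + (Ioc p 1).indicator (fun t => ENNReal.ofReal (p / t)) t) :=
        setLIntegral_mono' measurableSet_Ioi hpt
    _ ≤ ∫⁻ t, μ I *
          ((Ioc 0 p).indicator 1 t + (Ioc p 1).indicator (fun t => ENNReal.ofReal (p / t)) t) :=
        setLIntegral_le_lintegral _ _
    _ = μ I * ENNReal.ofReal (psiZero p) := by
        have hm1 : Measurable ((Ioc 0 p).indicator (1 : ℝ → ℝ≥0∞)) :=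
          measurable_one.indicator measurableSet_Ioc
        have hm2 : Measurable ((Ioc p 1).indicator fun t => ENNReal.ofReal (p / t)) :=
          Measurable.indicator (by fun_prop) measurableSet_Ioc
        rw [lintegral_const_mul _ (by fun_prop), lintegral_min_div_le hp0 hp1]

variable (F) in
/-- The `L¹` norm `∑_{K ∈ ch(I)} |K| |⟨f⟩_K - ⟨f⟩_I|` of the martingale difference `Δ_I f`. -/
def diffNorm (I : Set X) (f : X → ℝ) : ℝ≥0∞ :=
  ∑' K : F.children I, μ (K : Set X) * ‖(⨍ x in (K : Set X), f x ∂μ) - ⨍ x in I, f x ∂μ‖ₑ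

variable (F) in
/-- The `L¹` norm of the martingale difference of the indicator of `E`. -/
def setDiffNorm (I E : Set X) : ℝ≥0∞ :=
  ∑' K : F.children I, μ (K : Set X) * ENNReal.ofReal |density μ E K - density μ E I|

theorem setDiffNorm_eq_zero {I E : Set X} (h : μ (I ∩ E) = 0) : F.setDiffNorm I E = 0 := by
  refine ENNReal.tsum_eq_zero.2 fun K => ?_
  rw [density_eq_zero h, density_eq_zero
    (measure_mono_null (inter_subset_inter_left E (F.subset_of_mem_children K.2)) h)]
  simp

/-- One step of the entropy estimate: Pinsker's inequality. -/
theorem setDiffNorm_sq_add_le {I : Set X} (hI : I ∈ F.lattice) {E : Set X} :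
    F.setDiffNorm I E ^ 2 / (4 * μ (I ∩ E)) +
      ∑' K : F.children I, μ (K : Set X) * ENNReal.ofReal (Real.negMulLog (density μ E K)) ≤
    μ I * ENNReal.ofReal (Real.negMulLog (density μ E I)) := by
  have hl : ∀ K : F.children I, (K : Set X) ∈ F.lattice := fun K =>
    F.mem_lattice_of_mem_children K.2
  rcases (density_nonneg μ E I).eq_or_lt with hp0 | hp0
  · have hIE : μ (I ∩ E) = 0 := by rw [← measure_mul_density hI, ← hp0]; simp
    have hK : ∀ K : F.children I, density μ E K = 0 := fun K => density_eq_zero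
      (measure_mono_null (inter_subset_inter_left E (F.subset_of_mem_children K.2)) hIE)
    simp [setDiffNorm_eq_zero hIE, hK]
  set p := density μ E I with hp
  have hp1 : p ≤ 1 := density_le_one hI E
  set m : F.children I → ℝ := fun K => density μ E K with hm
  have hm0 : ∀ K, 0 ≤ m K := fun K => density_nonneg μ E K
  have hm1 : ∀ K, m K ≤ 1 := fun K => density_le_one (hl K) E
  have hsumm : ∑' K : F.children I, μ (K : Set X) * ENNReal.ofReal (m K) = μ (I ∩ E) := by
    rw [← Measure.restrict_apply (F.measurableSet_of_mem_lattice hI),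
      ← F.tsum_measure_children hI]
    refine tsum_congr fun K => ?_
    rw [Measure.restrict_apply (F.measurableSet_child K), measure_mul_density (hl K)]
  set H : ℝ≥0∞ := ∑' K : F.children I, μ (K : Set X) * ENNReal.ofReal (p * (√(m K / p) - 1) ^ 2)
    with hH
  set N : ℝ≥0∞ := ∑' K : F.children I, μ (K : Set X) * ENNReal.ofReal (Real.negMulLog (m K)) with hN
  have hfin : μ (I ∩ E) ≠ ∞ :=
    ne_top_of_le_ne_top (F.measure_lt_top_of_mem_lattice hI).ne (measure_mono inter_subset_left)
  have hent : H + N ≤ μ I * ENNReal.ofReal (Real.negMulLog p) := by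
    have hlogp : 0 ≤ -Real.log p := neg_nonneg.2 (Real.log_nonpos hp0.le hp1)
    -- Summed over the children, the linear terms on the two sides agree: both equal `|I ∩ E|`,
    -- since `p` is the average of the `m K`. The remaining term on the right is the entropy of `p`.
    have hpt : ∀ K : F.children I, μ (K : Set X) * ENNReal.ofReal (Real.negMulLog (m K)) +
        μ (K : Set X) * ENNReal.ofReal (p * (√(m K / p) - 1) ^ 2) +
        μ (K : Set X) * ENNReal.ofReal (m K) ≤
        μ (K : Set X) * ENNReal.ofReal (m K) * ENNReal.ofReal (-Real.log p) +
        μ (K : Set X) * ENNReal.ofReal p := by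
      intro K
      have hn := Real.negMulLog_nonneg (hm0 K) (hm1 K)
      rw [mul_assoc, ← mul_add, ← mul_add, ← mul_add, ← ENNReal.ofReal_mul (hm0 K),
        ← ENNReal.ofReal_add hn (by positivity), ← ENNReal.ofReal_add (by positivity) (hm0 K),
        ← ENNReal.ofReal_add (mul_nonneg (hm0 K) hlogp) hp0.le]
      exact mul_le_mul_right (ENNReal.ofReal_le_ofReal (negMulLog_add_le (hm0 K) hp0)) _
    have hsum := ENNReal.tsum_le_tsum hpt
    simp only [ENNReal.tsum_add, ENNReal.tsum_mul_right, hsumm] at hsum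
    rw [F.tsum_measure_children hI μ, hp, measure_mul_density hI, ← hp] at hsum
    rw [ENNReal.add_le_add_iff_right hfin] at hsum
    rw [add_comm]
    refine hsum.trans (le_of_eq ?_)
    rw [← measure_mul_density hI, mul_assoc, ← ENNReal.ofReal_mul hp0.le, Real.negMulLog]
    congr 2
    ring
  refine le_trans ?_ hent
  gcongr
  refine ENNReal.div_le_of_le_mul ?_
  have hsq : ∀ K : F.children I, (μ (K : Set X) ^ (1 / 2 : ℝ)) ^ 2 = μ (K : Set X) := fun K => by
    rw [← ENNReal.rpow_two, ← ENNReal.rpow_mul]; norm_num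
  -- The first factor sums to `H / p`, and the second to at most `4 p |I ∩ E|`, so `p` cancels and
  -- the constant of Pinsker's inequality is `4 |I ∩ E|`.
  have hCS := ENNReal.tsum_mul_sq_le
    (fun K : F.children I => μ (K : Set X) ^ (1 / 2 : ℝ) * ENNReal.ofReal |√(m K / p) - 1|)
    (fun K : F.children I => μ (K : Set X) ^ (1 / 2 : ℝ) *
      ENNReal.ofReal (p * (√(m K / p) + 1)))
  have e1 : ∀ K : F.children I,
      μ (K : Set X) ^ (1 / 2 : ℝ) * ENNReal.ofReal |√(m K / p) - 1| *
      (μ (K : Set X) ^ (1 / 2 : ℝ) * ENNReal.ofReal (p * (√(m K / p) + 1))) =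
      μ (K : Set X) * ENNReal.ofReal |m K - p| := by
    intro K
    rw [abs_sub_eq_mul_sqrt (hm0 K) hp0, ENNReal.ofReal_mul (abs_nonneg _)]
    nth_rw 3 [← hsq K]
    ring
  simp only [e1] at hCS
  simp only [mul_pow, hsq] at hCS
  have h2 : ∑' K : F.children I, μ (K : Set X) * ENNReal.ofReal (p * (√(m K / p) + 1)) ^ 2 ≤
      4 * ENNReal.ofReal p * μ (I ∩ E) := by
    calc ∑' K : F.children I, μ (K : Set X) * ENNReal.ofReal (p * (√(m K / p) + 1)) ^ 2
        ≤ ∑' K : F.children I, (ENNReal.ofReal (2 * p) * (μ (K : Set X) * ENNReal.ofReal (m K)) +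
            ENNReal.ofReal (2 * p ^ 2) * μ (K : Set X)) := by
          refine ENNReal.tsum_le_tsum fun K => ?_
          rw [mul_left_comm, mul_comm (ENNReal.ofReal (2 * p ^ 2)), ← mul_add,
            ← ENNReal.ofReal_pow (by positivity), ← ENNReal.ofReal_mul (by positivity),
            ← ENNReal.ofReal_add (mul_nonneg (by positivity) (hm0 K)) (by positivity)]
          gcongr
          exact mul_sqrt_add_one_sq_le (hm0 K) hp0
      _ = ENNReal.ofReal (2 * p) * μ (I ∩ E) + ENNReal.ofReal (2 * p ^ 2) * μ I := by
          rw [ENNReal.tsum_add, ENNReal.tsum_mul_left, ENNReal.tsum_mul_left, hsumm,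
            F.tsum_measure_children hI μ]
      _ = 4 * ENNReal.ofReal p * μ (I ∩ E) := by
          rw [← measure_mul_density hI, ← hp, sq, ENNReal.ofReal_mul zero_le_two,
            ENNReal.ofReal_mul zero_le_two, ENNReal.ofReal_mul hp0.le, ENNReal.ofReal_ofNat]
          ring
  calc F.setDiffNorm I E ^ 2 ≤ _ := hCS
    _ ≤ (∑' K : F.children I, μ (K : Set X) * ENNReal.ofReal |√(m K / p) - 1| ^ 2) *
        (4 * ENNReal.ofReal p * μ (I ∩ E)) := by gcongr
    _ = H * (4 * μ (I ∩ E)) := by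
        have : H = ENNReal.ofReal p *
            ∑' K : F.children I, μ (K : Set X) * ENNReal.ofReal |√(m K / p) - 1| ^ 2 := by
          rw [hH, ← ENNReal.tsum_mul_left]
          refine tsum_congr fun K => ?_
          rw [← ENNReal.ofReal_pow (abs_nonneg _), sq_abs, ENNReal.ofReal_mul hp0.le]
          ring
        rw [this]
        ring

/-- The entropy `|K| (-m ln m)`, with `m` the density of `E` in `K`, is a superadditive majorant:
each passage to the children pays for one difference. Its initial value is below `|I| ψ₀`. -/
theorem sum_setDiffNorm_sq_le (E : Set X) :
    F.CarlesonBound (fun J => F.setDiffNorm J E ^ 2 / (4 * μ (J ∩ E)))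
      fun I => μ I * ENNReal.ofReal (psiZero (density μ E I)) := by
  intro I hI s hs hsI
  refine (F.sum_le_of_superadditive
    (B := fun K => μ K * ENNReal.ofReal (Real.negMulLog (density μ E K)))
    (fun J hJ => setDiffNorm_sq_add_le hJ) hI hs hsI).trans ?_
  dsimp only
  gcongr
  exact negMulLog_le_psiZero (density_nonneg μ E I)

end AtomicFiltration

/-! ### Dyadic summation of the penalty function. -/

namespace IsPenalty

variable {α : ℝ → ℝ}

theorem mul_pos (hα : IsPenalty α) {t : ℝ} (ht : 1 ≤ t) : 0 < t * α t :=
  _root_.mul_pos (by linarith) (hα.pos t ht)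

theorem antitoneOn (hα : IsPenalty α) : AntitoneOn (fun t => 1 / (t * α t)) (Ici 1) :=
  fun _ hs _ ht hst => one_div_le_one_div_of_le (hα.mul_pos hs) (hα.mono hs ht hst)

theorem integral_nonneg (hα : IsPenalty α) : 0 ≤ ∫ t in Ioi (1 : ℝ), 1 / (t * α t) :=
  setIntegral_nonneg measurableSet_Ioi fun _ ht => (one_div_pos.2 (hα.mul_pos (le_of_lt ht))).le

theorem penaltyConst_pos (hα : IsPenalty α) : 0 < penaltyConst α :=
  add_pos_of_pos_of_nonneg (one_div_pos.2 (hα.pos 1 le_rfl)) hα.integral_nonneg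

theorem one_div_le_penaltyConst (hα : IsPenalty α) {t : ℝ} (ht : 1 ≤ t) :
    1 / (t * α t) ≤ penaltyConst α := by
  have h := hα.antitoneOn (mem_Ici.2 le_rfl) (mem_Ici.2 ht) ht
  simp only [one_mul] at h
  exact h.trans (le_add_of_nonneg_right hα.integral_nonneg)

/-- Cauchy condensation: since `1/(t α(t))` is decreasing, the term with `k ≥ 1` is at most 4 times
the integral over `[2^(k-1), 2^k]`. The term `k = 0` equals `2/α(1)`, which is why `C_α` includes
`1/α(1)`. -/
theorem sum_dyadic_le (hα : IsPenalty α) (n : ℕ) :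
    ∑ k ∈ Finset.range n, 1 / ((2 : ℝ) ^ k * α (2 ^ k)) * 2 ^ (k + 1) ≤ 4 * penaltyConst α := by
  have hone : ∀ k : ℕ, (1 : ℝ) ≤ 2 ^ k := fun k => one_le_pow₀ one_le_two
  have hinteg : ∀ a b : ℝ, 1 ≤ a → a ≤ b →
      IntervalIntegrable (fun t => 1 / (t * α t)) volume a b := by
    intro a b ha hab
    rw [intervalIntegrable_iff_integrableOn_Ioc_of_le hab]
    exact hα.integrable.mono_set fun t ht => lt_of_le_of_lt ha ht.1
  have key : ∀ n : ℕ, ∑ k ∈ Finset.range (n + 1), 1 / ((2 : ℝ) ^ k * α (2 ^ k)) * 2 ^ (k + 1) ≤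
      2 * (1 / α 1) + 4 * ∫ t in (1 : ℝ)..2 ^ n, 1 / (t * α t) := by
    intro n
    induction n with
    | zero => simp [mul_comm]
    | succ n ih =>
      rw [Finset.sum_range_succ]
      have hle : (2 : ℝ) ^ n ≤ 2 ^ (n + 1) := pow_le_pow_right₀ one_le_two (Nat.le_succ n)
      have hlow : 1 / ((2 : ℝ) ^ (n + 1) * α (2 ^ (n + 1))) * 2 ^ n ≤
          ∫ t in (2 : ℝ) ^ n..2 ^ (n + 1), 1 / (t * α t) := by
        have h := intervalIntegral.integral_mono_on hle
          (f := fun _ => 1 / ((2 : ℝ) ^ (n + 1) * α (2 ^ (n + 1)))) (g := fun t => 1 / (t * α t))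
          intervalIntegrable_const (hinteg _ _ (hone n) hle) fun t ht =>
            hα.antitoneOn (mem_Ici.2 ((hone n).trans ht.1)) (mem_Ici.2 (hone (n + 1))) ht.2
        rw [intervalIntegral.integral_const, smul_eq_mul] at h
        calc _ = ((2 : ℝ) ^ (n + 1) - 2 ^ n) * (1 / ((2 : ℝ) ^ (n + 1) * α (2 ^ (n + 1)))) := by
              rw [show (2 : ℝ) ^ (n + 1) - 2 ^ n = 2 ^ n by ring]; ring
          _ ≤ _ := h
      rw [← intervalIntegral.integral_add_adjacent_intervals (hinteg 1 _ le_rfl (hone n))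
        (hinteg _ _ (hone n) hle)]
      have h4 : 1 / ((2 : ℝ) ^ (n + 1) * α (2 ^ (n + 1))) * 2 ^ (n + 1 + 1) =
          4 * (1 / ((2 : ℝ) ^ (n + 1) * α (2 ^ (n + 1))) * 2 ^ n) := by ring
      linarith
  have hle : ∀ n : ℕ, ∫ t in (1 : ℝ)..2 ^ n, 1 / (t * α t) ≤ ∫ t in Ioi (1 : ℝ), 1 / (t * α t) := by
    intro n
    rw [intervalIntegral.integral_of_le (hone n)]
    refine setIntegral_mono_set hα.integrable ?_ (Eventually.of_forall fun t ht => ht.1)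
    exact (ae_restrict_iff' measurableSet_Ioi).2
      (Eventually.of_forall fun t ht => (one_div_pos.2 (hα.mul_pos (le_of_lt ht))).le)
  have h1 : 0 < 1 / α 1 := one_div_pos.2 (hα.pos 1 le_rfl)
  rcases n with _ | n
  · simpa using hα.penaltyConst_pos.le
  · have := key n
    have := hle n
    simp only [penaltyConst]
    linarith

theorem finset_sum_dyadic_le (hα : IsPenalty α) (t : Finset ℕ) :
    ∑ k ∈ t, ENNReal.ofReal (1 / ((2 : ℝ) ^ k * α (2 ^ k)) * 2 ^ (k + 1)) ≤
      ENNReal.ofReal (4 * penaltyConst α) := by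
  have hpos : ∀ k : ℕ, 0 ≤ 1 / ((2 : ℝ) ^ k * α (2 ^ k)) * 2 ^ (k + 1) := fun k =>
    mul_nonneg (one_div_pos.2 (hα.mul_pos (one_le_pow₀ one_le_two))).le (by positivity)
  obtain ⟨n, hn⟩ := t.exists_nat_subset_range
  calc _ ≤ ∑ k ∈ Finset.range n, ENNReal.ofReal (1 / ((2 : ℝ) ^ k * α (2 ^ k)) * 2 ^ (k + 1)) :=
        Finset.sum_le_sum_of_subset hn
    _ = ENNReal.ofReal (∑ k ∈ Finset.range n, 1 / ((2 : ℝ) ^ k * α (2 ^ k)) * 2 ^ (k + 1)) :=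
        (ENNReal.ofReal_sum_of_nonneg fun k _ => hpos k).symm
    _ ≤ _ := ENNReal.ofReal_le_ofReal (hα.sum_dyadic_le n)

end IsPenalty

/-! ### From level sets to weights, and division by the entropy bump. -/

namespace AtomicFiltration

variable {X : Type*} [mX : MeasurableSpace X] {μ : Measure X} {F : AtomicFiltration μ}
  {u : X → ℝ} {α : ℝ → ℝ}

theorem IsWeight.average_nonneg (hu : F.IsWeight u) (I : Set X) : 0 ≤ ⨍ x in I, u x ∂μ := by
  rw [setAverage_eq]
  exact smul_nonneg (inv_nonneg.2 measureReal_nonneg) (integral_nonneg hu.nonneg)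

theorem IsWeight.weighted_apply (hu : F.IsWeight u) {I : Set X} (hI : I ∈ F.lattice) :
    weighted μ u I = ENNReal.ofReal (∫ x in I, u x ∂μ) := by
  rw [weighted, withDensity_apply _ (F.measurableSet_of_mem_lattice hI),
    ofReal_integral_eq_lintegral_ofReal (hu.integrableOn I hI) (Eventually.of_forall hu.nonneg)]

theorem IsWeight.weighted_ne_top (hu : F.IsWeight u) {I : Set X} (hI : I ∈ F.lattice) :
    weighted μ u I ≠ ∞ := by
  rw [hu.weighted_apply hI]
  exact ENNReal.ofReal_ne_top

theorem measure_mul_ofReal_average {I : Set X} (hI : I ∈ F.lattice) (f : X → ℝ) :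
    μ I * ENNReal.ofReal (⨍ x in I, f x ∂μ) = ENNReal.ofReal (∫ x in I, f x ∂μ) := by
  have h := F.measureReal_pos_of_mem_lattice hI
  rw [setAverage_eq, smul_eq_mul, ENNReal.ofReal_mul (inv_nonneg.2 h.le), ← mul_assoc,
    ENNReal.ofReal_inv_of_pos h, Measure.real,
    ENNReal.ofReal_toReal (F.measure_lt_top_of_mem_lattice hI).ne,
    ENNReal.mul_inv_cancel (F.measure_pos_of_mem_lattice hI).ne'
      (F.measure_lt_top_of_mem_lattice hI).ne, one_mul]

theorem IsWeight.weighted_eq_mul_average (hu : F.IsWeight u) {I : Set X} (hI : I ∈ F.lattice) :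
    weighted μ u I = μ I * ENNReal.ofReal (⨍ x in I, u x ∂μ) := by
  rw [hu.weighted_apply hI, measure_mul_ofReal_average hI]

theorem IsWeight.weighted_eq_lintegral (hu : F.IsWeight u) {I : Set X} (hI : I ∈ F.lattice) :
    weighted μ u I = ∫⁻ t in Ioi (0 : ℝ), μ (I ∩ {x | t < u x}) := by
  have hm := F.measurableSet_of_mem_lattice hI
  rw [weighted, withDensity_apply _ hm, lintegral_eq_lintegral_meas_lt _
    (Eventually.of_forall hu.nonneg) hu.measurable.aemeasurable]
  refine lintegral_congr fun t => ?_
  rw [Measure.restrict_apply (measurableSet_lt measurable_const hu.measurable), inter_comm]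

theorem measurable_measure_inter (I : Set X) (u : X → ℝ) :
    Measurable fun t : ℝ => μ (I ∩ {x | t < u x}) := by
  refine Antitone.measurable fun s t hst => measure_mono ?_
  exact inter_subset_inter_right I fun x hx => lt_of_le_of_lt hst hx

theorem measurable_density {I : Set X} (u : X → ℝ) :
    Measurable fun t : ℝ => density μ {x | t < u x} I :=
  (measurable_measure_inter I u).ennreal_toReal.div_const _

theorem measurable_psiZero : Measurable psiZero := by
  unfold psiZero
  fun_prop

theorem measure_mul_llogl {I : Set X} (u : X → ℝ) :
    μ I * llogl μ I u =
      ∫⁻ t in Ioi (0 : ℝ), μ I * ENNReal.ofReal (psiZero (density μ {x | t < u x} I)) := by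
  rw [llogl, ← lintegral_const_mul]
  · rfl
  · exact (measurable_psiZero.comp (measurable_density u)).ennreal_ofReal

theorem IsWeight.weighted_le_mul_llogl (hu : F.IsWeight u) {I : Set X} (hI : I ∈ F.lattice) :
    weighted μ u I ≤ μ I * llogl μ I u := by
  rw [hu.weighted_eq_lintegral hI, measure_mul_llogl]
  refine lintegral_mono fun t => ?_
  rw [← measure_mul_density hI]
  gcongr
  exact le_psiZero (density_nonneg _ _ _) (density_le_one hI _)

/-- The estimate for sets is applied to each `{u > t}` and integrated in `t`. Nothing is lost,
because `u*_I` is defined as the integral of `ψ₀` of the densities of these sets. -/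
theorem IsWeight.sum_mul_weighted_le (hu : F.IsWeight u) {a : Set X → ℝ≥0∞}
    (ha : F.CarlesonBound (fun J => a J * μ J) fun I => μ I) :
    F.CarlesonBound (fun J => a J * weighted μ u J) fun I => μ I * llogl μ I u := by
  intro I hI s hs hsI
  have hm := fun J => measurable_measure_inter (μ := μ) J u
  calc ∑ J ∈ s, a J * weighted μ u J
      = ∑ J ∈ s, ∫⁻ t in Ioi (0 : ℝ), a J * μ (J ∩ {x | t < u x}) := by
        refine Finset.sum_congr rfl fun J hJ => ?_
        rw [hu.weighted_eq_lintegral (hs J hJ), lintegral_const_mul _ (hm J)]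
    _ = ∫⁻ t in Ioi (0 : ℝ), ∑ J ∈ s, a J * μ (J ∩ {x | t < u x}) :=
        (lintegral_finsetSum _ fun J _ => (hm J).const_mul _).symm
    _ ≤ μ I * llogl μ I u := by
        rw [measure_mul_llogl]
        refine lintegral_mono fun t => ?_
        exact sum_mul_measure_inter_le ha _ I hI s hs hsI

theorem IsWeight.ofReal_average_eq_lintegral (hu : F.IsWeight u) {I : Set X}
    (hI : I ∈ F.lattice) : ENNReal.ofReal (⨍ x in I, u x ∂μ) =
      ∫⁻ t in Ioi (0 : ℝ), ENNReal.ofReal (density μ {x | t < u x} I) := by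
  have h0 := (F.measure_pos_of_mem_lattice hI).ne'
  have h1 := (F.measure_lt_top_of_mem_lattice hI).ne
  refine (ENNReal.mul_right_inj h0 h1).1 ?_
  rw [← hu.weighted_eq_mul_average hI, hu.weighted_eq_lintegral hI,
    ← lintegral_const_mul _ (measurable_density u).ennreal_ofReal]
  exact lintegral_congr fun t => (measure_mul_density hI _).symm

/-- The triangle inequality for `u = ∫_0^∞ 1_{u > t} dt`. It is proved without subtraction, by
comparing both averages through their layer cake formulas. -/
theorem IsWeight.diffNorm_le_lintegral (hu : F.IsWeight u) {I : Set X} (hI : I ∈ F.lattice) :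
    F.diffNorm I u ≤ ∫⁻ t in Ioi (0 : ℝ), F.setDiffNorm I {x | t < u x} := by
  have hm : ∀ K : F.children I, Measurable fun t : ℝ =>
      ENNReal.ofReal |density μ {x | t < u x} (K : Set X) - density μ {x | t < u x} I| := fun K =>
    (((measurable_density u).sub (measurable_density u)).abs).ennreal_ofReal
  simp only [setDiffNorm]
  rw [lintegral_tsum fun K => ((hm K).const_mul _).aemeasurable]
  refine ENNReal.tsum_le_tsum fun K => ?_
  rw [lintegral_const_mul _ (hm K)]
  gcongr
  have hmd : ∀ J : Set X, Measurable fun t : ℝ => ENNReal.ofReal (density μ {x | t < u x} J) :=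
    fun J => (measurable_density u).ennreal_ofReal
  refine enorm_sub_le_of_ofReal_le (hu.average_nonneg _) (hu.average_nonneg _) ?_ ?_ <;>
  rw [hu.ofReal_average_eq_lintegral hI,
    hu.ofReal_average_eq_lintegral (F.mem_lattice_of_mem_children K.2),
    ← lintegral_add_left (hmd _)] <;>
  refine lintegral_mono fun t => ?_ <;>
  rw [← ENNReal.ofReal_add (density_nonneg _ _ _) (abs_nonneg _)] <;>
  refine ENNReal.ofReal_le_ofReal ?_
  · linarith [le_abs_self (density μ {x | t < u x} (K : Set X) - density μ {x | t < u x} I)]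
  · linarith [neg_abs_le (density μ {x | t < u x} (K : Set X) - density μ {x | t < u x} I)]

theorem measurable_setDiffNorm (I : Set X) (u : X → ℝ) :
    Measurable fun t : ℝ => F.setDiffNorm I {x | t < u x} := by
  refine Measurable.tsum fun K => Measurable.const_mul ?_ _
  exact (((measurable_density u).sub (measurable_density u)).abs).ennreal_ofReal

theorem IsWeight.sum_diffNorm_sq_le (hu : F.IsWeight u) :
    F.CarlesonBound (fun J => F.diffNorm J u ^ 2 / (4 * weighted μ u J))
      fun I => μ I * llogl μ I u := by
  intro I hI s hs hsI
  have hm : ∀ J, Measurable fun t : ℝ => 4 * μ (J ∩ {x | t < u x}) := fun J =>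
    (measurable_measure_inter J u).const_mul 4
  have hd := fun J => measurable_setDiffNorm (F := F) J u
  calc ∑ J ∈ s, F.diffNorm J u ^ 2 / (4 * weighted μ u J)
      ≤ ∑ J ∈ s, ∫⁻ t in Ioi (0 : ℝ),
          F.setDiffNorm J {x | t < u x} ^ 2 / (4 * μ (J ∩ {x | t < u x})) := by
        refine Finset.sum_le_sum fun J hJ => ENNReal.div_le_of_le_mul ?_
        rw [hu.weighted_eq_lintegral (hs J hJ),
          ← lintegral_const_mul _ (measurable_measure_inter J u)]
        refine le_trans (pow_le_pow_left' (hu.diffNorm_le_lintegral (hs J hJ)) 2) ?_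
        -- Cauchy–Schwarz as `(∫ a)² ≤ ∫ a²/b · ∫ b` with `b = 4 |J ∩ {u > t}|`, whose integral over
        -- `t` is `4 u(J)`: the denominators for sets integrate to the denominator for `u`.
        refine ENNReal.lintegral_sq_le_div (hd J) (hm J) (fun t ht => ?_) fun t => ?_
        · refine setDiffNorm_eq_zero ?_
          simpa using ht
        · exact ENNReal.mul_ne_top (by norm_num) (ne_top_of_le_ne_top
            (F.measure_lt_top_of_mem_lattice (hs J hJ)).ne (measure_mono inter_subset_left))
    _ = ∫⁻ t in Ioi (0 : ℝ), ∑ J ∈ s,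
          F.setDiffNorm J {x | t < u x} ^ 2 / (4 * μ (J ∩ {x | t < u x})) :=
        (lintegral_finsetSum _ fun J _ => ((hd J).pow_const 2).div (hm J)).symm
    _ ≤ μ I * llogl μ I u := by
        rw [measure_mul_llogl]
        refine lintegral_mono fun t => ?_
        exact sum_setDiffNorm_sq_le _ I hI s hs hsI

theorem IsWeight.measure_mul_llogl_eq (hu : F.IsWeight u) {J : Set X} (hJ : J ∈ F.lattice)
    (h0 : weighted μ u J ≠ 0) (hfin : llogl μ J u ≠ ∞) :
    μ J * llogl μ J u =
      ENNReal.ofReal ((llogl μ J u).toReal / ⨍ x in J, u x ∂μ) * weighted μ u J := by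
  have hpos : 0 < ⨍ x in J, u x ∂μ := by
    refine lt_of_le_of_ne (hu.average_nonneg J) fun h => h0 ?_
    rw [hu.weighted_eq_mul_average hJ, ← h]
    simp
  rw [hu.weighted_eq_mul_average hJ, mul_left_comm, ← ENNReal.ofReal_mul (by positivity),
    div_mul_cancel₀ _ hpos.ne', ENNReal.ofReal_toReal hfin]

/-- A consequence of `s ≤ ψ₀(s)`. It guarantees that `α` is evaluated only on `[1, ∞)`, where the
assumptions on it hold. -/
theorem IsWeight.one_le_llogl_div (hu : F.IsWeight u) {J : Set X} (hJ : J ∈ F.lattice)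
    (h0 : weighted μ u J ≠ 0) (hfin : llogl μ J u ≠ ∞) :
    1 ≤ (llogl μ J u).toReal / ⨍ x in J, u x ∂μ := by
  have h := hu.weighted_le_mul_llogl hJ
  rw [hu.measure_mul_llogl_eq hJ h0 hfin] at h
  by_contra hlt
  refine absurd h (not_le.2 ?_)
  nth_rw 2 [← one_mul (weighted μ u J)]
  refine (ENNReal.mul_lt_mul_iff_left h0 (hu.weighted_ne_top hJ)).2 ?_
  simpa [ENNReal.ofReal_lt_one] using hlt

theorem IsWeight.measure_mul_entropyBump (hu : F.IsWeight u) {J : Set X}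
    (α : ℝ → ℝ) (hJ : J ∈ F.lattice) (h0 : weighted μ u J ≠ 0) (hfin : llogl μ J u ≠ ∞) :
    μ J * entropyBump μ α J u =
      ENNReal.ofReal ((llogl μ J u).toReal / (⨍ x in J, u x ∂μ) *
        α ((llogl μ J u).toReal / ⨍ x in J, u x ∂μ)) * weighted μ u J := by
  have h1 := hu.one_le_llogl_div hJ h0 hfin
  rw [entropyBump, if_neg hfin, mul_left_comm, hu.measure_mul_llogl_eq hJ h0 hfin,
    ENNReal.ofReal_mul (by linarith)]
  ring

theorem IsWeight.entropyBump_ne_zero (hu : F.IsWeight u) (hα : IsPenalty α) {J : Set X}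
    (hJ : J ∈ F.lattice) (h0 : weighted μ u J ≠ 0) : entropyBump μ α J u ≠ 0 := by
  by_cases hfin : llogl μ J u = ∞
  · simp [entropyBump, hfin]
  intro h
  have h1 := hu.measure_mul_entropyBump α hJ h0 hfin
  rw [h, mul_zero] at h1
  have h2 := hα.mul_pos (hu.one_le_llogl_div hJ h0 hfin)
  rcases mul_eq_zero.1 h1.symm with h3 | h3
  · exact absurd (ENNReal.ofReal_eq_zero.1 h3) (not_le.2 h2)
  · exact h0 h3

/-- Dividing by the entropy bump turns an `L log L` bound into a Carleson condition. -/
theorem CarlesonBound.div_entropyBump (hu : F.IsWeight u) (hα : IsPenalty α)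
    {d : Set X → ℝ≥0∞} {L : ℝ≥0∞} (hd0 : ∀ J ∈ F.lattice, weighted μ u J = 0 → d J = 0)
    (hd : F.CarlesonBound (fun J => d J / weighted μ u J) fun I => L * (μ I * llogl μ I u)) :
    F.CarlesonBound (fun J => d J / (μ J * entropyBump μ α J u))
      fun I => ENNReal.ofReal (4 * penaltyConst α) * L * weighted μ u I := by
  classical
  intro I hI s hs hsI
  set r : Set X → ℝ := fun J => (llogl μ J u).toReal / ⨍ x in J, u x ∂μ with hr
  set S := s.filter fun J => weighted μ u J ≠ 0 ∧ llogl μ J u ≠ ∞ with hS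
  have hSs : ∀ J ∈ S, J ∈ s := fun J hJ => (Finset.mem_filter.1 hJ).1
  have hSl : ∀ J ∈ S, J ∈ F.lattice := fun J hJ => hs J (hSs J hJ)
  have hS0 : ∀ J ∈ S, weighted μ u J ≠ 0 := fun J hJ => (Finset.mem_filter.1 hJ).2.1
  have hSf : ∀ J ∈ S, llogl μ J u ≠ ∞ := fun J hJ => (Finset.mem_filter.1 hJ).2.2
  -- Degenerate atoms contribute nothing: if `u(J) = 0` then `d J = 0`, and if `u*_J = ∞` the
  -- denominator is infinite.
  have hsum : ∑ J ∈ s, d J / (μ J * entropyBump μ α J u) =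
      ∑ J ∈ S, d J / (μ J * entropyBump μ α J u) := by
    refine (Finset.sum_subset (Finset.filter_subset _ _) fun J hJ hJS => ?_).symm
    have : weighted μ u J = 0 ∨ llogl μ J u = ∞ := by
      by_contra hcon
      push Not at hcon
      exact hJS (Finset.mem_filter.2 ⟨hJ, hcon⟩)
    rcases this with h | h
    · rw [hd0 J (hs J hJ) h, ENNReal.zero_div]
    · rw [entropyBump, if_pos h, ENNReal.mul_top (F.measure_pos_of_mem_lattice (hs J hJ)).ne',
        ENNReal.div_top]
  -- Classes by the dyadic size of `r = u*/u`. On the class `k` the denominator is `r α(r) u(J) ≥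
  -- 2^k α(2^k) u(J)`.
  have hk : ∀ J ∈ S, ∃ k : ℕ, (2 : ℝ) ^ k ≤ r J ∧ r J < 2 ^ (k + 1) := fun J hJ =>
    exists_nat_pow_near (hu.one_le_llogl_div (hSl J hJ) (hS0 J hJ) (hSf J hJ)) one_lt_two
  choose! k hk1 hk2 using hk
  have hfiber : ∀ j : ℕ, ∑ J ∈ S with k J = j, d J / (μ J * entropyBump μ α J u) ≤
      ENNReal.ofReal (1 / ((2 : ℝ) ^ j * α (2 ^ j)) * 2 ^ (j + 1)) * (L * weighted μ u I) := by
    intro j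
    set T := S.filter fun J => k J = j with hT
    have hTS : ∀ J ∈ T, J ∈ S := fun J hJ => (Finset.mem_filter.1 hJ).1
    have hTk : ∀ J ∈ T, k J = j := fun J hJ => (Finset.mem_filter.1 hJ).2
    have hj : (1 : ℝ) ≤ 2 ^ j := one_le_pow₀ one_le_two
    have hφ := hα.mul_pos hj
    calc ∑ J ∈ T, d J / (μ J * entropyBump μ α J u)
        ≤ ∑ J ∈ T, ENNReal.ofReal (1 / ((2 : ℝ) ^ j * α (2 ^ j))) * (d J / weighted μ u J) := by
          refine Finset.sum_le_sum fun J hJ => ?_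
          have hJS := hTS J hJ
          have h2 : (2 : ℝ) ^ j * α (2 ^ j) ≤ r J * α (r J) := by
            have := hk1 J hJS
            rw [hTk J hJ] at this
            exact hα.mono (mem_Ici.2 hj) (mem_Ici.2 (hj.trans this)) this
          rw [hu.measure_mul_entropyBump α (hSl J hJS) (hS0 J hJS) (hSf J hJS)]
          calc d J / (ENNReal.ofReal (r J * α (r J)) * weighted μ u J)
              ≤ d J / (ENNReal.ofReal ((2 : ℝ) ^ j * α (2 ^ j)) * weighted μ u J) := by gcongr
            _ = _ := by
                rw [one_div, ENNReal.ofReal_inv_of_pos hφ, div_eq_mul_inv, div_eq_mul_inv,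
                  ENNReal.mul_inv (Or.inr (hu.weighted_ne_top (hSl J hJS)))
                    (Or.inr (hS0 J hJS))]
                ring
      _ = ENNReal.ofReal (1 / ((2 : ℝ) ^ j * α (2 ^ j))) * ∑ J ∈ T, d J / weighted μ u J :=
          (Finset.mul_sum _ _ _).symm
      _ ≤ ENNReal.ofReal (1 / ((2 : ℝ) ^ j * α (2 ^ j))) *
            ((L * ENNReal.ofReal (2 ^ (j + 1))) • weighted μ u) (⋃ J ∈ T, J) := by
          gcongr
          -- The `L log L` bound is used only on atoms `M` of the class, where `|M| u*_M` is at most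
          -- `2^(j+1) u(M)`; this makes the right side a measure, so the maximal atoms add up.
          refine F.sum_le_measure_iUnion (fun J hJ => hSl J (hTS J hJ)) fun M hM t ht htM => ?_
          have hMS := hTS M hM
          refine (hd M (hSl M hMS) t (fun J hJ => hSl J (hTS J (ht hJ))) htM).trans ?_
          dsimp only
          rw [hu.measure_mul_llogl_eq (hSl M hMS) (hS0 M hMS) (hSf M hMS), Measure.smul_apply,
            smul_eq_mul, mul_assoc]
          gcongr
          have := hk2 M hMS
          rw [hTk M hM] at this
          exact this.le
      _ ≤ ENNReal.ofReal (1 / ((2 : ℝ) ^ j * α (2 ^ j))) *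
            ((L * ENNReal.ofReal (2 ^ (j + 1))) • weighted μ u) I := by
          gcongr
          exact iUnion₂_subset fun J hJ => hsI J (hSs J (hTS J hJ))
      _ = _ := by
          rw [ENNReal.ofReal_mul (one_div_pos.2 hφ).le, Measure.smul_apply, smul_eq_mul]
          ring
  calc ∑ J ∈ s, d J / (μ J * entropyBump μ α J u)
      = ∑ j ∈ S.image k, ∑ J ∈ S with k J = j, d J / (μ J * entropyBump μ α J u) := by
        rw [hsum, Finset.sum_fiberwise_of_maps_to fun J hJ => Finset.mem_image_of_mem k hJ]
    _ ≤ ∑ j ∈ S.image k,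
          ENNReal.ofReal (1 / ((2 : ℝ) ^ j * α (2 ^ j)) * 2 ^ (j + 1)) * (L * weighted μ u I) :=
        Finset.sum_le_sum fun j _ => hfiber j
    _ ≤ ENNReal.ofReal (4 * penaltyConst α) * (L * weighted μ u I) := by
        rw [← Finset.sum_mul]
        gcongr
        exact hα.finset_sum_dyadic_le _
    _ = _ := (mul_assoc _ _ _).symm

end AtomicFiltration

/-! ### The one-weight embedding theorems for differences and averages. -/

theorem ENNReal.add_sq_le_two_mul (a b : ℝ≥0∞) : (a + b) ^ 2 ≤ 2 * a ^ 2 + 2 * b ^ 2 := by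
  have h := ENNReal.rpow_add_le_mul_rpow_add_rpow a b (one_le_two (α := ℝ))
  norm_num at h
  rwa [mul_add] at h

/-- The variance identity `∫ |f - a|² = ∫ |f - ⟨f⟩|² + |⟨f⟩ - a|² ρ(Y)`. -/
theorem lintegral_enorm_sub_sq_eq {Y : Type*} [MeasurableSpace Y] {ρ : Measure Y}
    [IsFiniteMeasure ρ] {f : Y → ℝ} (hf : MemLp f 2 ρ) (a : ℝ) :
    ∫⁻ y, ‖f y - a‖ₑ ^ 2 ∂ρ =
      ∫⁻ y, ‖f y - ⨍ z, f z ∂ρ‖ₑ ^ 2 ∂ρ + ρ univ * ‖(⨍ z, f z ∂ρ) - a‖ₑ ^ 2 := by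
  set c := ⨍ z, f z ∂ρ with hc
  have hsq : ∀ r : ℝ, ‖r‖ₑ ^ 2 = ENNReal.ofReal (r ^ 2) := fun r => by
    rw [Real.enorm_eq_ofReal_abs, ← ENNReal.ofReal_pow (abs_nonneg r), sq_abs]
  have hinteg : ∀ b : ℝ, Integrable (fun y => (f y - b) ^ 2) ρ := fun b =>
    (hf.sub (memLp_const b)).integrable_sq
  have hf1 : Integrable f ρ := hf.integrable (by norm_num)
  have h0 : ∫ y, (f y - c) ∂ρ = 0 := integral_sub_average ρ f
  have hreal : ∫ y, (f y - a) ^ 2 ∂ρ = ∫ y, (f y - c) ^ 2 ∂ρ + ρ.real univ * (c - a) ^ 2 := by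
    have h1 : ∀ y, (f y - a) ^ 2 = (f y - c) ^ 2 + (2 * (c - a) * (f y - c) + (c - a) ^ 2) :=
      fun y => by ring
    simp_rw [h1]
    have hi2 : Integrable (fun y => 2 * (c - a) * (f y - c)) ρ :=
      (hf1.sub (integrable_const c)).const_mul _
    have hi3 : Integrable (fun y => 2 * (c - a) * (f y - c) + (c - a) ^ 2) ρ :=
      hi2.add (integrable_const _)
    rw [integral_add (hinteg c) hi3, integral_add hi2 (integrable_const _), integral_const_mul,
      h0, integral_const, smul_eq_mul]
    ring
  simp_rw [hsq]
  rw [← ofReal_integral_eq_lintegral_ofReal (hinteg a) (Eventually.of_forall fun y => sq_nonneg _),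
    ← ofReal_integral_eq_lintegral_ofReal (hinteg c) (Eventually.of_forall fun y => sq_nonneg _),
    hreal, ENNReal.ofReal_add (integral_nonneg fun y => sq_nonneg _) (by positivity),
    ENNReal.ofReal_mul measureReal_nonneg, ofReal_measureReal]

instance {X : Type*} [MeasurableSpace X] (μ : Measure X) [SFinite μ] (u : X → ℝ) :
    SFinite (weighted μ u) := by unfold weighted; infer_instance

namespace AtomicFiltration

variable {X : Type*} [mX : MeasurableSpace X] {μ : Measure X} {F : AtomicFiltration μ}
  {u : X → ℝ} {α : ℝ → ℝ} {f : X → ℝ}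

theorem memLp_restrict_integrable {ν : Measure X} (hf : MemLp f 2 ν) {I : Set X} (hI : ν I ≠ ∞) :
    IntegrableOn f I ν := by
  have : IsFiniteMeasure (ν.restrict I) := ⟨by simpa using hI.lt_top⟩
  exact (hf.restrict I).integrable (by norm_num)

theorem IsWeight.setIntegral_mul (hu : F.IsWeight u) (f : X → ℝ) {I : Set X}
    (hI : MeasurableSet I) : ∫ x in I, f x * u x ∂μ = ∫ x in I, f x ∂(weighted μ u) := by
  rw [weighted, setIntegral_withDensity_eq_setIntegral_toReal_smul hu.measurable.ennreal_ofReal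
    (Eventually.of_forall fun x => ENNReal.ofReal_lt_top) f hI]
  refine integral_congr_ae (Eventually.of_forall fun x => ?_)
  simp only [ENNReal.toReal_ofReal (hu.nonneg x), smul_eq_mul, mul_comm]

theorem IsWeight.integral_mul (hu : F.IsWeight u) (f : X → ℝ) :
    ∫ x, f x * u x ∂μ = ∫ x, f x ∂(weighted μ u) := by
  simpa using hu.setIntegral_mul f MeasurableSet.univ

theorem IsWeight.integrableOn_mul (hu : F.IsWeight u) (hf : MemLp f 2 (weighted μ u)) {I : Set X}
    (hI : I ∈ F.lattice) : IntegrableOn (fun x => f x * u x) I μ := by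
  have h := memLp_restrict_integrable hf (hu.weighted_ne_top hI)
  rw [IntegrableOn, weighted, restrict_withDensity (F.measurableSet_of_mem_lattice hI),
    integrable_withDensity_iff_integrable_smul' hu.measurable.ennreal_ofReal
      (Eventually.of_forall fun x => ENNReal.ofReal_lt_top)] at h
  refine h.congr (Eventually.of_forall fun x => ?_)
  simp only [ENNReal.toReal_ofReal (hu.nonneg x), smul_eq_mul, mul_comm]

theorem measureReal_mul_average {ν : Measure X} {I : Set X} (hI : ν I ≠ ∞) (f : X → ℝ) :
    ν.real I * ⨍ x in I, f x ∂ν = ∫ x in I, f x ∂ν := by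
  have : IsFiniteMeasure (ν.restrict I) := ⟨by simpa using hI.lt_top⟩
  have h := measure_smul_average (ν.restrict I) f
  simpa [measureReal_restrict_apply_univ] using h

theorem IsWeight.weighted_real (hu : F.IsWeight u) {I : Set X} (hI : I ∈ F.lattice) :
    (weighted μ u).real I = μ.real I * ⨍ x in I, u x ∂μ := by
  rw [measureReal_mul_average (F.measure_lt_top_of_mem_lattice hI).ne, Measure.real,
    hu.weighted_apply hI, ENNReal.toReal_ofReal (integral_nonneg hu.nonneg)]

theorem IsWeight.measureReal_mul_average_mul (hu : F.IsWeight u) (f : X → ℝ) {I : Set X}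
    (hI : I ∈ F.lattice) : μ.real I * ⨍ x in I, f x * u x ∂μ =
      (weighted μ u).real I * ⨍ x in I, f x ∂(weighted μ u) := by
  rw [measureReal_mul_average (F.measure_lt_top_of_mem_lattice hI).ne,
    measureReal_mul_average (hu.weighted_ne_top hI),
    hu.setIntegral_mul f (F.measurableSet_of_mem_lattice hI)]

theorem measure_mul_enorm {ν : Measure X} {I : Set X} (hI : ν I ≠ ∞) (r : ℝ) :
    ν I * ‖r‖ₑ = ‖ν.real I * r‖ₑ := by
  rw [enorm_mul, Real.enorm_of_nonneg measureReal_nonneg, ofReal_measureReal hI]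

theorem enorm_average_le {ν : Measure X} {I : Set X} (hI : ν I ≠ ∞) (f : X → ℝ) :
    ‖⨍ x in I, f x ∂ν‖ₑ ≤ (∫⁻ x in I, ‖f x‖ₑ ∂ν) / ν I := by
  rcases eq_or_ne (ν I) 0 with h0 | h0
  · simp [Measure.restrict_eq_zero.2 h0]
  rw [ENNReal.le_div_iff_mul_le (Or.inl h0) (Or.inl hI), mul_comm, measure_mul_enorm hI,
    measureReal_mul_average hI]
  exact enorm_integral_le_lintegral_enorm _

variable (F) in
/-- The square `∑_{K ∈ ch(I)} |⟨f⟩_K - ⟨f⟩_I|² ν(K)` of the `L²(ν)` norm of a martingale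
difference with respect to `ν`. -/
def sqDiff (ν : Measure X) (I : Set X) (f : X → ℝ) : ℝ≥0∞ :=
  ∑' K : F.children I, ν K * ‖(⨍ x in (K : Set X), f x ∂ν) - ⨍ x in I, f x ∂ν‖ₑ ^ 2

/-- The martingale differences are orthogonal. -/
theorem sum_sqDiff_le {ν : Measure X} (hν : ∀ I ∈ F.lattice, ν I ≠ ∞) (hf : MemLp f 2 ν)
    {s : Finset (Set X)} (hs : ∀ J ∈ s, J ∈ F.lattice) :
    ∑ J ∈ s, F.sqDiff ν J f ≤ ∫⁻ x, ‖f x‖ₑ ^ 2 ∂ν := by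
  have hvar : ∀ K ∈ F.lattice, ∀ a : ℝ, ∫⁻ x in K, ‖f x - a‖ₑ ^ 2 ∂ν =
      ∫⁻ x in K, ‖f x - ⨍ z in K, f z ∂ν‖ₑ ^ 2 ∂ν + ν K * ‖(⨍ z in K, f z ∂ν) - a‖ₑ ^ 2 := by
    intro K hK a
    have : IsFiniteMeasure (ν.restrict K) := ⟨by simpa using (hν K hK).lt_top⟩
    simpa using lintegral_enorm_sub_sq_eq (hf.restrict K) a
  -- The variance `∫_I |f - ⟨f⟩_I|²` serves as superadditive majorant: on passing to the children it
  -- drops by exactly the squared difference.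
  have hsup : ∀ I ∈ F.lattice, F.sqDiff ν I f + ∑' K : F.children I,
      ∫⁻ x in (K : Set X), ‖f x - ⨍ z in (K : Set X), f z ∂ν‖ₑ ^ 2 ∂ν ≤
      ∫⁻ x in I, ‖f x - ⨍ z in I, f z ∂ν‖ₑ ^ 2 ∂ν := by
    intro I hI
    rw [sqDiff, ← ENNReal.tsum_add, ← F.tsum_lintegral_children hI]
    refine ENNReal.tsum_le_tsum fun K => ?_
    rw [hvar K (F.mem_lattice_of_mem_children K.2) (⨍ z in I, f z ∂ν), add_comm]
  calc ∑ J ∈ s, F.sqDiff ν J f ≤ (ν.withDensity fun x => ‖f x‖ₑ ^ 2) (⋃ J ∈ s, J) := by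
        refine F.sum_le_measure_iUnion hs fun I hI t ht htI => ?_
        refine (F.sum_le_of_superadditive (B := fun I =>
          ∫⁻ x in I, ‖f x - ⨍ z in I, f z ∂ν‖ₑ ^ 2 ∂ν) hsup (hs I hI)
          (fun J hJ => hs J (ht hJ)) htI).trans ?_
        rw [withDensity_apply _ (F.measurableSet_of_mem_lattice (hs I hI))]
        have := hvar I (hs I hI) 0
        simp only [sub_zero] at this
        rw [this]
        exact le_self_add
    _ ≤ (ν.withDensity fun x => ‖f x‖ₑ ^ 2) univ := measure_mono (subset_univ _)
    _ = _ := by rw [withDensity_apply _ MeasurableSet.univ, Measure.restrict_univ]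

theorem diffNorm_eq_zero_of_weighted (hu : F.IsWeight u) {I : Set X} (hI : I ∈ F.lattice)
    (h : weighted μ u I = 0) (f : X → ℝ) : F.diffNorm I (fun x => f x * u x) = 0 := by
  have havg : ∀ K ∈ F.lattice, K ⊆ I → ⨍ x in K, f x * u x ∂μ = 0 := by
    intro K hK hKI
    have h1 := hu.measureReal_mul_average_mul f hK
    have h2 : (weighted μ u).real K = 0 := by
      simp [Measure.real, measure_mono_null hKI h]
    rw [h2, zero_mul] at h1
    exact (mul_eq_zero.1 h1).resolve_left (F.measureReal_pos_of_mem_lattice hK).ne'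
  refine ENNReal.tsum_eq_zero.2 fun K => ?_
  rw [havg I hI subset_rfl, havg K (F.mem_lattice_of_mem_children K.2)
    (F.subset_of_mem_children K.2)]
  simp

/-- With `c` the averages of `f` over `ν = u dμ`, one has `|K| (⟨fu⟩_K - ⟨fu⟩_I) = ν(K) (c_K - c_I)
+ c_I |K| (⟨u⟩_K - ⟨u⟩_I)`. Cauchy–Schwarz with weights `ν(K)` handles the first part. -/
theorem diffNorm_mul_sq_le (hu : F.IsWeight u) {I : Set X} (hI : I ∈ F.lattice) (f : X → ℝ) :
    F.diffNorm I (fun x => f x * u x) ^ 2 ≤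
      2 * (weighted μ u I * F.sqDiff (weighted μ u) I f) +
      2 * (‖⨍ x in I, f x ∂(weighted μ u)‖ₑ ^ 2 * F.diffNorm I u ^ 2) := by
  set ν := weighted μ u with hν
  set c : Set X → ℝ := fun K => ⨍ x in K, f x ∂ν with hc
  have hl : ∀ K : F.children I, (K : Set X) ∈ F.lattice := fun K =>
    F.mem_lattice_of_mem_children K.2
  have h1 : F.diffNorm I (fun x => f x * u x) ≤
      ∑' K : F.children I, ν K * ‖c K - c I‖ₑ + ‖c I‖ₑ * F.diffNorm I u := by
    rw [diffNorm, diffNorm, ← ENNReal.tsum_mul_left, ← ENNReal.tsum_add]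
    refine ENNReal.tsum_le_tsum fun K => ?_
    have hμK := (F.measure_lt_top_of_mem_lattice (hl K)).ne
    rw [mul_left_comm, ← enorm_mul (c I), measure_mul_enorm hμK, measure_mul_enorm hμK,
      measure_mul_enorm (hu.weighted_ne_top (hl K))]
    refine le_of_eq_of_le (congrArg _ ?_) (enorm_add_le _ _)
    have e1 := hu.measureReal_mul_average_mul f (hl K)
    have e2 := hu.measureReal_mul_average_mul f hI
    have e3 := hu.weighted_real (hl K)
    have e4 := hu.weighted_real hI
    have e5 : ⨍ x in I, f x * u x ∂μ = (⨍ x in I, u x ∂μ) * c I := by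
      refine mul_left_cancel₀ (F.measureReal_pos_of_mem_lattice hI).ne' ?_
      rw [e2, e4, mul_assoc]
    simp only [hc, ← hν] at e1 e3 e5 ⊢
    linear_combination e1 - μ.real K * e5 + (c I) * e3
  have hsq : ∀ K : F.children I, (ν (K : Set X) ^ (1 / 2 : ℝ)) ^ 2 = ν (K : Set X) := fun K => by
    rw [← ENNReal.rpow_two, ← ENNReal.rpow_mul]; norm_num
  have h2 : (∑' K : F.children I, ν K * ‖c K - c I‖ₑ) ^ 2 ≤ ν I * F.sqDiff ν I f := by
    have h := ENNReal.tsum_mul_sq_le (fun K : F.children I => ν (K : Set X) ^ (1 / 2 : ℝ))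
      (fun K : F.children I => ν (K : Set X) ^ (1 / 2 : ℝ) * ‖c K - c I‖ₑ)
    simp only [mul_pow, hsq] at h
    simp only [← mul_assoc, ← sq, hsq] at h
    rwa [F.tsum_measure_children hI ν] at h
  calc _ ≤ (∑' K : F.children I, ν K * ‖c K - c I‖ₑ + ‖c I‖ₑ * F.diffNorm I u) ^ 2 := by gcongr
    _ ≤ _ := ENNReal.add_sq_le_two_mul _ _
    _ ≤ _ := by
      rw [mul_pow]
      gcongr

/-- Outside the degenerate cases the quotient is `1/(r α(r))` with `r = u*/u ≥ 1`, and monotonicity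
bounds it by `1/α(1)`. -/
theorem IsWeight.weighted_div_le (hu : F.IsWeight u) (hα : IsPenalty α) {I : Set X}
    (hI : I ∈ F.lattice) :
    weighted μ u I / (μ I * entropyBump μ α I u) ≤ ENNReal.ofReal (penaltyConst α) := by
  rcases eq_or_ne (weighted μ u I) 0 with h0 | h0
  · simp [h0]
  by_cases hfin : llogl μ I u = ∞
  · rw [entropyBump, if_pos hfin, ENNReal.mul_top (F.measure_pos_of_mem_lattice hI).ne',
      ENNReal.div_top]
    exact zero_le
  have h1 := hu.one_le_llogl_div hI h0 hfin
  rw [hu.measure_mul_entropyBump α hI h0 hfin]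
  refine ENNReal.div_le_of_le_mul ?_
  rw [← mul_assoc, ← ENNReal.ofReal_mul hα.penaltyConst_pos.le]
  refine le_mul_of_one_le_left' (ENNReal.one_le_ofReal.2 ?_)
  have := hα.one_div_le_penaltyConst h1
  rwa [div_le_iff₀ (hα.mul_pos h1)] at this

/-- The embedding theorem for martingale differences. -/
theorem IsWeight.sum_diffNorm_mul_sq_le [SFinite μ] (hu : F.IsWeight u) (hα : IsPenalty α)
    (hf : MemLp f 2 (weighted μ u)) {s : Finset (Set X)} (hs : ∀ J ∈ s, J ∈ F.lattice) :
    ∑ J ∈ s, F.diffNorm J (fun x => f x * u x) ^ 2 / (μ J * entropyBump μ α J u) ≤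
      ENNReal.ofReal (258 * penaltyConst α) * ∫⁻ x, ‖f x‖ₑ ^ 2 ∂(weighted μ u) := by
  set ν := weighted μ u with hν
  have hνfin : ∀ I ∈ F.lattice, ν I ≠ ∞ := fun I hI => hu.weighted_ne_top hI
  -- One factor 4 comes from the dyadic sum and the other from Pinsker's inequality. With the 8 of
  -- the Carleson embedding theorem, the final constant is `258 = 2 + 2 · 8 · 4 · 4`.
  have hcarl : F.CarlesonBound (fun J => F.diffNorm J u ^ 2 / (μ J * entropyBump μ α J u))
      fun I => ENNReal.ofReal (4 * penaltyConst α) * 4 * ν I := by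
    refine CarlesonBound.div_entropyBump hu hα ?_ ?_
    · intro J hJ h0
      have := diffNorm_eq_zero_of_weighted hu hJ h0 fun _ => 1
      simp only [one_mul] at this
      simp [this]
    · intro I hI s hs hsI
      have h := hu.sum_diffNorm_sq_le I hI s hs hsI
      calc ∑ J ∈ s, F.diffNorm J u ^ 2 / weighted μ u J
          = 4 * ∑ J ∈ s, F.diffNorm J u ^ 2 / (4 * weighted μ u J) := by
            rw [Finset.mul_sum]
            refine Finset.sum_congr rfl fun J _ => ?_
            rw [div_eq_mul_inv, div_eq_mul_inv, ENNReal.mul_inv (by simp) (by simp),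
              mul_left_comm, ← mul_assoc 4, ENNReal.mul_inv_cancel (by simp) (by simp), one_mul]
        _ ≤ 4 * (μ I * llogl μ I u) := by gcongr
  have h2 := hcarl.sum_mul_sq_le hνfin (f := fun x => ‖f x‖ₑ)
    hf.aestronglyMeasurable.enorm hs
  calc ∑ J ∈ s, F.diffNorm J (fun x => f x * u x) ^ 2 / (μ J * entropyBump μ α J u)
      ≤ ∑ J ∈ s, (2 * (ENNReal.ofReal (penaltyConst α) * F.sqDiff ν J f) +
          2 * (F.diffNorm J u ^ 2 / (μ J * entropyBump μ α J u) *
            ((∫⁻ x in J, ‖f x‖ₑ ∂ν) / ν J) ^ 2)) := by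
        refine Finset.sum_le_sum fun J hJ => ?_
        calc _ ≤ (2 * (ν J * F.sqDiff ν J f) +
              2 * (‖⨍ x in J, f x ∂ν‖ₑ ^ 2 * F.diffNorm J u ^ 2)) /
              (μ J * entropyBump μ α J u) := by
              gcongr
              exact diffNorm_mul_sq_le hu (hs J hJ) f
          _ = 2 * (ν J / (μ J * entropyBump μ α J u) * F.sqDiff ν J f) +
              2 * (F.diffNorm J u ^ 2 / (μ J * entropyBump μ α J u) *
                ‖⨍ x in J, f x ∂ν‖ₑ ^ 2) := by
              simp only [div_eq_mul_inv]
              ring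
          _ ≤ _ := by
              gcongr
              · exact hu.weighted_div_le hα (hs J hJ)
              · exact enorm_average_le (hνfin J (hs J hJ)) f
    _ = 2 * (ENNReal.ofReal (penaltyConst α) * ∑ J ∈ s, F.sqDiff ν J f) +
          2 * ∑ J ∈ s, F.diffNorm J u ^ 2 / (μ J * entropyBump μ α J u) *
            ((∫⁻ x in J, ‖f x‖ₑ ∂ν) / ν J) ^ 2 := by
        rw [Finset.sum_add_distrib, ← Finset.mul_sum, ← Finset.mul_sum, ← Finset.mul_sum]
    _ ≤ 2 * (ENNReal.ofReal (penaltyConst α) * ∫⁻ x, ‖f x‖ₑ ^ 2 ∂ν) +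
          2 * (8 * (ENNReal.ofReal (4 * penaltyConst α) * 4) * ∫⁻ x, ‖f x‖ₑ ^ 2 ∂ν) := by
        gcongr
        exact sum_sqDiff_le hνfin hf hs
    _ = _ := by
        rw [ENNReal.ofReal_mul (by norm_num), ENNReal.ofReal_mul (by norm_num)]
        norm_num
        ring

/-- The embedding theorem for averages. -/
theorem IsWeight.sum_average_mul_sq_le [SFinite μ] (hu : F.IsWeight u) (hα : IsPenalty α)
    {a : Set X → ℝ≥0∞} (ha : F.CarlesonBound (fun J => a J * μ J) fun I => μ I)
    (hf : MemLp f 2 (weighted μ u)) {s : Finset (Set X)} (hs : ∀ J ∈ s, J ∈ F.lattice) :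
    ∑ J ∈ s, a J * (μ J * ‖⨍ x in J, f x * u x ∂μ‖ₑ) ^ 2 / (μ J * entropyBump μ α J u) ≤
      ENNReal.ofReal (32 * penaltyConst α) * ∫⁻ x, ‖f x‖ₑ ^ 2 ∂(weighted μ u) := by
  set ν := weighted μ u with hν
  have hνfin : ∀ I ∈ F.lattice, ν I ≠ ∞ := fun I hI => hu.weighted_ne_top hI
  -- Here `d_J / u(J) = a_J u(J)`, which the estimate for averages sums without loss; hence `32 = 8
  -- · 4`.
  have hcarl : F.CarlesonBound (fun J => a J * ν J ^ 2 / (μ J * entropyBump μ α J u))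
      fun I => ENNReal.ofReal (4 * penaltyConst α) * 1 * ν I := by
    refine CarlesonBound.div_entropyBump hu hα (fun J _ h0 => by rw [hν, h0]; simp) ?_
    intro I hI s hs hsI
    refine le_trans (le_of_eq ?_) ((hu.sum_mul_weighted_le ha I hI s hs hsI).trans
      (one_mul _).ge)
    refine Finset.sum_congr rfl fun J hJ => ?_
    dsimp only
    rcases eq_or_ne (ν J) 0 with h0 | h0
    · rw [← hν, h0]; simp
    · rw [← hν, sq, mul_div_assoc, ENNReal.mul_div_cancel_right h0 (hνfin J (hs J hJ))]
  have h2 := hcarl.sum_mul_sq_le hνfin (f := fun x => ‖f x‖ₑ)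
    hf.aestronglyMeasurable.enorm hs
  refine (Finset.sum_le_sum fun J hJ => ?_).trans (h2.trans (le_of_eq ?_))
  · rw [measure_mul_enorm (F.measure_lt_top_of_mem_lattice (hs J hJ)).ne,
      hu.measureReal_mul_average_mul f (hs J hJ), ← measure_mul_enorm (hνfin J (hs J hJ)),
      mul_pow, ← mul_assoc, ENNReal.mul_div_right_comm]
    gcongr
    exact enorm_average_le (hνfin J (hs J hJ)) f
  · rw [ENNReal.ofReal_mul (by norm_num), ENNReal.ofReal_mul (by norm_num)]
    norm_num
    ring

end AtomicFiltration

/-! ### Haar functions, and their pairings with martingale differences. -/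

namespace AtomicFiltration

variable {X : Type*} [mX : MeasurableSpace X] {μ : Measure X} {F : AtomicFiltration μ}

variable (F) in
/-- A function supported on `I` and constant on the children of `I`. -/
structure IsChildConst (I : Set X) (t : X → ℝ) : Prop where
  eq_of_mem : ∀ K ∈ F.children I, ∀ x ∈ K, ∀ y ∈ K, t x = t y
  eq_zero : ∀ x ∉ I, t x = 0

theorem IsChildConst.exists_value {I : Set X} {t : X → ℝ} (ht : F.IsChildConst I t) :
    ∃ c : F.children I → ℝ, ∀ (K : F.children I), ∀ x ∈ (K : Set X), t x = c K :=
  ⟨fun K => t (F.nonempty_of_mem_lattice (F.mem_lattice_of_mem_children K.2)).some,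
    fun K x hx => ht.eq_of_mem K K.2 x hx _ (Nonempty.some_mem _)⟩

theorem IsChildConst.measurable {I : Set X} (hI : I ∈ F.lattice) {t : X → ℝ}
    (ht : F.IsChildConst I t) : Measurable t := by
  obtain ⟨c, hc⟩ := ht.exists_value
  intro S _
  have : t ⁻¹' S = (⋃ K : {K : F.children I // c K ∈ S}, (K : Set X)) ∪
      (Iᶜ ∩ {_x | (0 : ℝ) ∈ S}) := by
    ext x
    simp only [mem_preimage, mem_union, mem_iUnion, mem_inter_iff, mem_compl_iff, mem_ofPred_eq]
    constructor
    · intro hx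
      by_cases hxI : x ∈ I
      · obtain ⟨K, hK, hxK⟩ := F.exists_child_mem hI hxI
        exact Or.inl ⟨⟨⟨K, hK⟩, by rwa [← hc ⟨K, hK⟩ x hxK]⟩, hxK⟩
      · exact Or.inr ⟨hxI, by rwa [← ht.eq_zero x hxI]⟩
    · rintro (⟨K, hxK⟩ | ⟨hxI, h0⟩)
      · rw [hc K x hxK]
        exact K.2
      · rwa [ht.eq_zero x hxI]
  rw [this]
  refine MeasurableSet.union (MeasurableSet.iUnion fun K => F.measurableSet_child _)
    ((F.measurableSet_of_mem_lattice hI).compl.inter (MeasurableSet.const _))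

theorem IsChildConst.indicator_eq {I : Set X} {t : X → ℝ} (ht : F.IsChildConst I t) :
    I.indicator t = t :=
  indicator_eq_self.2 fun x hx => by
    by_contra h
    exact hx (ht.eq_zero x h)

theorem IsChildConst.setIntegral_mul {I : Set X} {t : X → ℝ}
    (ht : F.IsChildConst I t) (H : X → ℝ) : ∫ x, t x * H x ∂μ = ∫ x in I, t x * H x ∂μ := by
  refine (setIntegral_eq_integral_of_forall_compl_eq_zero fun x hx => ?_).symm
  rw [ht.eq_zero x hx, zero_mul]

theorem IsChildConst.setIntegral {I : Set X} {t : X → ℝ}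
    (ht : F.IsChildConst I t) : ∫ x, t x ∂μ = ∫ x in I, t x ∂μ :=
  (setIntegral_eq_integral_of_forall_compl_eq_zero fun x hx => ht.eq_zero x hx).symm

variable (F) in
/-- A bounded function with mean zero, supported on `I` and constant on the children of `I`. -/
structure IsHaarFn (I : Set X) (t : X → ℝ) (β : ℝ) : Prop where
  isChildConst : F.IsChildConst I t
  abs_le : ∀ x, |t x| ≤ β
  integral_eq_zero : ∫ x, t x ∂μ = 0

theorem IsChildConst.memLp_two {I : Set X} (hI : I ∈ F.lattice) {t : X → ℝ} {β : ℝ}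
    (ht : F.IsChildConst I t) (hβ : ∀ x, |t x| ≤ β) {ρ : Measure X} (hρ : ρ I ≠ ∞) :
    MemLp t 2 ρ := by
  have : IsFiniteMeasure (ρ.restrict I) := ⟨by simpa using hρ.lt_top⟩
  rw [← ht.indicator_eq, memLp_indicator_iff_restrict (F.measurableSet_of_mem_lattice hI)]
  exact MemLp.of_bound (ht.measurable hI).aestronglyMeasurable β (Eventually.of_forall hβ)

/-- Only the martingale difference of `H` contributes to the pairing with a Haar function. -/
theorem IsHaarFn.enorm_integral_mul_le {I : Set X} (hI : I ∈ F.lattice) {t : X → ℝ} {β : ℝ}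
    (ht : F.IsHaarFn I t β) {H : X → ℝ} (hH : IntegrableOn H I μ) :
    ‖∫ x, t x * H x ∂μ‖ₑ ≤ ENNReal.ofReal β * F.diffNorm I H := by
  obtain ⟨c, hc⟩ := ht.isChildConst.exists_value
  have hl : ∀ K : F.children I, (K : Set X) ∈ F.lattice := fun K =>
    F.mem_lattice_of_mem_children K.2
  have hcβ : ∀ K, |c K| ≤ β := fun K => by
    obtain ⟨x, hx⟩ := F.nonempty_of_mem_lattice (hl K)
    rw [← hc K x hx]
    exact ht.abs_le x
  have hm := ht.isChildConst.measurable hI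
  have : IsFiniteMeasure (μ.restrict I) := ⟨by simpa using F.measure_lt_top_of_mem_lattice hI⟩
  have htH : IntegrableOn (fun x => t x * H x) I μ :=
    hH.bdd_mul hm.aestronglyMeasurable (Eventually.of_forall ht.abs_le)
  have htI : IntegrableOn t I μ :=
    memLp_restrict_integrable (ht.isChildConst.memLp_two hI ht.abs_le
      (F.measure_lt_top_of_mem_lattice hI).ne) (F.measure_lt_top_of_mem_lattice hI).ne
  have h1 := F.hasSum_integral_children hI htH
  have h2 := F.hasSum_integral_children hI htI
  rw [← ht.isChildConst.setIntegral, ht.integral_eq_zero] at h2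
  have e1 : ∀ K : F.children I, ∫ x in (K : Set X), t x * H x ∂μ =
      c K * (μ.real (K : Set X) * ⨍ x in (K : Set X), H x ∂μ) := by
    intro K
    rw [measureReal_mul_average (F.measure_lt_top_of_mem_lattice (hl K)).ne, ← integral_const_mul]
    exact setIntegral_congr_fun (F.measurableSet_child K) fun x hx => by simp only [hc K x hx]
  have e2 : ∀ K : F.children I, ∫ x in (K : Set X), t x ∂μ = c K * μ.real (K : Set X) := by
    intro K
    rw [setIntegral_congr_fun (F.measurableSet_child K) fun x hx => hc K x hx, setIntegral_const,
      smul_eq_mul, mul_comm]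
  simp only [e1] at h1
  simp only [e2] at h2
  -- Since `t` has mean zero, `⟨H⟩_I` may be subtracted from every `⟨H⟩_K`.
  have h3 := h1.sub (h2.mul_right (⨍ x in I, H x ∂μ))
  rw [zero_mul, sub_zero, ← ht.isChildConst.setIntegral_mul] at h3
  rw [← h3.tsum_eq, diffNorm, ← ENNReal.tsum_mul_left]
  refine enorm_tsum_le_tsum_enorm.trans (ENNReal.tsum_le_tsum fun K => ?_)
  rw [measure_mul_enorm (F.measure_lt_top_of_mem_lattice (hl K)).ne]
  rw [show c K * (μ.real (K : Set X) * ⨍ x in (K : Set X), H x ∂μ) -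
    c K * μ.real (K : Set X) * ⨍ x in I, H x ∂μ = c K * (μ.real (K : Set X) *
    ((⨍ x in (K : Set X), H x ∂μ) - ⨍ x in I, H x ∂μ)) by ring, enorm_mul]
  gcongr
  rw [Real.enorm_eq_ofReal_abs]
  exact ENNReal.ofReal_le_ofReal (hcβ K)

theorem expect_of_mem {I : Set X} {x : X} (hx : x ∈ I) (f : X → ℝ) :
    F.expect I f x = ⨍ y in I, f y ∂μ := indicator_of_mem hx _

theorem expect_of_notMem {I : Set X} {x : X} (hx : x ∉ I) (f : X → ℝ) :
    F.expect I f x = 0 := indicator_of_notMem hx _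

theorem mdiff_of_mem {I : Set X} (K : F.children I) {x : X} (hx : x ∈ (K : Set X)) (f : X → ℝ) :
    F.mdiff I f x = (⨍ y in (K : Set X), f y ∂μ) - ⨍ y in I, f y ∂μ := by
  rw [mdiff, expect_of_mem (F.subset_of_mem_children K.2 hx), tsum_eq_single K, expect_of_mem hx]
  intro J hJ
  refine expect_of_notMem (fun hxJ => ?_) f
  exact Set.disjoint_left.1 (F.pairwise_disjoint_children I hJ) hxJ hx

theorem mdiff_of_notMem {I : Set X} {x : X} (hx : x ∉ I) (f : X → ℝ) : F.mdiff I f x = 0 := by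
  rw [mdiff, expect_of_notMem hx, sub_zero]
  convert tsum_zero with K
  exact expect_of_notMem (fun hxK => hx (F.subset_of_mem_children K.2 hxK)) f

theorem isChildConst_mdiff (I : Set X) (f : X → ℝ) : F.IsChildConst I (F.mdiff I f) where
  eq_of_mem K hK x hx y hy := by
    rw [mdiff_of_mem ⟨K, hK⟩ hx, mdiff_of_mem ⟨K, hK⟩ hy]
  eq_zero x hx := mdiff_of_notMem hx f

theorem lintegral_enorm_mdiff {I : Set X} (hI : I ∈ F.lattice) (f : X → ℝ) :
    ∫⁻ x, ‖F.mdiff I f x‖ₑ ∂μ = F.diffNorm I f := by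
  have h1 : ∫⁻ x, ‖F.mdiff I f x‖ₑ ∂μ = ∫⁻ x in I, ‖F.mdiff I f x‖ₑ ∂μ := by
    rw [← lintegral_indicator (F.measurableSet_of_mem_lattice hI)]
    refine lintegral_congr fun x => ?_
    by_cases hx : x ∈ I
    · simp [hx]
    · simp [hx, mdiff_of_notMem hx f]
  rw [h1, ← F.tsum_lintegral_children hI, diffNorm]
  refine tsum_congr fun K => ?_
  rw [setLIntegral_congr_fun (F.measurableSet_child K) fun x hx => by rw [mdiff_of_mem K hx],
    setLIntegral_const, mul_comm]

theorem diffNorm_le {I : Set X} (hI : I ∈ F.lattice) (f : X → ℝ) :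
    F.diffNorm I f ≤ 2 * ∫⁻ x in I, ‖f x‖ₑ ∂μ := by
  have h : ∀ K ∈ F.lattice, μ K * ‖⨍ x in K, f x ∂μ‖ₑ ≤ ∫⁻ x in K, ‖f x‖ₑ ∂μ := by
    intro K hK
    have hK' := (F.measure_lt_top_of_mem_lattice hK).ne
    rw [measure_mul_enorm hK', measureReal_mul_average hK']
    exact enorm_integral_le_lintegral_enorm _
  calc F.diffNorm I f ≤ ∑' K : F.children I, ((∫⁻ x in (K : Set X), ‖f x‖ₑ ∂μ) +
        μ (K : Set X) * ‖⨍ x in I, f x ∂μ‖ₑ) := by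
        refine ENNReal.tsum_le_tsum fun K => ?_
        refine (mul_le_mul_right (enorm_sub_le) _).trans ?_
        rw [mul_add]
        gcongr
        exact h K (F.mem_lattice_of_mem_children K.2)
    _ = (∫⁻ x in I, ‖f x‖ₑ ∂μ) + μ I * ‖⨍ x in I, f x ∂μ‖ₑ := by
        rw [ENNReal.tsum_add, F.tsum_lintegral_children hI, ENNReal.tsum_mul_right,
          F.tsum_measure_children hI]
    _ ≤ 2 * ∫⁻ x in I, ‖f x‖ₑ ∂μ := by
        rw [two_mul]
        gcongr
        exact h I hI

theorem diffNorm_ne_top {I : Set X} (hI : I ∈ F.lattice) {f : X → ℝ} (hf : IntegrableOn f I μ) :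
    F.diffNorm I f ≠ ∞ :=
  ne_top_of_le_ne_top (ENNReal.mul_ne_top (by norm_num) hf.2.ne) (diffNorm_le hI f)

theorem integrable_mdiff {I : Set X} (hI : I ∈ F.lattice) {f : X → ℝ} (hf : IntegrableOn f I μ) :
    Integrable (F.mdiff I f) μ :=
  ⟨((isChildConst_mdiff I f).measurable hI).aestronglyMeasurable, by
    rw [HasFiniteIntegral, lintegral_enorm_mdiff hI]
    exact (diffNorm_ne_top hI hf).lt_top⟩

theorem integral_abs_mdiff {I : Set X} (hI : I ∈ F.lattice) (f : X → ℝ) :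
    ∫ x, |F.mdiff I f x| ∂μ = (F.diffNorm I f).toReal := by
  rw [← lintegral_enorm_mdiff hI]
  exact integral_norm_eq_lintegral_enorm
    ((isChildConst_mdiff I f).measurable hI).aestronglyMeasurable

theorem integral_mdiff {I : Set X} (hI : I ∈ F.lattice) {f : X → ℝ} (hf : IntegrableOn f I μ) :
    ∫ x, F.mdiff I f x ∂μ = 0 := by
  have hμI := (F.measure_lt_top_of_mem_lattice hI).ne
  have : IsFiniteMeasure (μ.restrict I) := ⟨by simpa using F.measure_lt_top_of_mem_lattice hI⟩
  have h1 := F.hasSum_integral_children hI (integrable_mdiff hI hf).integrableOn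
  have h2 := F.hasSum_integral_children hI hf
  have h3 := F.hasSum_integral_children hI
    (integrable_const (μ := μ.restrict I) (⨍ y in I, f y ∂μ))
  have h4 := h2.sub h3
  rw [(isChildConst_mdiff I f).setIntegral]
  have e : ∀ K : F.children I, ∫ x in (K : Set X), F.mdiff I f x ∂μ =
      ∫ x in (K : Set X), f x ∂μ - ∫ x in (K : Set X), ⨍ y in I, f y ∂μ ∂μ := by
    intro K
    have hK := (F.measure_lt_top_of_mem_lattice (F.mem_lattice_of_mem_children K.2)).ne
    rw [setIntegral_congr_fun (F.measurableSet_child K) fun x hx => mdiff_of_mem K hx f,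
      setIntegral_const, setIntegral_const, smul_eq_mul, smul_eq_mul, mul_sub,
      measureReal_mul_average hK]
  simp only [e] at h1
  rw [h1.unique h4, setIntegral_const, smul_eq_mul, measureReal_mul_average hμI, sub_self]

theorem mem_diffSpace_spec {I : F.lattice} (h : F.diffSpace I) :
    F.IsChildConst I (h : X → ℝ) ∧ Integrable (h : X → ℝ) μ ∧ ∫ x, (h : X → ℝ) x ∂μ = 0 := by
  obtain ⟨_, f, hf, rfl⟩ := h
  have hfI := memLp_restrict_integrable hf (F.measure_lt_top_of_mem_lattice I.2).ne
  exact ⟨isChildConst_mdiff I f, integrable_mdiff I.2 hfI, integral_mdiff I.2 hfI⟩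

theorem mdiff_indicator_eq {I : Set X} (hI : I ∈ F.lattice) (K : F.children I) :
    F.mdiff I ((K : Set X).indicator fun _ => 1) =
      fun x => (K : Set X).indicator 1 x - μ.real (K : Set X) / μ.real I * I.indicator 1 x := by
  have havg : ∀ J : Set X, ⨍ y in J, (K : Set X).indicator (fun _ => (1 : ℝ)) y ∂μ =
      μ.real (J ∩ K) / μ.real J := by
    intro J
    rw [setAverage_eq, setIntegral_indicator (F.measurableSet_child K), setIntegral_const,
      smul_eq_mul, smul_eq_mul, mul_one, inv_mul_eq_div]
  funext x
  by_cases hx : x ∈ I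
  · obtain ⟨J, hJ, hxJ⟩ := F.exists_child_mem hI hx
    rw [mdiff_of_mem ⟨J, hJ⟩ hxJ, havg, havg, inter_eq_self_of_subset_right
      (F.subset_of_mem_children K.2)]
    simp only [indicator_of_mem hx, Pi.one_apply, mul_one]
    congr 1
    by_cases hJK : J = K
    · subst hJK
      rw [inter_self, div_self (F.measureReal_pos_of_mem_lattice
        (F.mem_lattice_of_mem_children hJ)).ne', indicator_of_mem hxJ, Pi.one_apply]
    · have hd := F.disjoint_children hJ K.2 hJK
      rw [hd.inter_eq, indicator_of_notMem (Set.disjoint_left.1 hd hxJ)]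
      simp
  · rw [mdiff_of_notMem hx, indicator_of_notMem hx, indicator_of_notMem fun h =>
      hx (F.subset_of_mem_children K.2 h)]
    simp

theorem diffNorm_indicator_toReal_le {I : Set X} (hI : I ∈ F.lattice) (K : F.children I) :
    (F.diffNorm I ((K : Set X).indicator fun _ => 1)).toReal ≤ 2 * μ.real (K : Set X) := by
  have hK := (F.measure_lt_top_of_mem_lattice (F.mem_lattice_of_mem_children K.2)).ne
  refine ENNReal.toReal_le_of_le_ofReal (by positivity) ((diffNorm_le hI _).trans ?_)
  rw [ENNReal.ofReal_mul zero_le_two, ofReal_measureReal hK, ENNReal.ofReal_ofNat]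
  gcongr
  calc ∫⁻ x in I, ‖(K : Set X).indicator (fun _ => (1 : ℝ)) x‖ₑ ∂μ
      ≤ ∫⁻ x, ‖(K : Set X).indicator (fun _ => (1 : ℝ)) x‖ₑ ∂μ := setLIntegral_le_lintegral _ _
    _ = ∫⁻ x, (K : Set X).indicator 1 x ∂μ := by
        refine lintegral_congr fun x => ?_
        by_cases hx : x ∈ (K : Set X) <;> simp [hx]
    _ = μ K := lintegral_indicator_one (F.measurableSet_child K)

/-! ### Sup bounds for the terms of a Haar shift, with possibly infinitely many children. -/

namespace HaarShift

variable (T : F.HaarShift)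

/-- The `L¹ → L^∞` bound for the operators of a Haar shift. -/
theorem abs_op_le (I : F.lattice) (h : F.diffSpace I) (x : X) :
    |(T.op I h : X → ℝ) x| ≤ 2 * (μ.real I)⁻¹ * ∫ y, |(h : X → ℝ) y| ∂μ := by
  obtain ⟨hcc, hinteg, hzero⟩ := mem_diffSpace_spec (T.op I h)
  set φ : X → ℝ := (T.op I h : X → ℝ) with hφ
  have hIpos := F.measureReal_pos_of_mem_lattice I.2
  have hnn : 0 ≤ ∫ y, |(h : X → ℝ) y| ∂μ := integral_nonneg fun y => abs_nonneg _
  by_cases hx : x ∈ (I : Set X)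
  swap
  · rw [hcc.eq_zero x hx, abs_zero]
    positivity
  obtain ⟨K, hK, hxK⟩ := F.exists_child_mem I.2 hx
  have hKpos := F.measureReal_pos_of_mem_lattice (F.mem_lattice_of_mem_children hK)
  -- The test function is `Δ_I 1_K`. As `T_I h` has mean zero and is constant on `K`, the pairing is
  -- `|K|` times its value there, while `‖Δ_I 1_K‖₁ ≤ 2|K|`. Testing with `-g` gives the other sign.
  set g : F.diffSpace I := ⟨_, F.mdiff_indicator_mem I hK⟩ with hg
  have hKm := F.measurableSet_child ⟨K, hK⟩
  have hIm := F.measurableSet_of_mem_lattice I.2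
  have hpair : ∫ y, φ y * (g : X → ℝ) y ∂μ = μ.real K * φ x := by
    have e : ∀ y, φ y * (g : X → ℝ) y =
        K.indicator φ y - μ.real K / μ.real I * (I : Set X).indicator φ y := by
      intro y
      rw [hg]
      simp only [mdiff_indicator_eq I.2 ⟨K, hK⟩]
      by_cases h1 : y ∈ K <;> by_cases h2 : y ∈ (I : Set X) <;> simp [h1, h2] <;> ring
    simp_rw [e]
    rw [integral_sub (hinteg.indicator hKm) ((hinteg.indicator hIm).const_mul _),
      integral_const_mul, hcc.indicator_eq, hzero, mul_zero, sub_zero, integral_indicator hKm,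
      setIntegral_congr_fun hKm fun y hy => hcc.eq_of_mem K hK y hy x hxK, setIntegral_const,
      smul_eq_mul]
  have hgn : ∫ y, |(g : X → ℝ) y| ∂μ ≤ 2 * μ.real K := by
    rw [hg]
    simp only
    rw [integral_abs_mdiff I.2]
    exact diffNorm_indicator_toReal_le I.2 ⟨K, hK⟩
  have hb1 := T.bound I h g
  have hb2 := T.bound I h (-g)
  simp only [NegMemClass.coe_neg, Pi.neg_apply, mul_neg, abs_neg, integral_neg] at hb2
  rw [← hφ, hpair] at hb1 hb2
  have hle : (μ.real I)⁻¹ * (∫ y, |(h : X → ℝ) y| ∂μ) * ∫ y, |(g : X → ℝ) y| ∂μ ≤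
      μ.real K * (2 * (μ.real I)⁻¹ * ∫ y, |(h : X → ℝ) y| ∂μ) := by
    calc _ ≤ (μ.real I)⁻¹ * (∫ y, |(h : X → ℝ) y| ∂μ) * (2 * μ.real K) := by gcongr
      _ = _ := by ring
  refine abs_le.2 ⟨?_, ?_⟩
  · have := hb2.trans hle
    rw [← mul_neg] at this
    linarith [le_of_mul_le_mul_left this hKpos]
  · exact le_of_mul_le_mul_left (hb1.trans hle) hKpos

/-- The value of a Haar shift on the martingale difference of the indicator of a child. -/
def opIndicator (I : F.lattice) (K : F.children I) : X → ℝ :=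
  T.op I ⟨F.mdiff I ((K : Set X).indicator fun _ => 1), F.mdiff_indicator_mem I K.2⟩

theorem abs_opIndicator_le (I : F.lattice) (K : F.children I) (x : X) :
    |T.opIndicator I K x| ≤ 4 * (μ.real I)⁻¹ * μ.real (K : Set X) := by
  refine (T.abs_op_le I _ x).trans ?_
  simp only
  rw [integral_abs_mdiff I.2]
  have := diffNorm_indicator_toReal_le I.2 K
  have hIpos := F.measureReal_pos_of_mem_lattice I.2
  calc _ ≤ 2 * (μ.real I)⁻¹ * (2 * μ.real (K : Set X)) := by gcongr
    _ = _ := by ring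

theorem hasSum_measureReal_children {I : Set X} (hI : I ∈ F.lattice) :
    HasSum (fun K : F.children I => μ.real (K : Set X)) (μ.real I) := by
  have : IsFiniteMeasure (μ.restrict I) := ⟨by simpa using F.measure_lt_top_of_mem_lattice hI⟩
  simpa using F.hasSum_integral_children hI (integrable_const (μ := μ.restrict I) (1 : ℝ))

/-- By linearity the sum is `T_I` applied to `Δ_I 1_U`, with `U` the union of the chosen children.
Because `Δ_I` kills constants, its `L¹` norm is governed by the missing part `I \ U`. -/
theorem abs_sum_opIndicator_le (I : F.lattice) (s : Finset (F.children I)) (x : X) :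
    |∑ K ∈ s, T.opIndicator I K x| ≤
      4 * (μ.real I)⁻¹ * (μ.real I - ∑ K ∈ s, μ.real (K : Set X)) := by
  classical
  have hIpos := F.measureReal_pos_of_mem_lattice I.2
  have hIm := F.measurableSet_of_mem_lattice I.2
  have hIfin := (F.measure_lt_top_of_mem_lattice I.2).ne
  set g : F.children I → F.diffSpace I := fun K =>
    ⟨F.mdiff I ((K : Set X).indicator fun _ => 1), F.mdiff_indicator_mem I K.2⟩ with hg
  set U : Set X := ⋃ K ∈ s, (K : Set X) with hU
  have hUm : MeasurableSet U := s.measurableSet_biUnion fun K _ => F.measurableSet_child K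
  have hUI : U ⊆ I := iUnion₂_subset fun K _ => F.subset_of_mem_children K.2
  have hUr : μ.real U = ∑ K ∈ s, μ.real (K : Set X) :=
    measureReal_biUnion_finset (fun K _ L _ h => F.pairwise_disjoint_children I h)
      (fun K _ => F.measurableSet_child K)
      fun K _ => (F.measure_lt_top_of_mem_lattice (F.mem_lattice_of_mem_children K.2)).ne
  have hUle : μ.real U ≤ μ.real I := measureReal_mono hUI hIfin
  have e1 : ∑ K ∈ s, T.opIndicator I K x = (T.op I (∑ K ∈ s, g K) : X → ℝ) x := by
    rw [map_sum]
    simp [opIndicator, hg]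
  have e2 : ∀ y, ((∑ K ∈ s, g K : F.diffSpace I) : X → ℝ) y =
      U.indicator 1 y - μ.real U / μ.real I * (I : Set X).indicator 1 y := by
    intro y
    rw [AddSubmonoidClass.coe_finsetSum, Finset.sum_apply]
    simp only [hg, mdiff_indicator_eq I.2]
    rw [Finset.sum_sub_distrib, ← Finset.sum_mul, ← Finset.sum_div, ← hUr, hU]
    congr 1
    rw [Finset.indicator_biUnion_apply]
    exact fun K _ L _ h => F.pairwise_disjoint_children I h
  have hi : Integrable ((I : Set X).indicator (1 : X → ℝ)) μ :=
    (integrable_indicator_iff hIm).2 (integrableOn_const hIfin)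
  have hi2 : Integrable (((I : Set X) \ U).indicator (1 : X → ℝ)) μ :=
    (integrable_indicator_iff (hIm.diff hUm)).2
      (integrableOn_const (ne_top_of_le_ne_top hIfin (measure_mono sdiff_subset)))
  have e3 : ∫ y, |((∑ K ∈ s, g K : F.diffSpace I) : X → ℝ) y| ∂μ ≤
      2 * (μ.real I - μ.real U) := by
    calc ∫ y, |((∑ K ∈ s, g K : F.diffSpace I) : X → ℝ) y| ∂μ
        ≤ ∫ y, (((I : Set X) \ U).indicator 1 y +
            (1 - μ.real U / μ.real I) * (I : Set X).indicator 1 y) ∂μ := by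
          refine integral_mono (mem_diffSpace_spec _).2.1.abs (hi2.add (hi.const_mul _)) ?_
          intro y
          simp only [e2]
          have h1 : μ.real U / μ.real I ≤ 1 := (div_le_one hIpos).2 hUle
          have h0 : 0 ≤ μ.real U / μ.real I := by positivity
          by_cases hyU : y ∈ U
          · have hyI := hUI hyU
            have : y ∉ (I : Set X) \ U := fun h => h.2 hyU
            simp only [hyU, hyI, this, indicator_of_mem, Pi.one_apply, mul_one,
              not_false_eq_true, indicator_of_notMem, zero_add]
            rw [abs_of_nonneg (by linarith)]
          · by_cases hyI : y ∈ (I : Set X)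
            · have : y ∈ (I : Set X) \ U := ⟨hyI, hyU⟩
              simp only [hyU, hyI, this, indicator_of_mem, Pi.one_apply, mul_one,
                not_false_eq_true, indicator_of_notMem, zero_sub, abs_neg]
              rw [abs_of_nonneg h0]
              linarith
            · have : y ∉ (I : Set X) \ U := fun h => hyI h.1
              simp [hyU, hyI, this]
      _ = 2 * (μ.real I - μ.real U) := by
          rw [integral_add hi2 (hi.const_mul _), integral_const_mul, integral_indicator_one hIm,
            integral_indicator_one (hIm.diff hUm), measureReal_sdiff hUI hUm hIfin]
          field_simp
          ring
  rw [e1, ← hUr]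
  refine (T.abs_op_le I _ x).trans ?_
  calc _ ≤ 2 * (μ.real I)⁻¹ * (2 * (μ.real I - μ.real U)) := by gcongr
    _ = _ := by ring

/-- This expresses `T_I (Δ_I 1_I) = 0` for the extended operator, so that a constant can be
subtracted from the averages `⟨f⟩_K` at no cost. -/
theorem hasSum_opIndicator (I : F.lattice) (x : X) :
    HasSum (fun K : F.children I => T.opIndicator I K x) 0 := by
  have hs : Tendsto (fun s : Finset (F.children I) =>
      4 * (μ.real I)⁻¹ * (μ.real I - ∑ K ∈ s, μ.real (K : Set X))) atTop (𝓝 0) := by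
    have h1 : Tendsto (fun s : Finset (F.children I) => ∑ K ∈ s, μ.real (K : Set X)) atTop
      (𝓝 (μ.real I)) := hasSum_measureReal_children I.2
    simpa using (h1.const_sub (μ.real I)).const_mul (4 * (μ.real I)⁻¹)
  exact squeeze_zero_norm (fun s => T.abs_sum_opIndicator_le I s x) hs

/-- When `Δ_I f` is in `D_I`, the sup bound for `T_I` applies directly. Otherwise `⟨f⟩_K` is
replaced by `⟨f⟩_K - ⟨f⟩_I` in the series, so the bound involves `‖Δ_I f‖₁` and not `‖f‖₁`. The
constant 4 is that of the second case. -/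
theorem isHaarFn_term (I : F.lattice) {f : X → ℝ} (hf : IntegrableOn f I μ) :
    F.IsHaarFn I (T.term I f) (4 * (μ.real I)⁻¹ * (F.diffNorm I f).toReal) := by
  have hIpos := F.measureReal_pos_of_mem_lattice I.2
  have hIfin := (F.measure_lt_top_of_mem_lattice I.2).ne
  by_cases h : F.mdiff I f ∈ F.diffSpace I
  · rw [term, dif_pos h]
    obtain ⟨hcc, -, hzero⟩ := mem_diffSpace_spec (T.op I ⟨_, h⟩)
    refine ⟨hcc, fun x => (T.abs_op_le I _ x).trans ?_, hzero⟩
    simp only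
    rw [integral_abs_mdiff I.2]
    have : 0 ≤ (μ.real I)⁻¹ * (F.diffNorm I f).toReal := by positivity
    linarith
  · have hterm : T.term I f = fun x => ∑' K : F.children I,
        (⨍ y in (K : Set X), f y ∂μ) * T.opIndicator I K x := by
      rw [term, dif_neg h]
      rfl
    have hspec := fun K : F.children I => mem_diffSpace_spec
      (T.op I ⟨F.mdiff I ((K : Set X).indicator fun _ => 1), F.mdiff_indicator_mem I K.2⟩)
    have hcc : F.IsChildConst I (T.term I f) := by
      rw [hterm]
      constructor
      · intro K hK x hx y hy
        refine tsum_congr fun L => ?_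
        rw [opIndicator, (hspec L).1.eq_of_mem K hK x hx y hy]
      · intro x hx
        convert tsum_zero with L
        rw [opIndicator, (hspec L).1.eq_zero x hx, mul_zero]
    have hKfin : ∀ K : F.children I, μ (K : Set X) ≠ ∞ := fun K =>
      (F.measure_lt_top_of_mem_lattice (F.mem_lattice_of_mem_children K.2)).ne
    have hdsum : HasSum (fun K : F.children I => μ.real (K : Set X) *
        |(⨍ y in (K : Set X), f y ∂μ) - ⨍ y in (I : Set X), f y ∂μ|)
        (F.diffNorm I f).toReal := by
      have hne := diffNorm_ne_top I.2 hf
      have hs := ENNReal.hasSum_toReal hne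
      rw [← ENNReal.tsum_toReal_eq (ENNReal.ne_top_of_tsum_ne_top hne)] at hs
      simp only [ENNReal.toReal_mul, toReal_enorm, Real.norm_eq_abs] at hs
      exact hs
    have hfsum : Summable fun K : F.children I =>
        |⨍ y in (K : Set X), f y ∂μ| * (4 * (μ.real I)⁻¹ * μ.real (K : Set X)) := by
      have h1 := (F.hasSum_integral_children I.2 hf.norm).summable.mul_left (4 * (μ.real I)⁻¹)
      refine h1.of_nonneg_of_le (fun K => by positivity) fun K => ?_
      have : μ.real (K : Set X) * |⨍ y in (K : Set X), f y ∂μ| ≤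
          ∫ y in (K : Set X), ‖f y‖ ∂μ := by
        have := norm_integral_le_integral_norm (μ := μ.restrict (K : Set X)) f
        rw [← measureReal_mul_average (hKfin K)] at this
        rwa [Real.norm_eq_abs, abs_mul, abs_of_nonneg measureReal_nonneg] at this
      calc _ = 4 * (μ.real I)⁻¹ * (μ.real (K : Set X) * |⨍ y in (K : Set X), f y ∂μ|) := by ring
        _ ≤ _ := by gcongr
    have hbd : ∀ x, ∀ K : F.children I, ‖(⨍ y in (K : Set X), f y ∂μ) * T.opIndicator I K x‖ ≤
        |⨍ y in (K : Set X), f y ∂μ| * (4 * (μ.real I)⁻¹ * μ.real (K : Set X)) := by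
      intro x K
      rw [norm_mul, Real.norm_eq_abs, Real.norm_eq_abs]
      gcongr
      exact T.abs_opIndicator_le I K x
    refine ⟨hcc, fun x => ?_, ?_⟩
    · have hs1 : HasSum (fun K : F.children I =>
          (⨍ y in (K : Set X), f y ∂μ) * T.opIndicator I K x) (T.term I f x) := by
        rw [hterm]
        exact (hfsum.of_norm_bounded (hbd x)).hasSum
      have hs2 := hs1.sub ((T.hasSum_opIndicator I x).mul_left (⨍ y in (I : Set X), f y ∂μ))
      rw [mul_zero, sub_zero] at hs2
      rw [← hs2.tsum_eq, ← Real.norm_eq_abs]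
      refine tsum_of_norm_bounded (hdsum.mul_left (4 * (μ.real I)⁻¹)) fun K => ?_
      rw [← sub_mul, norm_mul, Real.norm_eq_abs, Real.norm_eq_abs]
      calc _ ≤ |(⨍ y in (K : Set X), f y ∂μ) - ⨍ y in (I : Set X), f y ∂μ| *
            (4 * (μ.real I)⁻¹ * μ.real (K : Set X)) := by
            gcongr
            exact T.abs_opIndicator_le I K x
        _ = _ := by ring
    · have : IsFiniteMeasure (μ.restrict (I : Set X)) := ⟨by simpa using hIfin.lt_top⟩
      rw [hcc.setIntegral, hterm]
      have hi : ∀ K : F.children I, Integrable (fun x =>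
          (⨍ y in (K : Set X), f y ∂μ) * T.opIndicator I K x) (μ.restrict I) := fun K =>
        ((hspec K).2.1.integrableOn).const_mul _
      rw [← integral_tsum_of_summable_integral_norm hi]
      · convert tsum_zero with K
        rw [integral_const_mul, opIndicator, ← (hspec K).1.setIntegral, (hspec K).2.2, mul_zero]
      · refine (hfsum.mul_right (μ.real I)).of_nonneg_of_le
          (fun K => integral_nonneg fun x => norm_nonneg _) fun K => ?_
        refine (integral_mono (hi K).norm (integrable_const _) (hbd · K)).trans (le_of_eq ?_)
        rw [setIntegral_const, smul_eq_mul, mul_comm]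

end HaarShift

/-- Functions of `D_I` are constant on children, which have positive measure, so the essential
supremum is a supremum. -/
theorem enorm_le_eLpNorm_top (I : F.lattice) (b : F.diffSpace I) (x : X) :
    ‖(b : X → ℝ) x‖ₑ ≤ eLpNorm (b : X → ℝ) ∞ μ := by
  have hcc := (mem_diffSpace_spec b).1
  by_cases hx : x ∈ (I : Set X)
  swap
  · simp [hcc.eq_zero x hx]
  obtain ⟨K, hK, hxK⟩ := F.exists_child_mem I.2 hx
  have hae := enorm_ae_le_eLpNormEssSup (b : X → ℝ) μ
  by_contra hlt
  have hsub : K ⊆ {y | ¬ ‖(b : X → ℝ) y‖ₑ ≤ eLpNormEssSup (b : X → ℝ) μ} := by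
    intro y hy
    rw [mem_ofPred_eq, hcc.eq_of_mem K hK y hy x hxK]
    simpa using hlt
  exact (F.measure_pos_of_mem_lattice (F.mem_lattice_of_mem_children hK)).ne'
    (measure_mono_null hsub hae)

theorem isHaarFn_paraTerm (b : ∀ I : F.lattice, F.diffSpace I) (I : F.lattice)
    (hb : eLpNorm (b I : X → ℝ) ∞ μ ≠ ∞) (f : X → ℝ) :
    F.IsHaarFn I (F.paraTerm b I f)
      (|⨍ y in (I : Set X), f y ∂μ| * (eLpNorm (b I : X → ℝ) ∞ μ).toReal) := by
  obtain ⟨hcc, -, hzero⟩ := mem_diffSpace_spec (b I)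
  refine ⟨⟨fun K hK x hx y hy => ?_, fun x hx => ?_⟩, fun x => ?_, ?_⟩
  · simp only [paraTerm, hcc.eq_of_mem K hK x hx y hy]
  · simp only [paraTerm, hcc.eq_zero x hx, mul_zero]
  · rw [paraTerm, abs_mul]
    gcongr
    have := (ENNReal.toReal_le_toReal (by simp) hb).2 (enorm_le_eLpNorm_top I (b I) x)
    simpa using this
  · simp only [paraTerm]
    rw [integral_const_mul, hzero, mul_zero]

end AtomicFiltration

/-! ### Unconditional convergence by duality, and the reduction to one-weight embeddings. -/

theorem ENNReal.sum_sq_le_of_sq_le {ι : Type*} (s : Finset ι) {z x y : ι → ℝ≥0∞} {A : ℝ≥0∞}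
    (h : ∀ i ∈ s, z i ^ 2 ≤ A * (x i * y i)) :
    (∑ i ∈ s, z i) ^ 2 ≤ A * ((∑ i ∈ s, x i) * ∑ i ∈ s, y i) := by
  have hsq : ∀ a : ℝ≥0∞, (a ^ (1 / 2 : ℝ)) ^ 2 = a := fun a => by
    rw [← ENNReal.rpow_two, ← ENNReal.rpow_mul]; norm_num
  have hz : ∀ i ∈ s, z i ≤ (A * x i) ^ (1 / 2 : ℝ) * y i ^ (1 / 2 : ℝ) := by
    intro i hi
    refine (ENNReal.pow_le_pow_left_iff two_ne_zero).1 ?_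
    rw [mul_pow, hsq, hsq, mul_assoc]
    exact h i hi
  calc (∑ i ∈ s, z i) ^ 2 ≤ (∑ i ∈ s, (A * x i) ^ (1 / 2 : ℝ) * y i ^ (1 / 2 : ℝ)) ^ 2 := by
        gcongr with i hi
        exact hz i hi
    _ ≤ _ := ENNReal.sum_mul_sq_le _ _ _
    _ = _ := by
        simp only [hsq]
        rw [← Finset.mul_sum, mul_assoc]

theorem eLpNorm_two_sq {Y : Type*} [MeasurableSpace Y] (ρ : Measure Y) (g : Y → ℝ) :
    eLpNorm g 2 ρ ^ 2 = ∫⁻ y, ‖g y‖ₑ ^ 2 ∂ρ := by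
  rw [eLpNorm_eq_lintegral_rpow_enorm_toReal (by norm_num) (by norm_num), ← ENNReal.rpow_two,
    ← ENNReal.rpow_mul]
  norm_num

/-- A series in `L²` whose pairings are square summable with a uniform bound converges
unconditionally. -/
theorem exists_tendsto_of_pairing {Y : Type*} [MeasurableSpace Y] {ρ : Measure Y} {ι : Type*}
    {t : ι → Y → ℝ} (ht : ∀ i, MemLp (t i) 2 ρ) {p : ι → ℝ≥0∞} {P M : ℝ≥0∞} (hP : P ≠ ∞)
    (hM : M ≠ ∞) (hp : ∀ s : Finset ι, ∑ i ∈ s, p i ≤ P)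
    (h : ∀ (s : Finset ι) (g : Y → ℝ), MemLp g 2 ρ →
      (∑ i ∈ s, ‖∫ y, t i y * g y ∂ρ‖ₑ) ^ 2 ≤ M * ((∑ i ∈ s, p i) * ∫⁻ y, ‖g y‖ₑ ^ 2 ∂ρ)) :
    ∃ g : Y → ℝ, MemLp g 2 ρ ∧
      Tendsto (fun s : Finset ι => eLpNorm (fun y => g y - ∑ i ∈ s, t i y) 2 ρ) atTop (𝓝 0) ∧
      ∫⁻ y, ‖g y‖ₑ ^ 2 ∂ρ ≤ M * P := by
  classical
  have hmem : ∀ s : Finset ι, MemLp (fun y => ∑ i ∈ s, t i y) 2 ρ := fun s =>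
    memLp_finsetSum s fun i _ => ht i
  -- A partial sum is tested against itself, and one factor of its squared norm, which is finite, is
  -- cancelled.
  have hfin : ∀ s : Finset ι, ∫⁻ y, ‖∑ i ∈ s, t i y‖ₑ ^ 2 ∂ρ ≤ M * ∑ i ∈ s, p i := by
    intro s
    set g : Y → ℝ := fun y => ∑ i ∈ s, t i y with hg
    set N : ℝ≥0∞ := ∫⁻ y, ‖g y‖ₑ ^ 2 ∂ρ with hN
    have hNfin : N ≠ ∞ := by
      rw [hN, ← eLpNorm_two_sq]
      exact ENNReal.pow_ne_top (hmem s).2.ne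
    have hN1 : N ≤ ∑ i ∈ s, ‖∫ y, t i y * g y ∂ρ‖ₑ := by
      have e1 : N = ‖∫ y, g y * g y ∂ρ‖ₑ := by
        have hi : Integrable (fun y => g y * g y) ρ := (hmem s).integrable_mul (hmem s)
        rw [Real.enorm_of_nonneg (integral_nonneg fun y => mul_self_nonneg _),
          ofReal_integral_eq_lintegral_ofReal hi (Eventually.of_forall fun y => mul_self_nonneg _),
          hN]
        refine lintegral_congr fun y => ?_
        rw [Real.enorm_eq_ofReal_abs, ← ENNReal.ofReal_pow (abs_nonneg _), sq_abs, sq]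
      have e2 : ∫ y, g y * g y ∂ρ = ∑ i ∈ s, ∫ y, t i y * g y ∂ρ := by
        have hi : ∀ i ∈ s, Integrable (fun y => t i y * g y) ρ := fun i _ =>
          (ht i).integrable_mul (hmem s)
        rw [← integral_finsetSum s hi]
        simp only [hg, Finset.sum_mul]
      rw [e1, e2]
      exact enorm_sum_le _ _
    rcases eq_or_ne N 0 with h0 | h0
    · rw [h0]; exact zero_le
    have h2 : N * N ≤ (M * ∑ i ∈ s, p i) * N := by
      rw [← sq, mul_assoc]
      exact (pow_le_pow_left' hN1 2).trans (h s g (hmem s))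
    exact (ENNReal.mul_le_mul_iff_left h0 hNfin).1 h2
  set T : ι → Lp ℝ 2 ρ := fun i => (ht i).toLp (t i) with hT
  have hTsum : ∀ s : Finset ι, ∑ i ∈ s, T i = (hmem s).toLp _ := by
    intro s
    induction s using Finset.induction_on with
    | empty => simp only [Finset.sum_empty]; exact (MemLp.toLp_zero _).symm
    | insert i s hi ih =>
      rw [Finset.sum_insert hi, ih, hT, ← MemLp.toLp_add]
      congr 1
      funext y
      simp [Finset.sum_insert hi]
  have hTnorm : ∀ s : Finset ι, ‖∑ i ∈ s, T i‖ₑ ^ 2 ≤ M * ∑ i ∈ s, p i := by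
    intro s
    rw [hTsum, Lp.enorm_toLp, eLpNorm_two_sq]
    exact hfin s
  have hptop : ∑' i, p i ≠ ∞ := by
    refine ne_top_of_le_ne_top hP ?_
    rw [ENNReal.tsum_eq_iSup_sum]
    exact iSup_le hp
  -- The bound by the sum of `p` over the same finite set, not merely by `P`, makes blocks far out
  -- small. The `+ 1` covers `M = 0`.
  have hsummable : Summable T := by
    rw [summable_iff_vanishing_norm]
    intro ε hε
    have hps : Summable fun i => (p i).toReal := ENNReal.summable_toReal hptop
    obtain ⟨s, hs⟩ := summable_iff_vanishing_norm.1 hps (ε ^ 2 / (M.toReal + 1)) (by positivity)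
    refine ⟨s, fun r hr => ?_⟩
    have h1 := hs r hr
    have hpi : ∀ i ∈ r, p i ≠ ∞ := fun i _ => ENNReal.ne_top_of_tsum_ne_top hptop i
    rw [← ENNReal.toReal_sum hpi, Real.norm_of_nonneg ENNReal.toReal_nonneg,
      lt_div_iff₀ (by positivity)] at h1
    have h2 := ENNReal.toReal_mono
      (ENNReal.mul_ne_top hM (ENNReal.sum_ne_top.2 hpi)) (hTnorm r)
    rw [ENNReal.toReal_pow, toReal_enorm, ENNReal.toReal_mul] at h2
    refine lt_of_pow_lt_pow_left₀ 2 hε.le (h2.trans_lt (lt_of_le_of_lt ?_ h1))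
    nlinarith [ENNReal.toReal_nonneg (a := ∑ i ∈ r, p i)]
  obtain ⟨G, hG⟩ := hsummable
  have hG' : Tendsto (fun s : Finset ι => ∑ i ∈ s, T i) atTop (𝓝 G) := hG
  refine ⟨G, Lp.memLp G, ?_, ?_⟩
  · have h1 : Tendsto (fun s : Finset ι => ‖G - ∑ i ∈ s, T i‖ₑ) atTop (𝓝 0) := by
      have h2 := (tendsto_const_nhds (x := G)).sub hG'
      rw [sub_self] at h2
      simpa using h2.enorm
    refine h1.congr fun s => ?_
    rw [hTsum, Lp.enorm_def]
    refine eLpNorm_congr_ae ?_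
    filter_upwards [Lp.coeFn_sub G ((hmem s).toLp _), (hmem s).coeFn_toLp] with y hy1 hy2
    rw [hy1, Pi.sub_apply, hy2]
  · rw [← eLpNorm_two_sq, ← Lp.enorm_def]
    have h1 : Tendsto (fun s : Finset ι => ‖∑ i ∈ s, T i‖ₑ ^ 2) atTop (𝓝 (‖G‖ₑ ^ 2)) :=
      ((ENNReal.continuous_pow 2).tendsto _).comp hG'.enorm
    exact le_of_tendsto h1 (Eventually.of_forall fun s => (hTnorm s).trans (by gcongr; exact hp s))

namespace AtomicFiltration

variable {X : Type*} [mX : MeasurableSpace X] {μ : Measure X} {F : AtomicFiltration μ}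
  {u v : X → ℝ} {α : ℝ → ℝ}

theorem IsWeight.integral_sq_mul (hu : F.IsWeight u) {f : X → ℝ} (hf : MemLp f 2 (weighted μ u)) :
    ENNReal.ofReal (∫ x, f x ^ 2 * u x ∂μ) = ∫⁻ x, ‖f x‖ₑ ^ 2 ∂(weighted μ u) := by
  rw [hu.integral_mul, ofReal_integral_eq_lintegral_ofReal hf.integrable_sq
    (Eventually.of_forall fun x => sq_nonneg _)]
  refine lintegral_congr fun x => ?_
  rw [Real.enorm_eq_ofReal_abs, ← ENNReal.ofReal_pow (abs_nonneg _), sq_abs]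

/-- An operator is bounded if its terms satisfy a bilinear estimate by quantities for which the
embedding theorems hold. -/
theorem twoWeightBound_of_pairing (hu : F.IsWeight u) (hv : F.IsWeight v) (hα : IsPenalty α)
    {A : ℝ≥0} (hA : ∀ I ∈ F.lattice, entropyBump μ α I u * entropyBump μ α I v ≤ A)
    {ι : Type*} (I : ι → Set X) (hI : ∀ i, I i ∈ F.lattice) {term : ι → (X → ℝ) → X → ℝ}
    (hmem : ∀ i f, IntegrableOn f (I i) μ → MemLp (term i f) 2 (weighted μ v))
    (P R : ι → (X → ℝ) → ℝ≥0∞)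
    (hpair : ∀ i f h, IntegrableOn f (I i) μ → IntegrableOn h (I i) μ →
      ‖∫ x, term i f x * h x ∂μ‖ₑ ≤ P i f * R i h / μ (I i))
    (hP0 : ∀ i (f : X → ℝ), weighted μ u (I i) = 0 → P i (fun x => f x * u x) = 0)
    (hR0 : ∀ i (f : X → ℝ), weighted μ v (I i) = 0 → R i (fun x => f x * v x) = 0)
    {C₁ C₂ C : ℝ} (hC₁ : 0 ≤ C₁) (hC₂ : 0 ≤ C₂) (hC : C₁ * C₂ * A ≤ C)
    (hP : ∀ f, MemLp f 2 (weighted μ u) → ∀ s : Finset ι,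
      ∑ i ∈ s, P i (fun x => f x * u x) ^ 2 / (μ (I i) * entropyBump μ α (I i) u) ≤
        ENNReal.ofReal C₁ * ∫⁻ x, ‖f x‖ₑ ^ 2 ∂(weighted μ u))
    (hR : ∀ f, MemLp f 2 (weighted μ v) → ∀ s : Finset ι,
      ∑ i ∈ s, R i (fun x => f x * v x) ^ 2 / (μ (I i) * entropyBump μ α (I i) v) ≤
        ENNReal.ofReal C₂ * ∫⁻ x, ‖f x‖ₑ ^ 2 ∂(weighted μ v)) :
    TwoWeightBound μ term u v C := by
  intro f hf
  have hinteg : ∀ i, IntegrableOn (fun x => f x * u x) (I i) μ := fun i =>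
    hu.integrableOn_mul hf (hI i)
  have hterm := fun i => hmem i _ (hinteg i)
  have hfin : ∫⁻ x, ‖f x‖ₑ ^ 2 ∂(weighted μ u) ≠ ∞ := by
    rw [← eLpNorm_two_sq]
    exact ENNReal.pow_ne_top hf.2.ne
  obtain ⟨g, hg, hlim, hbound⟩ := exists_tendsto_of_pairing hterm
    (p := fun i => P i (fun x => f x * u x) ^ 2 / (μ (I i) * entropyBump μ α (I i) u))
    (P := ENNReal.ofReal C₁ * ∫⁻ x, ‖f x‖ₑ ^ 2 ∂(weighted μ u)) (M := A * ENNReal.ofReal C₂)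
    (ENNReal.mul_ne_top ENNReal.ofReal_ne_top hfin)
    (ENNReal.mul_ne_top ENNReal.coe_ne_top ENNReal.ofReal_ne_top) (hP f hf) (by
      intro s h hh
      have hpt : ∀ i ∈ s, ‖∫ x, term i (fun x => f x * u x) x * h x ∂(weighted μ v)‖ₑ ^ 2 ≤
          A * (P i (fun x => f x * u x) ^ 2 / (μ (I i) * entropyBump μ α (I i) u) *
            (R i (fun x => h x * v x) ^ 2 / (μ (I i) * entropyBump μ α (I i) v))) := by
        intro i _
        set p := P i (fun x => f x * u x) with hp
        set r := R i (fun x => h x * v x) with hr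
        set a := entropyBump μ α (I i) u with ha
        set b := entropyBump μ α (I i) v with hb
        have hμ0 := (F.measure_pos_of_mem_lattice (hI i)).ne'
        have hμt := (F.measure_lt_top_of_mem_lattice (hI i)).ne
        have h1 : ‖∫ x, term i (fun x => f x * u x) x * h x ∂(weighted μ v)‖ₑ ≤
            p * r / μ (I i) := by
          rw [← hv.integral_mul]
          simp_rw [mul_assoc]
          exact hpair i _ _ (hinteg i) (hv.integrableOn_mul hh (hI i))
        refine (pow_le_pow_left' h1 2).trans ?_
        -- A vanishing bump forces the weight to vanish on the atom, and then the pairing bound is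
        -- zero. If both bumps are nonzero, the bound on their product makes both finite, so they
        -- can be cancelled.
        rcases eq_or_ne a 0 with ha0 | ha0
        · have : p = 0 := by
            refine hP0 i f ?_
            by_contra hne
            exact hu.entropyBump_ne_zero hα (hI i) hne ha0
          simp [this]
        rcases eq_or_ne b 0 with hb0 | hb0
        · have : r = 0 := by
            refine hR0 i h ?_
            by_contra hne
            exact hv.entropyBump_ne_zero hα (hI i) hne hb0
          simp [this]
        have hab : a * b ≤ A := hA (I i) (hI i)
        have hat : a ≠ ∞ := by
          intro h
          rw [h, ENNReal.top_mul hb0] at hab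
          exact absurd hab (by simp)
        have hbt : b ≠ ∞ := by
          intro h
          rw [h, ENNReal.mul_top ha0] at hab
          exact absurd hab (by simp)
        calc (p * r / μ (I i)) ^ 2
            = (a * b) * (p ^ 2 / (μ (I i) * a) * (r ^ 2 / (μ (I i) * b))) := by
              simp only [div_eq_mul_inv]
              rw [ENNReal.mul_inv (Or.inl hμ0) (Or.inl hμt),
                ENNReal.mul_inv (Or.inl hμ0) (Or.inl hμt)]
              calc _ = (p * r * (μ (I i))⁻¹) ^ 2 * ((a * a⁻¹) * (b * b⁻¹)) := by
                    rw [ENNReal.mul_inv_cancel ha0 hat, ENNReal.mul_inv_cancel hb0 hbt]; simp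
                _ = _ := by ring
          _ ≤ _ := by gcongr
      refine (ENNReal.sum_sq_le_of_sq_le s hpt).trans ?_
      calc _ ≤ (A : ℝ≥0∞) * ((∑ i ∈ s, P i (fun x => f x * u x) ^ 2 /
            (μ (I i) * entropyBump μ α (I i) u)) *
            (ENNReal.ofReal C₂ * ∫⁻ x, ‖h x‖ₑ ^ 2 ∂(weighted μ v))) := by
            gcongr
            exact hR h hh s
        _ = _ := by ring)
  refine ⟨g, hg, hterm, hlim, ?_⟩
  have hnn : 0 ≤ ∫ x, f x ^ 2 * u x ∂μ :=
    integral_nonneg fun x => mul_nonneg (sq_nonneg _) (hu.nonneg x)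
  have h1 : ∫ x, g x ^ 2 * v x ∂μ ≤ C₁ * C₂ * A * ∫ x, f x ^ 2 * u x ∂μ := by
    refine (ENNReal.ofReal_le_ofReal_iff (by positivity)).1 ?_
    rw [hv.integral_sq_mul hg]
    refine hbound.trans (le_of_eq ?_)
    rw [ENNReal.ofReal_mul (by positivity), hu.integral_sq_mul hf,
      ENNReal.ofReal_mul (by positivity),
      ENNReal.ofReal_mul hC₁, ENNReal.ofReal_coe_nnreal]
    ring
  exact h1.trans (by gcongr)

end AtomicFiltration

/-! ### The three kinds of operators. -/

namespace AtomicFiltration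

variable {X : Type*} [mX : MeasurableSpace X] {μ : Measure X} {F : AtomicFiltration μ}
  {u v : X → ℝ} {α : ℝ → ℝ}

theorem sum_le_of_forall_finset_image {ι : Type*} {I : ι → Set X} (hinj : Function.Injective I)
    (hI : ∀ i, I i ∈ F.lattice) {g : Set X → ℝ≥0∞} {B : ℝ≥0∞}
    (h : ∀ s : Finset (Set X), (∀ J ∈ s, J ∈ F.lattice) → ∑ J ∈ s, g J ≤ B) (s : Finset ι) :
    ∑ i ∈ s, g (I i) ≤ B := by
  classical
  rw [← Finset.sum_image (g := I) (f := g) fun i _ j _ hij => hinj hij]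
  refine h _ fun J hJ => ?_
  obtain ⟨i, -, rfl⟩ := Finset.mem_image.1 hJ
  exact hI i

theorem IsWeight.average_mul_eq_zero (hu : F.IsWeight u) {I : Set X} (hI : I ∈ F.lattice)
    (h : weighted μ u I = 0) (f : X → ℝ) : ⨍ x in I, f x * u x ∂μ = 0 := by
  have h1 := hu.measureReal_mul_average_mul f hI
  rw [show (weighted μ u).real I = 0 by simp [Measure.real, h], zero_mul] at h1
  exact (mul_eq_zero.1 h1).resolve_left (F.measureReal_pos_of_mem_lattice hI).ne'

open Classical in
/-- The Carleson coefficients of a sparse family. -/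
def sparseCoeff (Q : Set F.lattice) (J : Set X) : ℝ≥0∞ :=
  if ∃ h : J ∈ F.lattice, ⟨J, h⟩ ∈ Q then 2⁻¹ else 0

theorem sparseCoeff_coe {Q : Set F.lattice} (I : Q) :
    sparseCoeff Q ((I : F.lattice) : Set X) = 2⁻¹ :=
  if_pos ⟨(I : F.lattice).2, I.2⟩

/-- Removing from each member the members strictly inside it leaves disjoint sets that keep at least
half of the measure. Hence the halves of the measures fit into `I`. -/
theorem IsSparse.carlesonBound {Q : Set F.lattice} (hQ : F.IsSparse Q) :
    F.CarlesonBound (fun J => sparseCoeff Q J * μ J) fun I => μ I := by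
  classical
  intro I hI s hs hsI
  set U : Set X → Set X := fun J => ⋃ L ∈ {L ∈ Q | (L : Set X) ⊂ J}, (L : Set X) with hU
  set S := s.filter fun J => ∃ h : J ∈ F.lattice, ⟨J, h⟩ ∈ Q with hS
  have hSs : ∀ J ∈ S, J ∈ s := fun J hJ => (Finset.mem_filter.1 hJ).1
  have hUm : ∀ J, MeasurableSet (U J) := by
    intro J
    have : Countable F.lattice := F.countable_lattice.to_subtype
    exact MeasurableSet.biUnion (Set.to_countable _) fun L _ => F.measurableSet_of_mem_lattice L.2
  have hle : ∀ J ∈ S, 2⁻¹ * μ J ≤ μ (J \ U J) := by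
    intro J hJ
    obtain ⟨hJl, hJQ⟩ := (Finset.mem_filter.1 hJ).2
    have h1 : μ (U J) ≤ μ J / 2 := hQ ⟨J, hJl⟩ hJQ
    have hfin : μ J / 2 ≠ ∞ :=
      ENNReal.div_ne_top (F.measure_lt_top_of_mem_lattice hJl).ne two_ne_zero
    rw [mul_comm, ← div_eq_mul_inv]
    refine (ENNReal.add_le_add_iff_right hfin).1 ?_
    rw [ENNReal.add_halves]
    calc μ J ≤ μ (J \ U J) + μ (U J) := by
          refine (measure_mono ?_).trans (measure_union_le _ _)
          rw [sdiff_union_self]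
          exact subset_union_left
      _ ≤ _ := by gcongr
  have hdisj : (S : Set (Set X)).PairwiseDisjoint fun J => J \ U J := by
    have key : ∀ J ∈ S, ∀ L ∈ S, J ≠ L → J ⊆ L → Disjoint (J \ U J) (L \ U L) := by
      intro J hJ L hL hne hJL
      obtain ⟨hJl, hJQ⟩ := (Finset.mem_filter.1 hJ).2
      refine Set.disjoint_left.2 fun x hxJ hxL => hxL.2 ?_
      exact mem_biUnion (x := ⟨J, hJl⟩) ⟨hJQ, hJL.ssubset_of_ne hne⟩ hxJ.1
    intro J hJ L hL hne
    by_cases hd : Disjoint J L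
    · exact hd.mono sdiff_subset sdiff_subset
    · obtain ⟨x, hxJ, hxL⟩ := Set.not_disjoint_iff.1 hd
      rcases F.subset_or_subset_of_mem (hs J (hSs J hJ)) (hs L (hSs L hL)) hxJ hxL with h | h
      · exact key J hJ L hL hne h
      · exact (key L hL J hJ hne.symm h).symm
  calc ∑ J ∈ s, sparseCoeff Q J * μ J = ∑ J ∈ S, 2⁻¹ * μ J := by
        rw [hS, Finset.sum_filter]
        refine Finset.sum_congr rfl fun J _ => ?_
        by_cases h : ∃ h : J ∈ F.lattice, ⟨J, h⟩ ∈ Q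
        · rw [sparseCoeff, if_pos h, if_pos h]
        · rw [sparseCoeff, if_neg h, if_neg h, zero_mul]
    _ ≤ ∑ J ∈ S, μ (J \ U J) := Finset.sum_le_sum hle
    _ = μ (⋃ J ∈ S, J \ U J) := (measure_biUnion_finset hdisj fun J hJ =>
        (F.measurableSet_of_mem_lattice (hs J (hSs J hJ))).diff (hUm J)).symm
    _ ≤ μ I := measure_mono (iUnion₂_subset fun J hJ => sdiff_subset.trans (hsI J (hSs J hJ)))

open Classical in
/-- The Carleson coefficients of a paraproduct. -/
def paraCoeff (b : ∀ I : F.lattice, F.diffSpace I) (J : Set X) : ℝ≥0∞ :=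
  if h : J ∈ F.lattice then eLpNorm (b ⟨J, h⟩ : X → ℝ) ∞ μ ^ 2 else 0

theorem paraCoeff_coe (b : ∀ I : F.lattice, F.diffSpace I) (I : F.lattice) :
    paraCoeff b (I : Set X) = eLpNorm (b I : X → ℝ) ∞ μ ^ 2 := dif_pos I.2

theorem IsNormalizedPara.carlesonBound {b : ∀ I : F.lattice, F.diffSpace I}
    (hb : F.IsNormalizedPara b) :
    F.CarlesonBound (fun J => paraCoeff b J * μ J) fun I => μ I := by
  classical
  intro I hI s hs hsI
  have h := hb ⟨I, hI⟩
  rw [mul_comm, ← div_eq_mul_inv, ENNReal.div_le_iff (F.measure_pos_of_mem_lattice hI).ne'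
    (F.measure_lt_top_of_mem_lattice hI).ne, one_mul] at h
  refine le_trans ?_ h
  calc ∑ J ∈ s, paraCoeff b J * μ J
      = ∑ J : s, paraCoeff b (J : Set X) * μ (J : Set X) := (Finset.sum_coe_sort s _).symm
    _ = ∑' J : s, eLpNorm (b ⟨J, hs J J.2⟩ : X → ℝ) ∞ μ ^ 2 * μ (J : Set X) := by
        rw [tsum_fintype]
        exact Finset.sum_congr rfl fun J _ => by rw [← paraCoeff_coe]
    _ ≤ _ := by
        refine ENNReal.tsum_comp_le_tsum_of_injective
          (f := fun J : s => (⟨⟨J, hs J J.2⟩, hsI J J.2⟩ :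
            {J : F.lattice // (J : Set X) ⊆ I})) ?_
          fun J => eLpNorm (b J : X → ℝ) ∞ μ ^ 2 * μ (J : Set X)
        intro J L hJL
        exact Subtype.ext (congrArg
          (fun J : {J : F.lattice // (J : Set X) ⊆ I} => ((J : F.lattice) : Set X)) hJL)

theorem IsNormalizedPara.eLpNorm_ne_top {b : ∀ I : F.lattice, F.diffSpace I}
    (hb : F.IsNormalizedPara b) (I : F.lattice) : eLpNorm (b I : X → ℝ) ∞ μ ≠ ∞ := by
  intro h
  have h1 := hb.carlesonBound I I.2 {(I : Set X)} (by simp) (by simp)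
  rw [Finset.sum_singleton, paraCoeff_coe, h] at h1
  have h2 := (F.measure_pos_of_mem_lattice I.2).ne'
  simp only [ne_eq, OfNat.ofNat_ne_zero, not_false_eq_true, ENNReal.top_pow, ENNReal.top_mul h2,
    top_le_iff] at h1
  exact (F.measure_lt_top_of_mem_lattice I.2).ne h1

theorem HaarShift.twoWeightBound [SFinite μ] (T : F.HaarShift) (hu : F.IsWeight u)
    (hv : F.IsWeight v) (hα : IsPenalty α) {A : ℝ≥0}
    (hA : ∀ I ∈ F.lattice, entropyBump μ α I u * entropyBump μ α I v ≤ A) :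
    TwoWeightBound μ T.term u v
      (16 * (258 * penaltyConst α) * (258 * penaltyConst α) * A) := by
  have hpos := hα.penaltyConst_pos
  -- The factor 4 from the sup bound of the terms is placed on the side of `u`; its square is the 16
  -- in `C₁`.
  refine twoWeightBound_of_pairing hu hv hα hA (fun I : F.lattice => (I : Set X)) (fun I => I.2)
    ?_ (fun I f => 4 * F.diffNorm I f) (fun I h => F.diffNorm I h) ?_ ?_ ?_
    (C₁ := 16 * (258 * penaltyConst α)) (C₂ := 258 * penaltyConst α) (by positivity)
    (by positivity) le_rfl ?_ ?_
  · intro I f hf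
    have h := T.isHaarFn_term I hf
    exact h.isChildConst.memLp_two I.2 h.abs_le (hv.weighted_ne_top I.2)
  · intro I f h hf hh
    refine ((T.isHaarFn_term I hf).enorm_integral_mul_le I.2 hh).trans (le_of_eq ?_)
    rw [ENNReal.ofReal_mul (by positivity), ENNReal.ofReal_toReal (diffNorm_ne_top I.2 hf),
      ENNReal.ofReal_mul (by norm_num),
      ENNReal.ofReal_inv_of_pos (F.measureReal_pos_of_mem_lattice I.2),
      ofReal_measureReal (F.measure_lt_top_of_mem_lattice I.2).ne, ENNReal.ofReal_ofNat,
      div_eq_mul_inv]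
    ring
  · intro I f h0
    simp only [diffNorm_eq_zero_of_weighted hu I.2 h0 f, mul_zero]
  · intro I f h0
    exact diffNorm_eq_zero_of_weighted hv I.2 h0 f
  · intro f hf s
    have h := sum_le_of_forall_finset_image (F := F) Subtype.val_injective (fun I => I.2)
      (fun s hs => hu.sum_diffNorm_mul_sq_le hα hf hs) s
    calc _ = 16 * ∑ I ∈ s, F.diffNorm I (fun x => f x * u x) ^ 2 /
          (μ (I : Set X) * entropyBump μ α I u) := by
          rw [Finset.mul_sum]
          refine Finset.sum_congr rfl fun I _ => ?_
          simp only [div_eq_mul_inv]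
          ring
      _ ≤ 16 * _ := mul_le_mul_right h _
      _ = _ := by
          rw [ENNReal.ofReal_mul (by norm_num : (0 : ℝ) ≤ 16), ENNReal.ofReal_ofNat, mul_assoc]
  · intro f hf s
    exact sum_le_of_forall_finset_image (F := F) Subtype.val_injective (fun I => I.2)
      (fun s hs => hv.sum_diffNorm_mul_sq_le hα hf hs) s

/-- The coefficients of the Carleson condition are `1/2` on the family; removing them doubles 32 to
64. -/
theorem IsSparse.sum_average_mul_sq_le [SFinite μ] {Q : Set F.lattice} (hQ : F.IsSparse Q)
    (hu : F.IsWeight u) (hα : IsPenalty α) {f : X → ℝ} (hf : MemLp f 2 (weighted μ u))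
    (s : Finset Q) :
    ∑ I ∈ s, (μ ((I : F.lattice) : Set X) *
      ‖⨍ x in ((I : F.lattice) : Set X), f x * u x ∂μ‖ₑ) ^ 2 /
        (μ ((I : F.lattice) : Set X) * entropyBump μ α ((I : F.lattice) : Set X) u) ≤
      ENNReal.ofReal (64 * penaltyConst α) * ∫⁻ x, ‖f x‖ₑ ^ 2 ∂(weighted μ u) := by
  have h := sum_le_of_forall_finset_image (F := F) (I := fun I : Q => ((I : F.lattice) : Set X))
    (Subtype.val_injective.comp Subtype.val_injective) (fun I => (I : F.lattice).2)
    (fun s hs => hu.sum_average_mul_sq_le hα hQ.carlesonBound hf hs) s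
  simp only [sparseCoeff_coe] at h
  calc _ = 2 * ∑ I ∈ s, 2⁻¹ * (μ ((I : F.lattice) : Set X) *
        ‖⨍ x in ((I : F.lattice) : Set X), f x * u x ∂μ‖ₑ) ^ 2 /
        (μ ((I : F.lattice) : Set X) * entropyBump μ α ((I : F.lattice) : Set X) u) := by
        rw [Finset.mul_sum]
        refine Finset.sum_congr rfl fun I _ => ?_
        rw [mul_div_assoc, ← mul_assoc, ENNReal.mul_inv_cancel two_ne_zero ENNReal.ofNat_ne_top,
          one_mul]
    _ ≤ 2 * _ := mul_le_mul_right h _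
    _ = _ := by
        rw [ENNReal.ofReal_mul (by norm_num), ENNReal.ofReal_mul (by norm_num)]
        norm_num
        ring

theorem IsSparse.twoWeightBound [SFinite μ] {Q : Set F.lattice} (hQ : F.IsSparse Q)
    (hu : F.IsWeight u) (hv : F.IsWeight v) (hα : IsPenalty α) {A : ℝ≥0}
    (hA : ∀ I ∈ F.lattice, entropyBump μ α I u * entropyBump μ α I v ≤ A) :
    TwoWeightBound μ (fun I : Q => F.sparseTerm I) u v
      ((64 * penaltyConst α) * (64 * penaltyConst α) * A) := by
  have hpos := hα.penaltyConst_pos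
  refine twoWeightBound_of_pairing hu hv hα hA (fun I : Q => ((I : F.lattice) : Set X))
    (fun I => (I : F.lattice).2) ?_
    (fun I f => μ ((I : F.lattice) : Set X) * ‖⨍ x in ((I : F.lattice) : Set X), f x ∂μ‖ₑ)
    (fun I f => μ ((I : F.lattice) : Set X) * ‖⨍ x in ((I : F.lattice) : Set X), f x ∂μ‖ₑ)
    ?_ ?_ ?_ (by positivity) (by positivity) le_rfl
    (fun f hf s => hQ.sum_average_mul_sq_le hu hα hf s)
    (fun f hf s => hQ.sum_average_mul_sq_le hv hα hf s)
  · intro I f _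
    exact memLp_indicator_const 2 (F.measurableSet_of_mem_lattice (I : F.lattice).2) _
      (Or.inr (hv.weighted_ne_top (I : F.lattice).2))
  · intro I f h _ _
    have hIl := (I : F.lattice).2
    have hμ0 := (F.measure_pos_of_mem_lattice hIl).ne'
    have hμt := (F.measure_lt_top_of_mem_lattice hIl).ne
    have e : ∫ x, F.sparseTerm I f x * h x ∂μ =
        (⨍ x in ((I : F.lattice) : Set X), f x ∂μ) *
          (μ.real ((I : F.lattice) : Set X) * ⨍ x in ((I : F.lattice) : Set X), h x ∂μ) := by
      rw [measureReal_mul_average hμt, ← integral_const_mul,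
        ← integral_indicator (F.measurableSet_of_mem_lattice hIl)]
      refine integral_congr_ae (Eventually.of_forall fun x => ?_)
      by_cases hx : x ∈ ((I : F.lattice) : Set X) <;> simp [sparseTerm, expect, hx]
    rw [e, enorm_mul, ← measure_mul_enorm hμt]
    refine le_of_eq ?_
    rw [mul_assoc, mul_div_assoc, ENNReal.mul_div_cancel hμ0 hμt]
  · intro I f h0
    simp [hu.average_mul_eq_zero (I : F.lattice).2 h0]
  · intro I f h0
    simp [hv.average_mul_eq_zero (I : F.lattice).2 h0]

theorem IsNormalizedPara.twoWeightBound [SFinite μ] {b : ∀ I : F.lattice, F.diffSpace I}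
    (hb : F.IsNormalizedPara b) (hu : F.IsWeight u) (hv : F.IsWeight v) (hα : IsPenalty α)
    {A : ℝ≥0} (hA : ∀ I ∈ F.lattice, entropyBump μ α I u * entropyBump μ α I v ≤ A) :
    TwoWeightBound μ (F.paraTerm b) u v
      ((32 * penaltyConst α) * (258 * penaltyConst α) * A) := by
  have hpos := hα.penaltyConst_pos
  -- The norm `‖b_I‖_∞` stays with the average of `fu`, where its square is the Carleson
  -- coefficient. On the side of `v` only `Δ_I(hv)` enters, because `b_I` is a Haar function.
  refine twoWeightBound_of_pairing hu hv hα hA (fun I : F.lattice => (I : Set X)) (fun I => I.2)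
    ?_ (fun I f => eLpNorm (b I : X → ℝ) ∞ μ * (μ (I : Set X) * ‖⨍ x in (I : Set X), f x ∂μ‖ₑ))
    (fun I h => F.diffNorm I h) ?_ ?_ ?_ (by positivity) (by positivity) le_rfl ?_ ?_
  · intro I f _
    have h := isHaarFn_paraTerm b I (hb.eLpNorm_ne_top I) f
    exact h.isChildConst.memLp_two I.2 h.abs_le (hv.weighted_ne_top I.2)
  · intro I f h _ hh
    have hμ0 := (F.measure_pos_of_mem_lattice I.2).ne'
    have hμt := (F.measure_lt_top_of_mem_lattice I.2).ne
    refine ((isHaarFn_paraTerm b I (hb.eLpNorm_ne_top I) f).enorm_integral_mul_le I.2 hh).trans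
      (le_of_eq ?_)
    rw [ENNReal.ofReal_mul (abs_nonneg _), ENNReal.ofReal_toReal (hb.eLpNorm_ne_top I),
      ← Real.enorm_eq_ofReal_abs]
    symm
    calc _ = ‖⨍ x in (I : Set X), f x ∂μ‖ₑ * eLpNorm (b I : X → ℝ) ∞ μ *
          F.diffNorm I h * μ (I : Set X) / μ (I : Set X) := by
          congr 1
          ring
      _ = _ := ENNReal.mul_div_cancel_right hμ0 hμt
  · intro I f h0
    simp [hu.average_mul_eq_zero I.2 h0]
  · intro I f h0
    exact diffNorm_eq_zero_of_weighted hv I.2 h0 f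
  · intro f hf s
    have h := sum_le_of_forall_finset_image (F := F) Subtype.val_injective (fun I => I.2)
      (fun s hs => hu.sum_average_mul_sq_le hα hb.carlesonBound hf hs) s
    simpa only [paraCoeff_coe, mul_pow _ (μ _ * _)] using h
  · intro f hf s
    exact sum_le_of_forall_finset_image (F := F) Subtype.val_injective (fun I => I.2)
      (fun s hs => hv.sum_diffNorm_mul_sq_le hα hf hs) s

end AtomicFiltration

theorem TwoWeightBound.mono {X : Type*} [MeasurableSpace X] {μ : Measure X} {ι : Type*}
    {term : ι → (X → ℝ) → X → ℝ} {u v : X → ℝ} (hu : ∀ x, 0 ≤ u x) {C C' : ℝ}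
    (h : TwoWeightBound μ term u v C) (hC : C ≤ C') : TwoWeightBound μ term u v C' := by
  intro f hf
  obtain ⟨g, hg, hterm, hlim, hle⟩ := h f hf
  exact ⟨g, hg, hterm, hlim, hle.trans (mul_le_mul_of_nonneg_right hC
    (integral_nonneg fun x => mul_nonneg (sq_nonneg _) (hu x)))⟩

end

theorem mainTheorem1 : ∃ K : ℝ, 0 < K ∧
    ∀ (X : Type*) [MeasurableSpace X] (μ : Measure X) [SigmaFinite μ] (F : AtomicFiltration μ)
      (α : ℝ → ℝ) (u v : X → ℝ) (A : ℝ≥0),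
      IsPenalty α → F.IsWeight u → F.IsWeight v →
      (∀ I ∈ F.lattice, entropyBump μ α I u * entropyBump μ α I v ≤ A) →
      -- Haar shifts of complexity `1`
      (∀ T : F.HaarShift, TwoWeightBound μ T.term u v (K * A * penaltyConst α ^ 2)) ∧
      -- sparse operators
      (∀ Q : Set F.lattice, F.IsSparse Q →
        TwoWeightBound μ (fun I : Q => F.sparseTerm I) u v (K * A * penaltyConst α ^ 2)) ∧
      -- paraproducts normalized by the `L^∞` Carleson condition
      (∀ b : ∀ I : F.lattice, F.diffSpace I, F.IsNormalizedPara b →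
        TwoWeightBound μ (F.paraTerm b) u v (K * A * penaltyConst α ^ 2)) := by
  -- The constant of the Haar shifts; it exceeds `64 · 64` for sparse operators and `32 · 258` for
  -- paraproducts.
  refine ⟨16 * 258 * 258, by norm_num, ?_⟩
  intro X _ μ _ F α u v A hα hu hv hA
  have hnn : (0 : ℝ) ≤ A * penaltyConst α ^ 2 := by positivity
  refine ⟨fun T => ?_, fun Q hQ => ?_, fun b hb => ?_⟩
  · exact (T.twoWeightBound hu hv hα hA).mono hu.nonneg (by nlinarith)
  · exact (hQ.twoWeightBound hu hv hα hA).mono hu.nonneg (by nlinarith)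
  · exact (hb.twoWeightBound hu hv hα hA).mono hu.nonneg (by nlinarith)
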